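/- **Landau solutions.** For $A>1$ put $\beta(A)=16\pi\bigl[A+\tfrac12A^2\log\tfrac{A-1}{A+1}+\tfrac{4A}{3(A^2-1)}\bigr]$, a decreasing bijection of $(1,\infty)$ onto $(0,\infty)$. For $0\ne b\in\mathbb R^3$ let $A>1$ be the number with $\beta(A)=|b|$. The Landau solution $U^b$ is the vector field on $\mathbb R^3\setminus\{0\}$ given, in spherical coordinates with $\rho=|x|$ and polar angle $\varphi$ measured from the direction $b/|b|$, by $$U^b=\frac2\rho\Bigl[\Bigl(\frac{A^2-1}{(A-\cos\varphi)^2}-1\Bigr)e_\rho-\frac{\sin\varphi}{A-\cos\varphi}\,e_\varphi\Bigr].$$ For $\varepsilon_0,C_0>0$ consider the estimate $$|U^b(x)|\le\frac{C_0|b|}{|x|},\qquad|\nabla U^b(x)|\le\frac{C_0|b|}{|x|^2}\qquad(x\ne0,\ 0<|b|<\varepsilon_0),\tag{E}$$ where $|\nabla U^b(x)|$ is the operator norm. **Operators.** Let $C^\infty_{0,\sigma}$ be the space of smooth compactly supported divergence-free vector fields $\mathbb R^3\to\mathbb C^3$, let $L^2_\sigma(\mathbb R^3)$ be its closure in $L^2(\mathbb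 R^3;\mathbb C^3)$ and $H^1_\sigma$ its completion in the $H^1$-norm. With the Leray projector $\mathbb P$, put $$L_1w=\mathbb P[-\Delta w+U^b\cdot\nabla w+\nabla\cdot(w\otimes U^b)],\qquad L_2w=\mathbb P[-\Delta w+U^b\cdot\nabla w-\nabla\cdot(w\otimes U^b)],$$ $$L_1^*v=\mathbb P\Bigl[-\Delta v-(U^b\cdot\nabla)v-\sum_{j=1}^3U^b_j\nabla v_j\Bigr],\qquad L_2^*v=\mathbb P\Bigl[-\Delta v-(U^b\cdot\nabla)v+\sum_{j=1}^3U^b_j\nabla v_j\Bigr],$$ where $\nabla\cdot(w\otimes U)$ has the components $\sum_j\partial_j(w_jU_k)$. These are unbounded operators in $L^2_\sigma(\mathbb R^3)$. The brackets are understood as distributions, $\mathbb PF=f\in L^2_\sigma$ means that $\langle F,\phi\rangle=\langle f,\phi\rangle$ for all $\phi\in C^\infty_{0,\sigma}$, and the domain of each operator is the set of all fields in $H^1_\sigma$ for which such an $f\in L^2_\sigma$ exists. **Theorem.** There are $\varepsilon_0,C_0>0$ for which (E) holds. For any $\varepsilon_0,C_0>0$ for which (E) holds, there is a function $r\mapsto\varepsilon(r)$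 such that for every $b\in\mathbb R^3$ with $0<|b|\le\min\{\varepsilon_0,\tfrac1{6C_0}\}$ the following is true, with $\varepsilon=\varepsilon(|b|)$: * $0<\varepsilon\le\pi/2$, and $L_i^*$ is the Hilbert space adjoint of $L_i$ in $L^2_\sigma(\mathbb R^3)$ for $i=1,2$; * each of the four operators $-L_1,-L_2,-L_1^*,-L_2^*$ is the infinitesimal generator of an analytic semigroup in the sector $S_\varepsilon=\{s\in\mathbb C\setminus\{0\}:|\operatorname{Arg}s|<\varepsilon\}$. That is, for each such operator $G$ there are bounded linear operators $T(s)$ on $L^2_\sigma(\mathbb R^3)$, $s\in S_\varepsilon\cup\{0\}$, such that $T(0)=I$, $T(s+t)=T(s)T(t)$, $s\mapsto T(s)$ is holomorphic on $S_\varepsilon$ in operator norm, $T(s)x\to x$ as $s\to0$ in $S_\varepsilon$ for every $x$, and $x\in D(G)$ with $Gx=y$ if and only if $(T(t)x-x)/t\to y$ as $t\downarrow0$. -/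

import Mathlib

open MeasureTheory Filter Topology
open scoped ContDiff ComplexConjugate

noncomputable section

namespace LandauMHD

/-- Physical space `ℝ³` with the Euclidean norm. -/
abbrev R3 : Type := EuclideanSpace ℝ (Fin 3)

/-- The space `ℂ³` of values of the vector fields. -/
abbrev C3 : Type := EuclideanSpace ℂ (Fin 3)

/-! ### Landau solutions -/

/-- The strength `β` of the point force of the Landau solution with parameter `A > 1`;
it is a decreasing bijection from `(1, ∞)` onto `(0, ∞)`. -/
def landauForce (A : ℝ) : ℝ :=
  16 * Real.pi *
    (A + 1 / 2 * A ^ 2 * Real.log ((A - 1) / (A + 1)) + 4 * A / (3 * (A ^ 2 - 1)))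

/-- The parameter `A > 1` with `β(A) = β`. -/
def landauParam (β : ℝ) : ℝ :=
  Classical.epsilon fun A : ℝ => 1 < A ∧ landauForce A = β

/-- The Landau solution with parameter `A` and axis the unit vector `e`. With the polar angle `φ`
measured from `e`, `cos φ = ⟨e, x⟩ / ρ`, `ρ = |x|`, the unit vectors `e_ρ = x / ρ` and `e_φ` satisfy
`- sin φ e_φ = e - cos φ e_ρ`, so this is
`(2 / ρ) (((A² - 1) / (A - cos φ)² - 1) e_ρ - (sin φ / (A - cos φ)) e_φ)`. -/
def landauProfile (A : ℝ) (e x : R3) : R3 :=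
  (2 / ‖x‖) •
    (((A ^ 2 - 1) / (A - inner ℝ e x / ‖x‖) ^ 2 - 1) • (‖x‖⁻¹ • x)
      + (1 / (A - inner ℝ e x / ‖x‖)) • (e - (inner ℝ e x / ‖x‖) • (‖x‖⁻¹ • x)))

/-- The Landau solution `U^b` for the point force `b ≠ 0`. -/
def landau (b : R3) : R3 → R3 :=
  landauProfile (landauParam ‖b‖) (‖b‖⁻¹ • b)

/-- `|U^b(x)| ≤ C₀ |b| / |x|` and `|∇U^b(x)| ≤ C₀ |b| / |x|²` for `x ≠ 0` and `0 < |b| < ε₀`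
(with the operator norm of the matrix `∇U^b(x)`). -/
def LandauEstimate (ε₀ C₀ : ℝ) : Prop :=
  ∀ b : R3, 0 < ‖b‖ → ‖b‖ < ε₀ → ∀ x : R3, x ≠ 0 →
    ‖landau b x‖ ≤ C₀ * ‖b‖ / ‖x‖ ∧ ‖fderiv ℝ (landau b) x‖ ≤ C₀ * ‖b‖ / ‖x‖ ^ 2

/-! ### Function spaces -/

/-- The partial derivative `∂ⱼ φ`. -/
def partialD (j : Fin 3) (φ : R3 → C3) (x : R3) : C3 :=
  fderiv ℝ φ x (EuclideanSpace.single j 1)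

theorem partialD_add (j : Fin 3) {φ ψ : R3 → C3} (hφ : ContDiff ℝ ∞ φ) (hψ : ContDiff ℝ ∞ ψ)
    (x : R3) : partialD j (φ + ψ) x = partialD j φ x + partialD j ψ x := by
  have h1 := hφ.differentiable (by simp) x
  have h2 := hψ.differentiable (by simp) x
  simp [partialD, fderiv_add h1 h2]

theorem partialD_smul (j : Fin 3) (c : ℂ) {φ : R3 → C3} (hφ : ContDiff ℝ ∞ φ)
    (x : R3) : partialD j (c • φ) x = c • partialD j φ x := by
  have h1 := hφ.differentiable (by simp) x
  simp [partialD, fderiv_const_smul h1 c]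

theorem partialD_zero (j : Fin 3) (x : R3) : partialD j (0 : R3 → C3) x = 0 := by
  simp [partialD]

/-- `C^∞_{0,σ}(ℝ³)`: smooth compactly supported divergence-free vector fields. -/
def testFields : Submodule ℂ (R3 → C3) where
  carrier := {φ | ContDiff ℝ ∞ φ ∧ HasCompactSupport φ ∧ ∀ x, ∑ j, partialD j φ x j = 0}
  zero_mem' := ⟨contDiff_const, HasCompactSupport.zero, fun x => by simp [partialD_zero]⟩
  add_mem' := by
    rintro φ ψ ⟨h1, h2, h3⟩ ⟨k1, k2, k3⟩
    refine ⟨h1.add k1, h2.add k2, fun x => ?_⟩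
    simp only [partialD_add _ h1 k1, PiLp.add_apply, Finset.sum_add_distrib, h3, k3, add_zero]
  smul_mem' := by
    rintro c φ ⟨h1, h2, h3⟩
    refine ⟨h1.const_smul c, h2.smul_left (f := fun _ => c), fun x => ?_⟩
    simp only [partialD_smul _ c h1, PiLp.smul_apply, smul_eq_mul, ← Finset.mul_sum, h3, mul_zero]

/-- `L²(ℝ³; ℂ³)`. -/
abbrev L2 : Type := Lp C3 2 (volume : Measure R3)

/-- `C^∞_{0,σ}(ℝ³)` as a subspace of `L²`. -/
def testL2 : Submodule ℂ L2 where
  carrier := {f | ∃ φ ∈ testFields, f =ᵐ[volume] φ}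
  zero_mem' := ⟨0, zero_mem _, Lp.coeFn_zero _ _ _⟩
  add_mem' := by
    rintro f g ⟨φ, hφ, h⟩ ⟨ψ, hψ, k⟩
    exact ⟨φ + ψ, add_mem hφ hψ, (Lp.coeFn_add f g).trans (h.add k)⟩
  smul_mem' := by
    rintro c f ⟨φ, hφ, h⟩
    exact ⟨c • φ, Submodule.smul_mem _ c hφ, (Lp.coeFn_smul c f).trans (h.const_smul c)⟩

/-- `L²_σ(ℝ³)`: the closure of `C^∞_{0,σ}(ℝ³)` in `L²`. -/
def L2σ : Submodule ℂ L2 := testL2.topologicalClosure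

/-- The Hilbert space `L² × (L²)³` of pairs `(w, (∂₁w, ∂₂w, ∂₃w))`, in which the norm of such a pair
is the `H¹`-norm of `w`. -/
abbrev Jet : Type := WithLp 2 (L2 × PiLp 2 fun _ : Fin 3 => L2)

/-- The pairs `(φ, ∇φ)` with `φ ∈ C^∞_{0,σ}(ℝ³)`. -/
def testJet : Submodule ℂ Jet where
  carrier := {u | ∃ φ ∈ testFields,
    u.fst =ᵐ[volume] φ ∧ ∀ j, u.snd j =ᵐ[volume] partialD j φ}
  zero_mem' := by
    refine ⟨0, zero_mem _, Lp.coeFn_zero _ _ _, fun j => ?_⟩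
    refine (Lp.coeFn_zero _ _ _).trans (Eventually.of_forall fun x => ?_)
    simp [partialD_zero]
  add_mem' := by
    rintro u v ⟨φ, hφ, h, h'⟩ ⟨ψ, hψ, k, k'⟩
    refine ⟨φ + ψ, add_mem hφ hψ, (Lp.coeFn_add u.fst v.fst).trans (h.add k), fun j => ?_⟩
    refine (Lp.coeFn_add (u.snd j) (v.snd j)).trans (((h' j).add (k' j)).trans ?_)
    exact Eventually.of_forall fun x => (partialD_add j hφ.1 hψ.1 x).symm
  smul_mem' := by
    rintro c u ⟨φ, hφ, h, h'⟩
    refine ⟨c • φ, Submodule.smul_mem _ c hφ, (Lp.coeFn_smul c u.fst).trans (h.const_smul c),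
      fun j => ?_⟩
    refine (Lp.coeFn_smul c (u.snd j)).trans (((h' j).const_smul c).trans ?_)
    exact Eventually.of_forall fun x => (partialD_smul j c hφ.1 x).symm

/-- `H¹_σ(ℝ³)`: the completion of `C^∞_{0,σ}(ℝ³)` in the `H¹`-norm, realised as the set of pairs
`(w, ∇w)`. -/
def H1σ : Submodule ℂ Jet := testJet.topologicalClosure

/-! ### The linearized operators

The terms of the operators are vector-valued distributions; they are paired sesquilinearly with
test fields, `⟨F, φ⟩ = ∫ F · conj φ`. A field `u ∈ H¹_σ` enters through `u.fst = w` and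
`u.snd j = ∂ⱼw`. -/

/-- `⟨-Δw, φ⟩ = ∫ ∇w : conj (∇φ)`. -/
def negLaplacian (u : Jet) (φ : R3 → C3) : ℂ :=
  ∫ x, ∑ j, ∑ k, u.snd j x k * conj (partialD j φ x k)

/-- `⟨U^b · ∇w, φ⟩ = ∫ ∑ₖ ∑ⱼ Uⱼ (∂ⱼwₖ) conj φₖ`. -/
def transport (b : R3) (u : Jet) (φ : R3 → C3) : ℂ :=
  ∫ x, ∑ j, ∑ k, (landau b x j : ℂ) * u.snd j x k * conj (φ x k)

/-- `⟨∇ · (w ⊗ U^b), φ⟩ = - ∫ ∑ₖ ∑ⱼ wⱼ Uₖ conj (∂ⱼφₖ)`, the divergence being taken in the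
distributional sense. -/
def divTensor (b : R3) (u : Jet) (φ : R3 → C3) : ℂ :=
  - ∫ x, ∑ j, ∑ k, u.fst x j * (landau b x k : ℂ) * conj (partialD j φ x k)

/-- `⟨∑ⱼ Uⱼ ∇vⱼ, φ⟩ = ∫ ∑ₖ ∑ⱼ Uⱼ (∂ₖvⱼ) conj φₖ`. -/
def gradContract (b : R3) (u : Jet) (φ : R3 → C3) : ℂ :=
  ∫ x, ∑ j, ∑ k, (landau b x j : ℂ) * u.snd k x j * conj (φ x k)

/-- The graph of the operator `w ↦ ℙ F(w)` in `L²_σ`, where `F` maps `w ∈ H¹_σ` to a distribution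
and `ℙ` is the Leray projector: `ℙ F = f ∈ L²_σ` means that `F - f` vanishes on all divergence-free
test fields, that is, `F - f` is a gradient. The domain consists of all `w ∈ H¹_σ` for which
`ℙ F(w)` belongs to `L²_σ`. -/
def lerayGraph (F : Jet → (R3 → C3) → ℂ) : Set (L2σ × L2σ) :=
  {p | ∃ u ∈ H1σ, u.fst = (p.1 : L2) ∧
    ∀ φ ∈ testFields, F u φ = ∫ x, ∑ k, (p.2 : L2) x k * conj (φ x k)}

/-- `L₁ w = ℙ [-Δw + U^b · ∇w + ∇ · (w ⊗ U^b)]`. -/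
def opL₁ (b : R3) : Set (L2σ × L2σ) :=
  lerayGraph fun u φ => negLaplacian u φ + transport b u φ + divTensor b u φ

/-- `L₂ B = ℙ [-ΔB + U^b · ∇B - ∇ · (B ⊗ U^b)]`. -/
def opL₂ (b : R3) : Set (L2σ × L2σ) :=
  lerayGraph fun u φ => negLaplacian u φ + transport b u φ - divTensor b u φ

/-- `L₁* v = ℙ [-Δv - (U^b · ∇)v - ∑ⱼ Uⱼ ∇vⱼ]`. -/
def opL₁star (b : R3) : Set (L2σ × L2σ) :=
  lerayGraph fun u φ => negLaplacian u φ - transport b u φ - gradContract b u φ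

/-- `L₂* v = ℙ [-Δv - (U^b · ∇)v + ∑ⱼ Uⱼ ∇vⱼ]`. -/
def opL₂star (b : R3) : Set (L2σ × L2σ) :=
  lerayGraph fun u φ => negLaplacian u φ - transport b u φ + gradContract b u φ

/-! ### Operators and analytic semigroups

An unbounded operator is given by its graph. -/

/-- `M` is the (graph of the) Hilbert space adjoint of `L`. -/
def IsAdjointOf {H : Type*} [NormedAddCommGroup H] [InnerProductSpace ℂ H]
    (M L : Set (H × H)) : Prop :=
  ∀ v g : H, (v, g) ∈ M ↔ ∀ w f : H, (w, f) ∈ L → inner ℂ v f = inner ℂ g w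

/-- The graph of `-L`. -/
def negGraph {X : Type*} [AddCommGroup X] (L : Set (X × X)) : Set (X × X) :=
  {p | (p.1, -p.2) ∈ L}

/-- The open sector `{s ≠ 0 : |Arg s| < ε}`. -/
def sector (ε : ℝ) : Set ℂ := {s | s ≠ 0 ∧ |s.arg| < ε}

/-- `T` is an analytic semigroup of bounded linear operators in the sector of half-angle `ε`. -/
structure IsAnalyticSemigroup {X : Type*} [NormedAddCommGroup X] [NormedSpace ℂ X]
    (ε : ℝ) (T : ℂ → X →L[ℂ] X) : Prop where
  map_zero : T 0 = ContinuousLinearMap.id ℂ X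
  map_add : ∀ s ∈ sector ε, ∀ t ∈ sector ε, T (s + t) = (T s).comp (T t)
  holomorphic : DifferentiableOn ℂ T (sector ε)
  tendsto_zero : ∀ x, Tendsto (fun s => T s x) (𝓝[sector ε] 0) (𝓝 x)

/-- The operator with graph `A` is the infinitesimal generator of `(T t)_{t ≥ 0}`: `x` is in the
domain and `A x = y` exactly when `(T t x - x) / t → y` as `t ↓ 0`. -/
def IsInfinitesimalGenerator {X : Type*} [NormedAddCommGroup X] [NormedSpace ℂ X]
    (A : Set (X × X)) (T : ℂ → X →L[ℂ] X) : Prop :=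
  ∀ x y : X, (x, y) ∈ A ↔
    Tendsto (fun t : ℝ => (t : ℂ)⁻¹ • (T (t : ℂ) x - x)) (𝓝[>] 0) (𝓝 y)

/-- The operator with graph `A` generates a semigroup which is analytic in the sector of half-angle
`ε`. -/
def GeneratesAnalyticSemigroup {X : Type*} [NormedAddCommGroup X] [NormedSpace ℂ X]
    (A : Set (X × X)) (ε : ℝ) : Prop :=
  ∃ T : ℂ → X →L[ℂ] X, IsAnalyticSemigroup ε T ∧ IsInfinitesimalGenerator A T

end LandauMHD

end

/-!
The four operators are realised by sesquilinear forms on `H¹_σ`, and everything is deduced from the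
theory of sectorial forms.

*The forms.* Tested against `v ∈ H¹_σ`, the operators `L₁`, `L₂` read
`⟨∇v, ∇u⟩ + ⟨v, U · ∇u⟩ ∓ ⟨∑ⱼ Uⱼ ∇vⱼ, u⟩` with `U = U^b`. Writing `U = |x|⁻¹ (|x| U)` and using
Hardy's inequality `‖v / |x|‖ ≤ 2 ‖∇v‖` (`norm_hardyMap_le`), each of the two lower order terms is
bounded by `2 sup (|x| |U|) ‖∇u‖ ‖∇v‖`. When `6 C₀ |b| ≤ 1` this supremum is at most `1 / 6`, so on
the diagonal both together are at most `2 / 3` of the Dirichlet form, and the values of the form lie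
in the sector `|Im z| ≤ 2 Re z` (`isSectorialForm_perturbedForm`). The estimate (E) is assumed for
`|b| < ε₀` only; the bound for `|U|` at `|b| = ε₀` follows by letting the parameter `A` tend to its
value from above (`norm_landau_le`).

*Adjoints.* The adjoint form belongs to `L₁*`, `L₂*` because `w ↦ U · ∇w` is skew-Hermitian, that
is, because `U` is divergence free also across the origin (`integral_fderiv_landau_eq_zero`). This
is seen from the vector potential `2 e × x / (A |x| - e · x)`, in which `|x|` may be regularised to
`(|x|² + δ²)^{1/2}`. That the operator of the adjoint form is the whole Hilbert space adjoint
follows from the surjectivity of `1 + L` and `1 + L*` (`IsSectorialForm.isAdjointOf`).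

*Generation.* By Lax–Milgram the operator of a sectorial form is m-sectorial
(`IsSectorialForm.isMSectorial`). For an m-sectorial operator `-A` with numerical range in
`|Im z| ≤ K Re z`, the Yosida approximations `Aₙ` have the same property, so `exp (s Aₙ)` is a
contraction for every `s` in the cone `K |Im s| ≤ Re s`; these exponentials converge strongly and
locally uniformly on the cone, and the limit is an analytic semigroup with generator `A`
(`IsMSectorial.generatesAnalyticSemigroup`). With `K = 2` the half-angle is `arctan (1 / 2)`.

*The estimate (E).* The power series of the logarithm gives
`16 π A / (A² - 1) ≤ β(A) ≤ 64 π A / (3 (A² - 1))` and the monotonicity of `β`. Hence `1 / A` is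
bounded by a multiple of `|b|`, while `|x| |U|` and `|x|² |∇U|` are bounded by multiples of `1 / A`
as soon as `A ≥ 2` (`norm_landauProfile_le`).
-/

namespace LandauMHD

/-! ### Exponentials of dissipative operators -/

section Exponential

variable {H : Type*} [NormedAddCommGroup H] [InnerProductSpace ℂ H] [CompleteSpace H]

theorem hasDerivAt_exp_real_smul (B : H →L[ℂ] H) (t : ℝ) :
    HasDerivAt (fun t : ℝ => NormedSpace.exp (t • B)) (B * NormedSpace.exp (t • B)) t :=
  hasDerivAt_exp_smul_const' B t

theorem hasDerivAt_exp_real_smul_apply (B : H →L[ℂ] H) (x : H) (t : ℝ) :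
    HasDerivAt (fun t : ℝ => NormedSpace.exp (t • B) x) (B (NormedSpace.exp (t • B) x)) t :=
  ((ContinuousLinearMap.apply ℂ H x).restrictScalars ℝ).hasFDerivAt.comp_hasDerivAt t
    (hasDerivAt_exp_real_smul B t)

/-- The exponential of a dissipative operator is a contraction: `‖exp (t B) x‖²` has derivative
`2 Re ⟨exp (t B) x, B exp (t B) x⟩ ≤ 0`. -/
theorem norm_exp_apply_le {B : H →L[ℂ] H} (hB : ∀ x, (inner ℂ x (B x)).re ≤ 0) (x : H) :
    ‖NormedSpace.exp B x‖ ≤ ‖x‖ := by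
  let : InnerProductSpace ℝ H := InnerProductSpace.complexToReal
  have hd := fun t : ℝ => HasDerivAt.norm_sq (F := H) (hasDerivAt_exp_real_smul_apply B x t)
  have hanti : AntitoneOn (fun t : ℝ => ‖NormedSpace.exp (t • B) x‖ ^ 2) Set.univ := by
    refine antitoneOn_of_deriv_nonpos convex_univ
      (fun t _ => (hd t).continuousAt.continuousWithinAt)
      (fun t _ => (hd t).differentiableAt.differentiableWithinAt) fun t _ => ?_
    rw [(hd t).deriv, real_inner_eq_re_inner ℂ]
    have := hB (NormedSpace.exp (t • B) x)
    simp only [RCLike.re_to_complex]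
    linarith
  have h := hanti (Set.mem_univ 0) (Set.mem_univ 1) zero_le_one
  simp only [one_smul, zero_smul, NormedSpace.exp_zero, one_apply_eq_self] at h
  exact (sq_le_sq₀ (norm_nonneg _) (norm_nonneg _)).1 h

/-- Two commuting contraction semigroups differ at most as much as their generators: this is the
mean value inequality along `t ↦ exp (t B) exp ((1 - t) C) x`. -/
theorem norm_exp_sub_exp_apply_le {B C : H →L[ℂ] H} (hBC : Commute B C)
    (hB : ∀ x, (inner ℂ x (B x)).re ≤ 0) (hC : ∀ x, (inner ℂ x (C x)).re ≤ 0) (x : H) :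
    ‖NormedSpace.exp B x - NormedSpace.exp C x‖ ≤ ‖B x - C x‖ := by
  have hr : ∀ (D : H →L[ℂ] H), (∀ x, (inner ℂ x (D x)).re ≤ 0) → ∀ t : ℝ, 0 ≤ t → ∀ x,
      ‖NormedSpace.exp (t • D) x‖ ≤ ‖x‖ := fun D hD t ht x => by
    refine norm_exp_apply_le (fun y => ?_) x
    have : (t • D) y = (t : ℂ) • D y := by simp
    rw [this, inner_smul_right, Complex.re_ofReal_mul]
    exact mul_nonpos_of_nonneg_of_nonpos ht (hD y)
  have hd : ∀ t : ℝ, HasDerivAt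
      (fun t : ℝ => (NormedSpace.exp (t • B) * NormedSpace.exp ((1 - t) • C)) x)
      (NormedSpace.exp (t • B) (NormedSpace.exp ((1 - t) • C) (B x - C x))) t := fun t => by
    have h1 := hasDerivAt_exp_real_smul B t
    have h2 := (hasDerivAt_exp_real_smul C (1 - t)).scomp t ((hasDerivAt_id t).const_sub 1)
    have h3 : HasDerivAt
        (fun t : ℝ => (NormedSpace.exp (t • B) * NormedSpace.exp ((1 - t) • C)) x)
        ((B * NormedSpace.exp (t • B) * NormedSpace.exp ((1 - t) • C) +
          NormedSpace.exp (t • B) * ((-1 : ℝ) • (C * NormedSpace.exp ((1 - t) • C)))) x) t :=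
      ((ContinuousLinearMap.apply ℂ H x).restrictScalars ℝ).hasFDerivAt.comp_hasDerivAt t
        (h1.mul h2)
    convert h3 using 1
    have c1 : Commute B (NormedSpace.exp (t • B)) := ((Commute.refl B).smul_right t).exp_right
    have c2 : Commute C (NormedSpace.exp ((1 - t) • C)) :=
      ((Commute.refl C).smul_right (1 - t)).exp_right
    have c3 : Commute B (NormedSpace.exp ((1 - t) • C)) := (hBC.smul_right (1 - t)).exp_right
    have e : B * NormedSpace.exp (t • B) * NormedSpace.exp ((1 - t) • C) +
        NormedSpace.exp (t • B) * ((-1 : ℝ) • (C * NormedSpace.exp ((1 - t) • C))) =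
        NormedSpace.exp (t • B) * NormedSpace.exp ((1 - t) • C) * (B - C) := by
      rw [c1.eq, mul_assoc, c3.eq, c2.eq, neg_one_smul]
      noncomm_ring
    rw [e]
    simp
  have h := norm_image_sub_le_of_norm_deriv_le_segment_01'
    (fun t _ => (hd t).hasDerivWithinAt) (C := ‖B x - C x‖) (fun t ht =>
      (hr B hB t ht.1 _).trans (hr C hC (1 - t) (by linarith [ht.2]) _))
  simpa using h

end Exponential

/-! ### Strongly holomorphic families of operators -/

section StrongHolomorphy

variable {X Y : Type*} [NormedAddCommGroup X] [NormedSpace ℂ X] [NormedAddCommGroup Y]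
  [NormedSpace ℂ Y]

/-- Cauchy's estimate for `s ↦ T s x` is uniform in `‖x‖ ≤ 1`, so that `T` is locally Lipschitz in
operator norm. -/
theorem continuousOn_of_forall_differentiableOn_apply {U : Set ℂ} (hU : IsOpen U)
    {T : ℂ → X →L[ℂ] Y} {M : ℝ} (hM : ∀ s ∈ U, ‖T s‖ ≤ M)
    (hT : ∀ x, DifferentiableOn ℂ (fun s => T s x) U) : ContinuousOn T U := by
  intro s hs
  obtain ⟨r, hr, hball⟩ := Metric.nhds_basis_closedBall.mem_iff.1 (hU.mem_nhds hs)
  have hM0 : 0 ≤ M := (norm_nonneg _).trans (hM s hs)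
  have hlip : ∀ z ∈ Metric.ball s (r / 2), ‖T z - T s‖ ≤ M / (r / 2) * ‖z - s‖ := by
    intro z hz
    refine ContinuousLinearMap.opNorm_le_bound _ (by positivity) fun x => ?_
    have hsub : ∀ w ∈ Metric.ball s (r / 2), Metric.closedBall w (r / 2) ⊆ U := by
      intro w hw v hv
      refine hball ?_
      rw [Metric.mem_closedBall] at hv ⊢
      rw [Metric.mem_ball] at hw
      linarith [dist_triangle v w s]
    have hder : ∀ w ∈ Metric.ball s (r / 2), ‖deriv (fun s => T s x) w‖ ≤ M * ‖x‖ / (r / 2) := by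
      intro w hw
      refine Complex.norm_deriv_le_of_forall_mem_sphere_norm_le (by positivity) ?_ ?_
      · exact ((hT x).mono (hsub w hw)).diffContOnCl_ball subset_rfl
      · intro v hv
        exact ((T v).le_opNorm x).trans (mul_le_mul_of_nonneg_right
          (hM v (hsub w hw (Metric.sphere_subset_closedBall hv))) (norm_nonneg _))
    have hdiff : ∀ w ∈ Metric.ball s (r / 2), DifferentiableAt ℂ (fun s => T s x) w := fun w hw =>
      (hT x).differentiableAt (hU.mem_nhds (hsub w hw (Metric.mem_closedBall_self (by positivity))))
    have := (convex_ball s (r / 2)).norm_image_sub_le_of_norm_deriv_le hdiff hder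
      (Metric.mem_ball_self (by positivity)) hz
    calc ‖(T z - T s) x‖ ≤ M * ‖x‖ / (r / 2) * ‖z - s‖ := by simpa using this
      _ = _ := by ring
  refine ContinuousAt.continuousWithinAt ?_
  rw [ContinuousAt, tendsto_iff_norm_sub_tendsto_zero]
  have hlim : Tendsto (fun z => M / (r / 2) * ‖z - s‖) (𝓝 s) (𝓝 0) := by
    have : Continuous fun z : ℂ => M / (r / 2) * ‖z - s‖ := by fun_prop
    simpa using this.tendsto s
  refine squeeze_zero' (Eventually.of_forall fun _ => norm_nonneg _) ?_ hlim
  filter_upwards [Metric.ball_mem_nhds s (by positivity : 0 < r / 2)] with z hz using hlip z hz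

/-- A bounded strongly holomorphic family of operators is holomorphic in operator norm, because it
is norm continuous and is therefore given by Cauchy's integral in operator norm. -/
theorem differentiableOn_of_forall_differentiableOn_apply [CompleteSpace Y] {U : Set ℂ}
    (hU : IsOpen U) {T : ℂ → X →L[ℂ] Y} {M : ℝ} (hM : ∀ s ∈ U, ‖T s‖ ≤ M)
    (hT : ∀ x, DifferentiableOn ℂ (fun s => T s x) U) : DifferentiableOn ℂ T U := by
  have hcont := continuousOn_of_forall_differentiableOn_apply hU hM hT
  intro s hs
  obtain ⟨r, hr, hball⟩ := Metric.nhds_basis_closedBall.mem_iff.1 (hU.mem_nhds hs)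
  lift r to NNReal using hr.le
  have hint : CircleIntegrable T s r :=
    (hcont.mono (Metric.sphere_subset_closedBall.trans hball)).circleIntegrable hr.le
  have hps := hasFPowerSeriesOn_cauchy_integral hint (by exact_mod_cast hr)
  refine ((hps.analyticAt.congr ?_).differentiableAt).differentiableWithinAt
  filter_upwards [Metric.ball_mem_nhds s hr] with w hw
  ext x
  have hc : ∀ θ : ℝ, circleMap s r θ ≠ w := fun θ h => by
    have h1 := circleMap_mem_sphere s hr.le θ
    rw [h, mem_sphere_iff_norm] at h1
    rw [mem_ball_iff_norm] at hw
    linarith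
  have hint2 : CircleIntegrable (fun z => (z - w)⁻¹ • T z) s r := by
    refine ContinuousOn.circleIntegrable hr.le ?_
    refine ContinuousOn.smul
      (ContinuousOn.inv₀ (continuousOn_id.sub continuousOn_const) fun z hz h0 => ?_)
      (hcont.mono (Metric.sphere_subset_closedBall.trans hball))
    rw [mem_sphere_iff_norm] at hz
    rw [mem_ball_iff_norm] at hw
    rw [show z = w from sub_eq_zero.1 h0] at hz
    linarith
  have happ : (∮ z in C(s, r), (z - w)⁻¹ • T z) x = ∮ z in C(s, r), (z - w)⁻¹ • T z x := by
    simp only [circleIntegral]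
    exact ContinuousLinearMap.intervalIntegral_apply hint2.out x
  have hcauchy := ((hT x).mono hball).circleIntegral_sub_inv_smul hw
  rw [smul_apply, happ, hcauchy, smul_smul, inv_mul_cancel₀, one_smul]
  exact Complex.two_pi_I_ne_zero

end StrongHolomorphy

/-! ### m-sectorial operators and their semigroups -/

section Sectorial

variable {H : Type*} [NormedAddCommGroup H] [InnerProductSpace ℂ H]

/-- The closed cone `{s : K |Im s| ≤ Re s}`, that is, `|Arg s| ≤ arctan (1 / K)` or `s = 0`. -/
def cone (K : ℝ) : Set ℂ := {s | K * |s.im| ≤ s.re}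

/-- `-A` is m-sectorial: its numerical range lies in the cone `{z : |Im z| ≤ K Re z}`, and `A` is
densely defined with every `c > 0` in its resolvent set. The operator `A` is given by its graph. -/
structure IsMSectorial (K : ℝ) (A : Submodule ℂ (H × H)) : Prop where
  pos : 0 < K
  abs_im_le : ∀ p ∈ A, |(inner ℂ p.1 p.2).im| ≤ -(K * (inner ℂ p.1 p.2).re)
  surj : ∀ c : ℝ, 0 < c → ∀ f, ∃ p ∈ A, (c : ℂ) • p.1 - p.2 = f
  dense : Dense {x : H | ∃ y, (x, y) ∈ A}

theorem re_mul_nonpos_of_mem_cone {K : ℝ} (hK : 0 < K) {s z : ℂ} (hs : s ∈ cone K)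
    (hz : |z.im| ≤ -(K * z.re)) : (s * z).re ≤ 0 := by
  have hs' : K * |s.im| ≤ s.re := hs
  rw [Complex.mul_re]
  have h1 : z.re ≤ 0 := by
    by_contra h
    have := mul_pos hK (not_le.1 h)
    linarith [abs_nonneg z.im]
  have h2 : -(s.im * z.im) ≤ |s.im| * |z.im| := by
    rw [← abs_mul]; exact neg_le_abs _
  have h3 : |s.im| * |z.im| ≤ |s.im| * -(K * z.re) := mul_le_mul_of_nonneg_left hz (abs_nonneg _)
  nlinarith

theorem add_mem_cone {K : ℝ} (hK : 0 < K) {s t : ℂ} (hs : s ∈ cone K) (ht : t ∈ cone K) :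
    s + t ∈ cone K := by
  have hs' : K * |s.im| ≤ s.re := hs
  have ht' : K * |t.im| ≤ t.re := ht
  have : K * |s.im + t.im| ≤ K * (|s.im| + |t.im|) :=
    mul_le_mul_of_nonneg_left (abs_add_le _ _) hK.le
  change K * |(s + t).im| ≤ (s + t).re
  rw [Complex.add_im, Complex.add_re]
  linarith

theorem ofReal_mem_cone {K t : ℝ} (ht : 0 ≤ t) : (t : ℂ) ∈ cone K := by
  simpa [cone] using ht

namespace IsMSectorial

variable {K : ℝ} {A : Submodule ℂ (H × H)}

theorem re_inner_nonpos (hA : IsMSectorial K A) {p : H × H} (hp : p ∈ A) :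
    (inner ℂ p.1 p.2).re ≤ 0 := by
  have := re_mul_nonpos_of_mem_cone hA.pos (ofReal_mem_cone zero_le_one) (hA.abs_im_le p hp)
  simpa using this

/-- The resolvent bound `‖c (c - A)⁻¹ f‖ ≤ ‖f‖`. -/
theorem norm_fst_le (hA : IsMSectorial K A) {c : ℝ} (hc : 0 < c) {p : H × H} (hp : p ∈ A) {f : H}
    (h : (c : ℂ) • p.1 - p.2 = (c : ℂ) • f) : ‖p.1‖ ≤ ‖f‖ := by
  have h1 := hA.re_inner_nonpos hp
  have h2 : p.2 = (c : ℂ) • (p.1 - f) := by rw [smul_sub, ← h]; abel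
  rw [h2, inner_smul_right, Complex.re_ofReal_mul, inner_sub_right, Complex.sub_re] at h1
  have h3 : (inner ℂ p.1 p.1).re = ‖p.1‖ ^ 2 := by
    simpa using inner_self_eq_norm_sq (𝕜 := ℂ) p.1
  have h4 : (inner ℂ p.1 f).re ≤ ‖p.1‖ * ‖f‖ := re_inner_le_norm (𝕜 := ℂ) p.1 f
  have h5 : (inner ℂ p.1 p.1).re - (inner ℂ p.1 f).re ≤ 0 := by
    by_contra h6
    have := mul_pos hc (not_le.1 h6)
    linarith
  rcases (norm_nonneg p.1).eq_or_lt with h0 | h0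
  · rw [← h0]; exact norm_nonneg _
  · nlinarith

theorem eq_of_smul_sub_eq (hA : IsMSectorial K A) {c : ℝ} (hc : 0 < c) {p q : H × H} (hp : p ∈ A)
    (hq : q ∈ A) (h : (c : ℂ) • p.1 - p.2 = (c : ℂ) • q.1 - q.2) : p = q := by
  have hz : (c : ℂ) • (p - q).1 - (p - q).2 = (c : ℂ) • (0 : H) := by
    rw [Prod.fst_sub, Prod.snd_sub, smul_sub, smul_zero, sub_sub_sub_comm, h, sub_self]
  have h0 := hA.norm_fst_le hc (A.sub_mem hp hq) hz
  have h1 : (p - q).1 = 0 := by simpa using h0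
  have h2 : (p - q).2 = 0 := by rwa [h1, smul_zero, zero_sub, neg_eq_zero] at hz
  exact sub_eq_zero.1 (Prod.ext h1 h2)

theorem exists_resolvent (hA : IsMSectorial K A) {c : ℝ} (hc : 0 < c) :
    ∃ J : H →L[ℂ] H, (∀ f, ‖J f‖ ≤ ‖f‖) ∧ ∀ f, (J f, (c : ℂ) • (J f - f)) ∈ A := by
  have hex : ∀ f, ∃ x, (x, (c : ℂ) • (x - f)) ∈ A := fun f => by
    obtain ⟨p, hp, h⟩ := hA.surj c hc ((c : ℂ) • f)
    refine ⟨p.1, ?_⟩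
    rw [smul_sub, ← h, sub_sub_cancel]
    exact hp
  choose J hJ using hex
  have hun : ∀ {f x : H}, (x, (c : ℂ) • (x - f)) ∈ A → J f = x := fun {f x} hx =>
    congrArg Prod.fst (hA.eq_of_smul_sub_eq hc (hJ f) hx (by simp [smul_sub]))
  have hle : ∀ f, ‖J f‖ ≤ ‖f‖ := fun f => hA.norm_fst_le hc (hJ f) (by simp [smul_sub])
  let J' : H →ₗ[ℂ] H :=
    { toFun := J
      map_add' := fun f g => hun (by
        have := A.add_mem (hJ f) (hJ g)
        rwa [Prod.mk_add_mk, ← smul_add, sub_add_sub_comm] at this)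
      map_smul' := fun a f => hun (by
        have := A.smul_mem a (hJ f)
        rwa [Prod.smul_mk, smul_comm, smul_sub] at this) }
  exact ⟨J'.mkContinuous 1 fun f => by simpa using! hle f, hle, hJ⟩

/-- The resolvents `J n = (1 - A / (n + 1))⁻¹`. -/
noncomputable def J (hA : IsMSectorial K A) (n : ℕ) : H →L[ℂ] H :=
  (hA.exists_resolvent (c := (n : ℝ) + 1) (by positivity)).choose

/-- The Yosida approximations `(n + 1) (J n - 1)` of `A`. -/
noncomputable def yosida (hA : IsMSectorial K A) (n : ℕ) : H →L[ℂ] H :=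
  (((n : ℝ) + 1 : ℝ) : ℂ) • (hA.J n - 1)

theorem norm_J_le (hA : IsMSectorial K A) (n : ℕ) (f : H) : ‖hA.J n f‖ ≤ ‖f‖ :=
  (hA.exists_resolvent (c := (n : ℝ) + 1) (by positivity)).choose_spec.1 f

theorem yosida_apply (hA : IsMSectorial K A) (n : ℕ) (f : H) :
    hA.yosida n f = (((n : ℝ) + 1 : ℝ) : ℂ) • (hA.J n f - f) := rfl

theorem J_mem (hA : IsMSectorial K A) (n : ℕ) (f : H) : (hA.J n f, hA.yosida n f) ∈ A :=
  (hA.exists_resolvent (c := (n : ℝ) + 1) (by positivity)).choose_spec.2 f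

theorem J_eq (hA : IsMSectorial K A) {n : ℕ} {f : H} {p : H × H} (hp : p ∈ A)
    (h : p.2 = (((n : ℝ) + 1 : ℝ) : ℂ) • (p.1 - f)) : hA.J n f = p.1 :=
  congrArg Prod.fst (hA.eq_of_smul_sub_eq (c := (n : ℝ) + 1) (by positivity) (hA.J_mem n f) hp
    (by rw [h, yosida_apply]; simp only [smul_sub, sub_sub_cancel]))

theorem yosida_apply_of_mem (hA : IsMSectorial K A) {p : H × H} (hp : p ∈ A) (n : ℕ) :
    hA.yosida n p.1 = hA.J n p.2 := by
  set c : ℂ := (((n : ℝ) + 1 : ℝ) : ℂ) with hc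
  have hc0 : c ≠ 0 := by
    rw [hc]; exact_mod_cast (by positivity : (n : ℝ) + 1 ≠ 0)
  have h := hA.J_eq (n := n) (f := p.1) (A.add_mem hp (A.smul_mem c⁻¹ (hA.J_mem n p.2))) (by
    rw [yosida_apply, ← hc, Prod.snd_add, Prod.fst_add, Prod.smul_snd, Prod.smul_fst, smul_smul,
      inv_mul_cancel₀ hc0, one_smul, add_sub_cancel_left, smul_smul, mul_inv_cancel₀ hc0, one_smul,
      add_sub_cancel])
  rw [yosida_apply, h, ← hc, Prod.fst_add, Prod.smul_fst, add_sub_cancel_left, smul_smul,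
    mul_inv_cancel₀ hc0, one_smul]

theorem J_mem_of_mem (hA : IsMSectorial K A) {p : H × H} (hp : p ∈ A) (n : ℕ) :
    (hA.J n p.1, hA.J n p.2) ∈ A := by
  rw [← hA.yosida_apply_of_mem hp]
  exact hA.J_mem n p.1

theorem J_commute (hA : IsMSectorial K A) (m n : ℕ) : Commute (hA.J m) (hA.J n) := by
  ext f
  have h := hA.J_mem_of_mem (hA.J_mem n f) m
  exact (hA.J_eq h (by simp [yosida_apply])).symm

theorem yosida_commute (hA : IsMSectorial K A) (m n : ℕ) :
    Commute (hA.yosida m) (hA.yosida n) :=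
  ((((hA.J_commute m n).sub_left (Commute.one_left _)).sub_right
    (Commute.one_right _)).smul_right _).smul_left _

/-- The Yosida approximations satisfy the sector condition of `A`, because
`⟨f, Aₙ f⟩ = ⟨J f, A J f⟩ - ‖Aₙ f‖² / (n + 1)`. -/
theorem abs_im_inner_yosida_le (hA : IsMSectorial K A) (n : ℕ) (f : H) :
    |(inner ℂ f (hA.yosida n f)).im| ≤ -(K * (inner ℂ f (hA.yosida n f)).re) := by
  set c : ℝ := (n : ℝ) + 1 with hc
  have hc0 : 0 < c := by positivity
  have hf : f = hA.J n f - ((c⁻¹ : ℝ) : ℂ) • hA.yosida n f := by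
    rw [yosida_apply, ← hc, smul_smul, ← Complex.ofReal_mul, inv_mul_cancel₀ hc0.ne',
      Complex.ofReal_one, one_smul, sub_sub_cancel]
  have h1 : inner ℂ f (hA.yosida n f) =
      inner ℂ (hA.J n f) (hA.yosida n f) - ((c⁻¹ * ‖hA.yosida n f‖ ^ 2 : ℝ) : ℂ) := by
    calc inner ℂ f (hA.yosida n f)
        = inner ℂ (hA.J n f - ((c⁻¹ : ℝ) : ℂ) • hA.yosida n f) (hA.yosida n f) :=
          congrArg (fun g => inner ℂ g (hA.yosida n f)) hf
      _ = _ := by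
        rw [inner_sub_left, inner_smul_left, inner_self_eq_norm_sq_to_K, Complex.conj_ofReal]
        push_cast
        rfl
  have h2 := hA.abs_im_le _ (hA.J_mem n f)
  rw [h1, Complex.sub_im, Complex.sub_re, Complex.ofReal_im, Complex.ofReal_re, sub_zero]
  have h3 : 0 ≤ K * (c⁻¹ * ‖hA.yosida n f‖ ^ 2) := mul_nonneg hA.pos.le (by positivity)
  simp only at h2
  linarith

theorem re_inner_smul_yosida_nonpos (hA : IsMSectorial K A) {s : ℂ} (hs : s ∈ cone K) (n : ℕ)
    (f : H) : (inner ℂ f ((s • hA.yosida n) f)).re ≤ 0 := by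
  rw [smul_apply, inner_smul_right]
  exact re_mul_nonpos_of_mem_cone hA.pos hs (hA.abs_im_inner_yosida_le n f)

theorem tendsto_J (hA : IsMSectorial K A) (y : H) :
    Tendsto (fun n => hA.J n y) atTop (𝓝 y) := by
  rw [Metric.tendsto_atTop]
  intro ε hε
  obtain ⟨x, ⟨z, hz⟩, hx⟩ := hA.dense.exists_dist_lt y (ε := ε / 3) (by positivity)
  obtain ⟨N, hN⟩ := exists_nat_gt (‖z‖ * 3 / ε)
  refine ⟨N, fun n hn => ?_⟩
  have hn' : ‖z‖ * 3 / ε < (n : ℝ) + 1 := hN.trans_le (by exact_mod_cast hn.trans n.le_succ)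
  have h1 : ((n : ℝ) + 1) * ‖hA.J n x - x‖ ≤ ‖z‖ := by
    have h := hA.norm_J_le n z
    rw [← hA.yosida_apply_of_mem hz n, yosida_apply, norm_smul, Complex.norm_real,
      Real.norm_of_nonneg (by positivity)] at h
    exact h
  have h2 : ‖hA.J n x - x‖ < ε / 3 := by
    rw [div_lt_iff₀ hε] at hn'
    by_contra h
    nlinarith [mul_le_mul_of_nonneg_left (not_lt.1 h) (by positivity : (0 : ℝ) ≤ (n : ℝ) + 1)]
  have h3 : hA.J n y - y = hA.J n (y - x) + (hA.J n x - x) - (y - x) := by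
    rw [map_sub]; abel
  rw [dist_eq_norm] at hx
  rw [dist_eq_norm, h3]
  calc _ ≤ ‖hA.J n (y - x)‖ + ‖hA.J n x - x‖ + ‖y - x‖ :=
        (norm_sub_le _ _).trans (add_le_add_left (norm_add_le _ _) _)
    _ < ε := by linarith [hA.norm_J_le n (y - x)]

theorem norm_exp_yosida_le [CompleteSpace H] (hA : IsMSectorial K A) {s : ℂ} (hs : s ∈ cone K)
    (n : ℕ) (x : H) : ‖NormedSpace.exp (s • hA.yosida n) x‖ ≤ ‖x‖ :=
  norm_exp_apply_le (hA.re_inner_smul_yosida_nonpos hs n) x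

/-- On bounded parts of the cone `exp (s Aₙ) x` is uniformly Cauchy. For `x` in the domain of `A`,
`norm_exp_sub_exp_apply_le` bounds the differences by `|s| ‖(J m - J n) A x‖`; the general case
follows by density, the exponentials being contractions. -/
theorem uniformCauchySeqOn_exp_yosida [CompleteSpace H] (hA : IsMSectorial K A) (R : ℝ) (x : H) :
    UniformCauchySeqOn (fun n (s : ℂ) => NormedSpace.exp (s • hA.yosida n) x) atTop
      (cone K ∩ Metric.closedBall 0 R) := by
  rw [Metric.uniformCauchySeqOn_iff]
  intro ε hε
  obtain ⟨x', ⟨y, hy⟩, hx⟩ := hA.dense.exists_dist_lt x (ε := ε / 4) (by positivity)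
  have hcau := (hA.tendsto_J y).cauchySeq
  obtain ⟨N, hN⟩ := Metric.cauchySeq_iff.1 hcau (ε / (2 * (|R| + 1))) (by positivity)
  refine ⟨N, fun m hm n hn s ⟨hs, hsR⟩ => ?_⟩
  have h1 := hN m hm n hn
  rw [dist_eq_norm, lt_div_iff₀ (by positivity)] at h1
  have h2 := norm_exp_sub_exp_apply_le
    (((hA.yosida_commute m n).smul_right s).smul_left s)
    (hA.re_inner_smul_yosida_nonpos hs m) (hA.re_inner_smul_yosida_nonpos hs n) x'
  have h3 : ‖(s • hA.yosida m) x' - (s • hA.yosida n) x'‖ ≤ (|R| + 1) * ‖hA.J m y - hA.J n y‖ := by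
    rw [smul_apply, smul_apply, ← smul_sub, norm_smul, hA.yosida_apply_of_mem hy,
      hA.yosida_apply_of_mem hy]
    rw [mem_closedBall_zero_iff] at hsR
    exact mul_le_mul_of_nonneg_right (by linarith [le_abs_self R]) (norm_nonneg _)
  rw [dist_eq_norm] at hx ⊢
  have h4 : NormedSpace.exp (s • hA.yosida m) x - NormedSpace.exp (s • hA.yosida n) x =
      NormedSpace.exp (s • hA.yosida m) (x - x') - NormedSpace.exp (s • hA.yosida n) (x - x') +
      (NormedSpace.exp (s • hA.yosida m) x' - NormedSpace.exp (s • hA.yosida n) x') := by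
    rw [map_sub, map_sub]; abel
  rw [h4]
  calc _ ≤ ‖NormedSpace.exp (s • hA.yosida m) (x - x')‖ +
          ‖NormedSpace.exp (s • hA.yosida n) (x - x')‖ +
          ‖NormedSpace.exp (s • hA.yosida m) x' - NormedSpace.exp (s • hA.yosida n) x'‖ :=
        (norm_add_le _ _).trans (add_le_add_left (norm_sub_le _ _) _)
    _ < ε := by
      linarith [hA.norm_exp_yosida_le hs m (x - x'), hA.norm_exp_yosida_le hs n (x - x')]

theorem exists_limit_exp_yosida [CompleteSpace H] (hA : IsMSectorial K A) :
    ∃ T : ℂ → H →L[ℂ] H, ∀ s ∈ cone K, ∀ x,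
      Tendsto (fun n => NormedSpace.exp (s • hA.yosida n) x) atTop (𝓝 (T s x)) := by
  have h : ∀ s : ℂ, ∃ T : H →L[ℂ] H, s ∈ cone K → ∀ x,
      Tendsto (fun n => NormedSpace.exp (s • hA.yosida n) x) atTop (𝓝 (T x)) := by
    intro s
    by_cases hs : s ∈ cone K
    · have hlim : ∀ x, ∃ y, Tendsto (fun n => NormedSpace.exp (s • hA.yosida n) x) atTop (𝓝 y) :=
        fun x => cauchySeq_tendsto_of_complete ((hA.uniformCauchySeqOn_exp_yosida ‖s‖ x).cauchySeq
          ⟨hs, by simp⟩)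
      choose f hf using hlim
      exact ⟨continuousLinearMapOfTendsto (fun n => NormedSpace.exp (s • hA.yosida n))
        (tendsto_pi_nhds.2 hf), fun _ => hf⟩
    · exact ⟨0, fun h => absurd h hs⟩
  choose T hT using h
  exact ⟨T, hT⟩

/-- The analytic semigroup generated by `A`, the strong limit of the exponentials of the Yosida
approximations; only its values on `cone K` are meaningful. -/
noncomputable def semigroup [CompleteSpace H] (hA : IsMSectorial K A) : ℂ → H →L[ℂ] H :=
  hA.exists_limit_exp_yosida.choose

variable [CompleteSpace H]

theorem tendsto_semigroup (hA : IsMSectorial K A) {s : ℂ} (hs : s ∈ cone K) (x : H) :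
    Tendsto (fun n => NormedSpace.exp (s • hA.yosida n) x) atTop (𝓝 (hA.semigroup s x)) :=
  hA.exists_limit_exp_yosida.choose_spec s hs x

theorem tendstoUniformlyOn_semigroup (hA : IsMSectorial K A) (R : ℝ) (x : H) :
    TendstoUniformlyOn (fun n (s : ℂ) => NormedSpace.exp (s • hA.yosida n) x)
      (fun s => hA.semigroup s x) atTop (cone K ∩ Metric.closedBall 0 R) :=
  (hA.uniformCauchySeqOn_exp_yosida R x).tendstoUniformlyOn_of_tendsto
    fun _ hs => hA.tendsto_semigroup hs.1 x

theorem norm_semigroup_le (hA : IsMSectorial K A) {s : ℂ} (hs : s ∈ cone K) (x : H) :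
    ‖hA.semigroup s x‖ ≤ ‖x‖ :=
  le_of_tendsto (hA.tendsto_semigroup hs x).norm
    (Eventually.of_forall fun n => hA.norm_exp_yosida_le hs n x)

theorem semigroup_zero (hA : IsMSectorial K A) : hA.semigroup 0 = ContinuousLinearMap.id ℂ H := by
  ext x
  have h := hA.tendsto_semigroup (s := 0) (by simp [cone]) x
  simp only [zero_smul, NormedSpace.exp_zero] at h
  exact tendsto_nhds_unique h tendsto_const_nhds

theorem semigroup_add (hA : IsMSectorial K A) {s t : ℂ} (hs : s ∈ cone K) (ht : t ∈ cone K) :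
    hA.semigroup (s + t) = (hA.semigroup s).comp (hA.semigroup t) := by
  ext x
  refine tendsto_nhds_unique (hA.tendsto_semigroup (add_mem_cone hA.pos hs ht) x) ?_
  have h1 : ∀ n, NormedSpace.exp ((s + t) • hA.yosida n) x =
      NormedSpace.exp (s • hA.yosida n) (NormedSpace.exp (t • hA.yosida n) x - hA.semigroup t x) +
        NormedSpace.exp (s • hA.yosida n) (hA.semigroup t x) := fun n => by
    let : NormedAlgebra ℚ (H →L[ℂ] H) := NormedAlgebra.restrictScalars ℚ ℂ _
    rw [← map_add, sub_add_cancel, add_smul, NormedSpace.exp_add_of_commute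
      (((Commute.refl _).smul_right t).smul_left s)]
    rfl
  simp only [h1]
  have h2 : Tendsto (fun n => NormedSpace.exp (s • hA.yosida n)
      (NormedSpace.exp (t • hA.yosida n) x - hA.semigroup t x)) atTop (𝓝 0) :=
    squeeze_zero_norm (fun n => hA.norm_exp_yosida_le hs n _)
      (tendsto_iff_norm_sub_tendsto_zero.1 (hA.tendsto_semigroup ht x))
  simpa using h2.add (hA.tendsto_semigroup hs (hA.semigroup t x))

theorem continuous_exp_smul_apply (B : H →L[ℂ] H) (x : H) :
    Continuous fun s : ℂ => NormedSpace.exp (s • B) x := by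
  have h1 : Continuous fun s : ℂ => NormedSpace.exp (s • B) :=
    continuous_iff_continuousAt.2 fun s => (hasDerivAt_exp_smul_const B s).continuousAt
  exact h1.clm_apply continuous_const

theorem continuousOn_semigroup (hA : IsMSectorial K A) (R : ℝ) (x : H) :
    ContinuousOn (fun s => hA.semigroup s x) (cone K ∩ Metric.closedBall 0 R) :=
  (hA.tendstoUniformlyOn_semigroup R x).continuousOn
    (Frequently.of_forall fun _ => (continuous_exp_smul_apply _ x).continuousOn)

theorem tendsto_semigroup_zero (hA : IsMSectorial K A) (x : H) :
    Tendsto (fun s => hA.semigroup s x) (𝓝[cone K] 0) (𝓝 x) := by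
  have h := (hA.continuousOn_semigroup 1 x) 0 (by simp [cone])
  rw [ContinuousWithinAt, hA.semigroup_zero, nhdsWithin_inter_of_mem'
    (mem_nhdsWithin_of_mem_nhds (Metric.closedBall_mem_nhds _ one_pos))] at h
  exact h

/-- The open cone `{s : K |Im s| < Re s}`. -/
def openCone (K : ℝ) : Set ℂ := {s | K * |s.im| < s.re}

theorem isOpen_openCone (K : ℝ) : IsOpen (openCone K) :=
  isOpen_lt (by fun_prop) Complex.continuous_re

theorem openCone_subset_cone (K : ℝ) : openCone K ⊆ cone K := fun s hs =>
  (show K * |s.im| < s.re from hs).le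

theorem differentiableOn_semigroup (hA : IsMSectorial K A) :
    DifferentiableOn ℂ hA.semigroup (openCone K) := by
  refine differentiableOn_of_forall_differentiableOn_apply (isOpen_openCone K) (M := 1)
    (fun s hs => ContinuousLinearMap.opNorm_le_bound _ zero_le_one fun x => by
      simpa using hA.norm_semigroup_le (openCone_subset_cone K hs) x) fun x => ?_
  have hloc : TendstoLocallyUniformlyOn
      (fun n (s : ℂ) => NormedSpace.exp (s • hA.yosida n) x)
      (fun s => hA.semigroup s x) atTop (openCone K) := by
    rw [tendstoLocallyUniformlyOn_iff_forall_isCompact (isOpen_openCone K)]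
    intro C hC hCK
    obtain ⟨R, hR⟩ := hCK.isBounded.subset_closedBall 0
    exact (hA.tendstoUniformlyOn_semigroup R x).mono
      fun s hs => ⟨openCone_subset_cone K (hC hs), hR hs⟩
  refine hloc.differentiableOn (Eventually.of_forall fun n s _ => ?_) (isOpen_openCone K)
  exact (((hasDerivAt_exp_smul_const (hA.yosida n) s).differentiableAt).clm_apply
    (differentiableAt_const x)).differentiableWithinAt

/-- If `(x, y) ∈ A` then `T(t) x - x - t y` is small compared with `t`. -/
theorem norm_semigroup_sub_le (hA : IsMSectorial K A) {p : H × H} (hp : p ∈ A) {t ε : ℝ}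
    (ht : 0 ≤ t) (hε : ∀ r ∈ Set.Icc 0 t, ‖hA.semigroup (r : ℂ) p.2 - p.2‖ ≤ ε) :
    ‖hA.semigroup (t : ℂ) p.1 - p.1 - (t : ℂ) • p.2‖ ≤ ε * t := by
  have key : ∀ η : ℝ, 0 < η →
      ‖hA.semigroup (t : ℂ) p.1 - p.1 - (t : ℂ) • p.2‖ ≤ (ε + 2 * η) * t := by
    intro η hη
    have hlim : Tendsto (fun n => ‖NormedSpace.exp ((t : ℂ) • hA.yosida n) p.1 - p.1 -
        (t : ℂ) • p.2‖) atTop (𝓝 ‖hA.semigroup (t : ℂ) p.1 - p.1 - (t : ℂ) • p.2‖) :=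
      (((hA.tendsto_semigroup (ofReal_mem_cone ht) p.1).sub_const _).sub_const _).norm
    refine le_of_tendsto hlim ?_
    have hun := Metric.tendstoUniformlyOn_iff.1 (hA.tendstoUniformlyOn_semigroup t p.2) η hη
    filter_upwards [hun, (Metric.tendsto_nhds.1 (hA.tendsto_J p.2)) η hη] with n h1 h2
    have hd : ∀ r : ℝ, HasDerivAt
        (fun r : ℝ => NormedSpace.exp ((r : ℂ) • hA.yosida n) p.1 - (r : ℂ) • p.2)
        (NormedSpace.exp ((r : ℂ) • hA.yosida n) (hA.J n p.2) - p.2) r := fun r => by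
      have h3 := (hasDerivAt_exp_real_smul_apply (hA.yosida n) p.1 r).sub
        ((hasDerivAt_id r).smul_const p.2)
      have hcomm : Commute (hA.yosida n) (NormedSpace.exp (r • hA.yosida n)) :=
        ((Commute.refl _).smul_right r).exp_right
      have h4 : hA.yosida n (NormedSpace.exp (r • hA.yosida n) p.1) =
          NormedSpace.exp (r • hA.yosida n) (hA.J n p.2) := by
        rw [← hA.yosida_apply_of_mem hp n]
        exact DFunLike.congr_fun hcomm.eq p.1
      rw [h4, one_smul] at h3
      simpa only [Complex.coe_smul] using! h3
    have hmv := norm_image_sub_le_of_norm_deriv_le_segment' (f := fun r : ℝ =>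
        NormedSpace.exp ((r : ℂ) • hA.yosida n) p.1 - (r : ℂ) • p.2) (C := ε + 2 * η)
      (fun r _ => (hd r).hasDerivWithinAt) (fun r hr => ?_) t (Set.right_mem_Icc.2 ht)
    · simp only [Complex.ofReal_zero, zero_smul, NormedSpace.exp_zero, sub_zero] at hmv
      rwa [one_apply_eq_self, sub_right_comm] at hmv
    · have hc := ofReal_mem_cone (K := K) hr.1
      have h5 := h1 (r : ℂ) ⟨hc, by
        rw [mem_closedBall_zero_iff, Complex.norm_real, Real.norm_of_nonneg hr.1]
        exact hr.2.le⟩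
      have h6 := hε r ⟨hr.1, hr.2.le⟩
      have h7 := hA.norm_exp_yosida_le hc n (hA.J n p.2 - p.2)
      rw [dist_eq_norm] at h2
      rw [dist_comm, dist_eq_norm] at h5
      have h8 : NormedSpace.exp ((r : ℂ) • hA.yosida n) (hA.J n p.2) - p.2 =
          NormedSpace.exp ((r : ℂ) • hA.yosida n) (hA.J n p.2 - p.2) +
          (NormedSpace.exp ((r : ℂ) • hA.yosida n) p.2 - hA.semigroup (r : ℂ) p.2) +
          (hA.semigroup (r : ℂ) p.2 - p.2) := by
        rw [map_sub]; abel
      rw [h8]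
      calc _ ≤ _ := norm_add₃_le
        _ ≤ _ := by linarith
  have hl : Tendsto (fun η : ℝ => (ε + 2 * η) * t) (𝓝[>] 0) (𝓝 (ε * t)) := by
    have : Continuous fun η : ℝ => (ε + 2 * η) * t := by fun_prop
    have h := this.tendsto 0
    rw [mul_zero, add_zero] at h
    exact h.mono_left nhdsWithin_le_nhds
  refine ge_of_tendsto hl ?_
  filter_upwards [self_mem_nhdsWithin] with η hη using key η hη

theorem isInfinitesimalGenerator_semigroup (hA : IsMSectorial K A) :
    IsInfinitesimalGenerator (A : Set (H × H)) hA.semigroup := by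
  have hfwd : ∀ x y : H, (x, y) ∈ A →
      Tendsto (fun t : ℝ => (t : ℂ)⁻¹ • (hA.semigroup (t : ℂ) x - x)) (𝓝[>] 0) (𝓝 y) := by
    intro x y hxy
    rw [Metric.tendsto_nhds]
    intro ε hε
    have hto : Tendsto (fun t : ℝ => hA.semigroup (t : ℂ) y) (𝓝[≥] 0) (𝓝 y) := by
      refine (hA.tendsto_semigroup_zero y).comp (tendsto_nhdsWithin_iff.2 ⟨?_, ?_⟩)
      · have : Tendsto (fun t : ℝ => (t : ℂ)) (𝓝 0) (𝓝 ((0 : ℝ) : ℂ)) :=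
          Complex.continuous_ofReal.tendsto 0
        rw [Complex.ofReal_zero] at this
        exact this.mono_left nhdsWithin_le_nhds
      · filter_upwards [self_mem_nhdsWithin] with t ht using ofReal_mem_cone ht
    have hev := (Metric.tendsto_nhds.1 hto) (ε / 2) (by positivity)
    obtain ⟨δ, hδ, hsub⟩ := Metric.mem_nhdsWithin_iff.1 hev
    filter_upwards [Ioo_mem_nhdsGT hδ] with t ht
    have hb := hA.norm_semigroup_sub_le hxy ht.1.le (ε := ε / 2) fun r hr => by
      have : r ∈ Metric.ball (0 : ℝ) δ ∩ Set.Ici 0 :=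
        ⟨by rw [mem_ball_zero_iff, Real.norm_of_nonneg hr.1]; exact hr.2.trans_lt ht.2, hr.1⟩
      have h := hsub this
      rw [Set.mem_ofPred_eq, dist_eq_norm] at h
      exact h.le
    have ht0 : (t : ℂ) ≠ 0 := by exact_mod_cast ht.1.ne'
    have he : (t : ℂ)⁻¹ • (hA.semigroup (t : ℂ) x - x) - y =
        (t : ℂ)⁻¹ • (hA.semigroup (t : ℂ) x - x - (t : ℂ) • y) := by
      rw [smul_sub _ _ ((t : ℂ) • y), smul_smul, inv_mul_cancel₀ ht0, one_smul]
    rw [dist_eq_norm, he, norm_smul, norm_inv, Complex.norm_real, Real.norm_of_nonneg ht.1.le]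
    calc t⁻¹ * _ ≤ t⁻¹ * (ε / 2 * t) := mul_le_mul_of_nonneg_left hb (inv_nonneg.2 ht.1.le)
      _ = ε / 2 := by field_simp [ht.1.ne']
      _ < ε := by linarith
  refine fun x y => ⟨hfwd x y, fun hxy => ?_⟩
  -- The generator is a dissipative extension of `A`, and `1 - A` is already onto.
  obtain ⟨p, hp, hpe⟩ := hA.surj 1 one_pos (x - y)
  have hz : Tendsto (fun t : ℝ => (t : ℂ)⁻¹ • (hA.semigroup (t : ℂ) (x - p.1) - (x - p.1)))
      (𝓝[>] 0) (𝓝 (y - p.2)) := by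
    refine (hxy.sub (hfwd p.1 p.2 hp)).congr fun t => ?_
    rw [← smul_sub, map_sub]
    congr 1
    abel
  have hyz : y - p.2 = x - p.1 := by
    rw [Complex.ofReal_one, one_smul] at hpe
    have : y - p.2 - (x - p.1) = (p.1 - p.2) - (x - y) := by abel
    rw [← sub_eq_zero, this, hpe, sub_self]
  rw [hyz] at hz
  set z := x - p.1
  have hre : (inner ℂ z z).re ≤ 0 := by
    have hl : Tendsto (fun t : ℝ => (inner ℂ z ((t : ℂ)⁻¹ • (hA.semigroup (t : ℂ) z - z))).re)
        (𝓝[>] 0) (𝓝 (inner ℂ z z).re) :=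
      (Complex.continuous_re.tendsto _).comp (tendsto_const_nhds.inner hz)
    refine le_of_tendsto hl ?_
    filter_upwards [self_mem_nhdsWithin] with t ht
    have ht' : (0 : ℝ) < t := ht
    rw [inner_smul_right, ← Complex.ofReal_inv, Complex.re_ofReal_mul]
    refine mul_nonpos_of_nonneg_of_nonpos (inv_nonneg.2 ht'.le) ?_
    rw [inner_sub_right, Complex.sub_re]
    have h3 : (inner ℂ z z).re = ‖z‖ ^ 2 := by
      simpa using inner_self_eq_norm_sq (𝕜 := ℂ) z
    have h4 : (inner ℂ z (hA.semigroup (t : ℂ) z)).re ≤ ‖z‖ * ‖hA.semigroup (t : ℂ) z‖ :=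
      re_inner_le_norm (𝕜 := ℂ) _ _
    have h5 := hA.norm_semigroup_le (ofReal_mem_cone ht'.le) z
    nlinarith [norm_nonneg z]
  have hz0 : z = 0 := by
    have h3 : (inner ℂ z z).re = ‖z‖ ^ 2 := by
      simpa using inner_self_eq_norm_sq (𝕜 := ℂ) z
    rw [h3] at hre
    exact norm_eq_zero.1 (pow_eq_zero_iff two_ne_zero |>.1 (le_antisymm hre (sq_nonneg _)))
  have hx : x = p.1 := sub_eq_zero.1 hz0
  have hy : y = p.2 := sub_eq_zero.1 (hyz.trans hz0)
  rw [hx, hy]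
  exact hp

theorem sector_subset_openCone (hK : 0 < K) : sector (Real.arctan (1 / K)) ⊆ openCone K := by
  intro s ⟨hs0, hs⟩
  have hpi := Real.arctan_lt_pi_div_two (1 / K)
  have hlt : |s.arg| < Real.pi / 2 := hs.trans hpi
  have hre : 0 < s.re := by
    rcases Complex.abs_arg_lt_pi_div_two_iff.1 hlt with h | h
    · exact h
    · exact absurd h hs0
  have htan : |Real.tan s.arg| < 1 / K := by
    rw [← Real.tan_arctan (1 / K)]
    rw [abs_lt] at hs hlt ⊢
    rw [← Real.tan_neg]
    have hneg : -(Real.pi / 2) < -Real.arctan (1 / K) := by linarith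
    exact ⟨Real.tan_lt_tan_of_lt_of_lt_pi_div_two hneg hlt.2 hs.1,
      Real.tan_lt_tan_of_lt_of_lt_pi_div_two hlt.1 hpi hs.2⟩
  rw [Complex.tan_arg, abs_div, abs_of_pos hre, div_lt_div_iff₀ hre hK] at htan
  change K * |s.im| < s.re
  linarith

/-- An m-sectorial operator generates a contraction semigroup which is analytic in the sector
of half-angle `arctan (1 / K) = π / 2 - arctan K`. -/
theorem generatesAnalyticSemigroup (hA : IsMSectorial K A) :
    GeneratesAnalyticSemigroup (A : Set (H × H)) (Real.arctan (1 / K)) := by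
  have hsub := sector_subset_openCone hA.pos
  have hsub' := hsub.trans (openCone_subset_cone K)
  exact ⟨hA.semigroup,
    { map_zero := hA.semigroup_zero
      map_add := fun s hs t ht => hA.semigroup_add (hsub' hs) (hsub' ht)
      holomorphic := hA.differentiableOn_semigroup.mono hsub
      tendsto_zero := fun x => (hA.tendsto_semigroup_zero x).mono_left (nhdsWithin_mono _ hsub') },
    hA.isInfinitesimalGenerator_semigroup⟩

end IsMSectorial

end Sectorial

/-! ### Operators associated with sectorial forms -/

section Form

variable {V H : Type*} [NormedAddCommGroup V] [InnerProductSpace ℂ V]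
  [NormedAddCommGroup H] [InnerProductSpace ℂ H]

/-- The graph of the operator in `H` associated with the bounded sesquilinear form
`(u, v) ↦ ⟨v, B u⟩` on `V`, where `V` is mapped into `H` by `i`. -/
def formGraph (i : V →L[ℂ] H) (B : V →L[ℂ] V) : Submodule ℂ (H × H) where
  carrier := {p | ∃ u, i u = p.1 ∧ ∀ v, inner ℂ (i v) p.2 = inner ℂ v (B u)}
  zero_mem' := ⟨0, by simp⟩
  add_mem' := by
    rintro p q ⟨u, hu, hu'⟩ ⟨w, hw, hw'⟩
    refine ⟨u + w, by simp [hu, hw], fun v => ?_⟩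
    rw [Prod.snd_add, inner_add_right, hu', hw', map_add, inner_add_right]
  smul_mem' := by
    rintro c p ⟨u, hu, hu'⟩
    refine ⟨c • u, by simp [hu], fun v => ?_⟩
    rw [Prod.smul_snd, inner_smul_right, hu', map_smul, inner_smul_right]

theorem mem_formGraph {i : V →L[ℂ] H} {B : V →L[ℂ] V} {p : H × H} :
    p ∈ formGraph i B ↔ ∃ u, i u = p.1 ∧ ∀ v, inner ℂ (i v) p.2 = inner ℂ v (B u) := Iff.rfl

theorem negGraph_formGraph (i : V →L[ℂ] H) (B : V →L[ℂ] V) :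
    negGraph (formGraph i B : Set (H × H)) = formGraph i (-B) := by
  ext p
  have h : ∀ u v, inner ℂ (i v) (-p.2) = inner ℂ v (B u) ↔
      inner ℂ (i v) p.2 = inner ℂ v ((-B) u) := fun u v => by
    rw [inner_neg_right, neg_apply, inner_neg_right, neg_eq_iff_eq_neg]
  change (∃ u, i u = p.1 ∧ ∀ v, inner ℂ (i v) (-p.2) = inner ℂ v (B u)) ↔
    ∃ u, i u = p.1 ∧ ∀ v, inner ℂ (i v) p.2 = inner ℂ v ((-B) u)
  simp only [h]

/-- The form `(u, v) ↦ ⟨v, B u⟩` takes its values on the diagonal in `{z : |Im z| ≤ K Re z}`, and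
becomes coercive on `V` when the square of the norm of `H` is added. -/
structure IsSectorialForm (K : ℝ) (i : V →L[ℂ] H) (B : V →L[ℂ] V) : Prop where
  pos : 0 < K
  abs_im_le : ∀ u, |(inner ℂ u (B u)).im| ≤ K * (inner ℂ u (B u)).re
  coercive : ∃ a : ℝ, 0 < a ∧ ∀ u, a * ‖u‖ ^ 2 ≤ (inner ℂ u (B u)).re + ‖i u‖ ^ 2
  denseRange : DenseRange i

namespace IsSectorialForm

variable {K : ℝ} {i : V →L[ℂ] H} {B : V →L[ℂ] V}

theorem re_nonneg (h : IsSectorialForm K i B) (u : V) : 0 ≤ (inner ℂ u (B u)).re := by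
  have h1 := (abs_nonneg _).trans (h.abs_im_le u)
  exact nonneg_of_mul_nonneg_right h1 h.pos

variable [CompleteSpace V]

theorem adjoint (h : IsSectorialForm K i B) : IsSectorialForm K i B.adjoint := by
  have key : ∀ u, inner ℂ u (B.adjoint u) = conj (inner ℂ u (B u)) := fun u => by
    rw [ContinuousLinearMap.adjoint_inner_right, inner_conj_symm]
  refine ⟨h.pos, fun u => ?_, ?_, h.denseRange⟩
  · rw [key, Complex.conj_im, Complex.conj_re, abs_neg]
    exact h.abs_im_le u
  · obtain ⟨a, ha, hu⟩ := h.coercive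
    exact ⟨a, ha, fun u => by rw [key, Complex.conj_re]; exact hu u⟩

variable [CompleteSpace H]

/-- The Lax–Milgram lemma for the form shifted by `c > 0`. -/
theorem exists_resolvent (h : IsSectorialForm K i B) {c : ℝ} (hc : 0 < c) (f : H) :
    ∃ u, ∀ v, inner ℂ (i v) (f - (c : ℂ) • i u) = inner ℂ v (B u) := by
  obtain ⟨a, ha, hcoer⟩ := h.coercive
  set C : V →L[ℂ] V := (c : ℂ) • (i.adjoint.comp i) + B with hC
  have hCu : ∀ u v, inner ℂ v (C u) = (c : ℂ) * inner ℂ (i v) (i u) + inner ℂ v (B u) :=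
    fun u v => by
      rw [hC, add_apply, inner_add_right, smul_apply, inner_smul_right,
        ContinuousLinearMap.comp_apply, ContinuousLinearMap.adjoint_inner_right]
  have hm : 0 < min c 1 * a := mul_pos (lt_min hc one_pos) ha
  have hunit : IsUnit C := by
    refine ContinuousLinearMap.isUnit_of_forall_le_norm_inner_map C
      (c := NNReal.mk (min c 1 * a) hm.le) hm fun u => ?_
    have h1 : (inner ℂ u (C u)).re = c * ‖i u‖ ^ 2 + (inner ℂ u (B u)).re := by
      rw [hCu, Complex.add_re, Complex.re_ofReal_mul]
      congr 2
      simpa using inner_self_eq_norm_sq (𝕜 := ℂ) (i u)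
    rw [norm_inner_symm]
    refine le_trans ?_ (Complex.re_le_norm _)
    rw [h1, NNReal.coe_mk]
    calc ‖u‖ ^ 2 * (min c 1 * a) = min c 1 * (a * ‖u‖ ^ 2) := by ring
      _ ≤ min c 1 * ((inner ℂ u (B u)).re + ‖i u‖ ^ 2) :=
        mul_le_mul_of_nonneg_left (hcoer u) (lt_min hc one_pos).le
      _ ≤ 1 * (inner ℂ u (B u)).re + c * ‖i u‖ ^ 2 := by
        rw [mul_add]
        exact add_le_add (mul_le_mul_of_nonneg_right (min_le_right _ _) (h.re_nonneg u))
          (mul_le_mul_of_nonneg_right (min_le_left _ _) (sq_nonneg _))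
      _ = _ := by ring
  obtain ⟨u, hu⟩ := (ContinuousLinearMap.isUnit_iff_bijective.1 hunit).2 (i.adjoint f)
  refine ⟨u, fun v => ?_⟩
  have h1 := hCu u v
  rw [hu, ContinuousLinearMap.adjoint_inner_right] at h1
  rw [inner_sub_right, inner_smul_right, h1, add_sub_cancel_left]

/-- The operator associated with a sectorial form is m-sectorial. -/
theorem isMSectorial (h : IsSectorialForm K i B) : IsMSectorial K (formGraph i (-B)) := by
  refine ⟨h.pos, ?_, fun c hc f => ?_, ?_⟩
  · rintro ⟨x, y⟩ ⟨u, hu, huv⟩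
    have h1 := huv u
    simp only at hu h1
    rw [hu, neg_apply, inner_neg_right] at h1
    simp only [h1, Complex.neg_im, Complex.neg_re, abs_neg, mul_neg, neg_neg]
    exact h.abs_im_le u
  · obtain ⟨u, hu⟩ := h.exists_resolvent hc f
    refine ⟨(i u, (c : ℂ) • i u - f), ⟨u, rfl, fun v => ?_⟩, sub_sub_cancel _ _⟩
    rw [neg_apply, inner_neg_right, ← hu v, ← inner_neg_right, neg_sub]
  · let D : Submodule ℂ H := (formGraph i (-B)).map (LinearMap.fst ℂ H H)
    have hD : (D : Set H) = {x | ∃ y, (x, y) ∈ formGraph i (-B)} := by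
      ext x
      simp [D]
    rw [← hD]
    refine Submodule.dense_iff_topologicalClosure_eq_top.2 ?_
    rw [Submodule.topologicalClosure_eq_top_iff, Submodule.eq_bot_iff]
    intro f hf
    obtain ⟨u, hu⟩ := h.exists_resolvent one_pos f
    have hmem : i u ∈ D := by
      refine ⟨(i u, i u - f), ⟨u, rfl, fun v => ?_⟩, rfl⟩
      rw [neg_apply, inner_neg_right, ← hu v, ← inner_neg_right, neg_sub, Complex.ofReal_one,
        one_smul]
    have h0 : inner ℂ (i u) f = 0 := hf _ hmem
    have h1 := hu u
    rw [Complex.ofReal_one, one_smul, inner_sub_right, h0, zero_sub] at h1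
    have h2 : (inner ℂ (i u) (i u)).re = ‖i u‖ ^ 2 := by
      simpa using inner_self_eq_norm_sq (𝕜 := ℂ) (i u)
    obtain ⟨a, ha, hcoer⟩ := h.coercive
    have h3 := hcoer u
    rw [← h1, Complex.neg_re, h2, neg_add_cancel] at h3
    have hu0 : u = 0 := by
      by_contra hne
      have : 0 < a * ‖u‖ ^ 2 := mul_pos ha (pow_pos (norm_pos_iff.2 hne) 2)
      linarith
    have h4 : ∀ v, inner ℂ (i v) f = 0 := fun v => by simpa [hu0] using hu v
    have h5 : ∀ g, inner ℂ g f = 0 := fun g =>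
      h.denseRange.induction_on (p := fun g => inner ℂ g f = 0) g
        (isClosed_eq (by fun_prop) continuous_const) h4
    exact inner_self_eq_zero.1 (h5 f)

/-- The adjoint of the operator associated with a sectorial form belongs to the adjoint form. -/
theorem isAdjointOf (h : IsSectorialForm K i B) :
    IsAdjointOf (formGraph i B.adjoint : Set (H × H)) (formGraph i B : Set (H × H)) := by
  have hfwd : ∀ v g w f : H, (v, g) ∈ formGraph i B.adjoint → (w, f) ∈ formGraph i B →
      inner ℂ v f = inner ℂ g w := by
    rintro v g w f ⟨a, ha, ha'⟩ ⟨b, hb, hb'⟩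
    simp only at ha ha' hb hb'
    rw [← ha, hb', ← hb, ← inner_conj_symm, ← inner_conj_symm g, ha',
      ContinuousLinearMap.adjoint_inner_right]
  refine fun v g => ⟨fun hv w f hw => hfwd v g w f hv hw, fun hv => ?_⟩
  -- `1 + L*` is onto, so subtract an element of its graph; what remains is orthogonal to the range
  -- of `1 + L`, which is everything.
  obtain ⟨a, ha⟩ := h.adjoint.exists_resolvent one_pos (v + g)
  set g' := v + g - i a with hg'
  rw [Complex.ofReal_one, one_smul, ← hg'] at ha
  have hmem : (i a, g') ∈ formGraph i B.adjoint := ⟨a, rfl, ha⟩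
  obtain ⟨b, hb⟩ := h.exists_resolvent one_pos (v - i a)
  rw [Complex.ofReal_one, one_smul] at hb
  have hmemb : (i b, v - i a - i b) ∈ formGraph i B := ⟨b, rfl, hb⟩
  have h1 := hv _ _ hmemb
  have h2 := hfwd _ _ _ _ hmem hmemb
  have h3 : inner ℂ (v - i a) (v - i a) = 0 := by
    have h4 : inner ℂ (v - i a) (v - i a - i b) = inner ℂ (g - g') (i b) := by
      rw [inner_sub_left, h1, h2, ← inner_sub_left]
    have h5 : g - g' = -(v - i a) := by rw [hg']; abel
    rw [h5, inner_neg_left, inner_sub_right, sub_eq_iff_eq_add, neg_add_cancel] at h4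
    exact h4
  have h6 : v = i a := sub_eq_zero.1 (inner_self_eq_zero.1 h3)
  have h7 : g = g' := by rw [hg', h6, add_sub_cancel_left]
  rw [h7]
  nth_rewrite 1 [h6]
  exact hmem

theorem generatesAnalyticSemigroup (h : IsSectorialForm K i B) :
    GeneratesAnalyticSemigroup (negGraph (formGraph i B : Set (H × H))) (Real.arctan (1 / K)) := by
  rw [negGraph_formGraph]
  exact h.isMSectorial.generatesAnalyticSemigroup

end IsSectorialForm

end Form

/-! ### The force of the Landau solution -/

section Force

/-- Here `log ((A - 1) / (A + 1)) = -2 ∑ₖ A^{-(2k+1)} / (2k+1)`; for the lower bound the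
coefficients `1 / (2k+1)`, `k ≥ 1`, are replaced by `1 / 3`, which leaves a geometric series. -/
theorem log_div_le {A : ℝ} (hA : 1 < A) : Real.log ((A - 1) / (A + 1)) ≤ -(2 / A) ∧
    -(2 / A) - 2 / (3 * (A * (A ^ 2 - 1))) ≤ Real.log ((A - 1) / (A + 1)) := by
  have hA0 : 0 < A := by linarith
  set t := 1 / A with ht
  have ht0 : 0 < t := by positivity
  have ht1 : t < 1 := by rw [ht, div_lt_one hA0]; exact hA
  have hlog : Real.log ((A - 1) / (A + 1)) = -(Real.log (1 + t) - Real.log (1 - t)) := by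
    rw [← Real.log_div (by linarith) (by linarith), ← Real.log_inv, ht]
    congr 1
    field_simp
  have hs := Real.hasSum_log_sub_log_of_abs_lt_one (x := t) (by rwa [abs_of_pos ht0])
  have hg : HasSum (fun k : ℕ => 2 / 3 * t * (t ^ 2) ^ k + if k = 0 then 4 / 3 * t else 0)
      (2 / 3 * t * (1 - t ^ 2)⁻¹ + 4 / 3 * t) :=
    ((hasSum_geometric_of_lt_one (sq_nonneg t) (by nlinarith)).mul_left _).add (hasSum_ite_eq 0 _)
  have h1 : 2 * t ≤ Real.log (1 + t) - Real.log (1 - t) := by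
    have := le_hasSum hs 0 fun k _ => by positivity
    simpa using this
  have h2 : Real.log (1 + t) - Real.log (1 - t) ≤ 2 / 3 * t * (1 - t ^ 2)⁻¹ + 4 / 3 * t := by
    refine hasSum_le (fun k => ?_) hs hg
    rcases Nat.eq_zero_or_pos k with rfl | hk
    · norm_num
      linarith
    · rw [if_neg hk.ne', add_zero]
      have hk' : (1 : ℝ) ≤ k := by exact_mod_cast hk
      have e : t ^ (2 * k + 1) = t * (t ^ 2) ^ k := by rw [pow_succ, pow_mul]; ring
      rw [e, mul_assoc (2 / 3)]
      refine mul_le_mul_of_nonneg_right ?_ (by positivity)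
      rw [mul_one_div]
      exact div_le_div_of_nonneg_left (by norm_num) (by norm_num) (by linarith)
  have e1 : 2 * t = 2 / A := by rw [ht]; ring
  have hA2 : A ^ 2 - 1 ≠ 0 := by nlinarith
  have e2 : 2 / 3 * t * (1 - t ^ 2)⁻¹ + 4 / 3 * t = 2 / A + 2 / (3 * (A * (A ^ 2 - 1))) := by
    rw [ht]
    have : 1 - (1 / A) ^ 2 = (A ^ 2 - 1) / A ^ 2 := by field_simp
    rw [this]
    field_simp
    ring
  rw [hlog]
  constructor <;> linarith

theorem le_landauForce {A : ℝ} (hA : 1 < A) :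
    16 * Real.pi * (A / (A ^ 2 - 1)) ≤ landauForce A := by
  have hA2 : 0 < A ^ 2 - 1 := by nlinarith
  have hA0 : 0 < A := by linarith
  have h := mul_le_mul_of_nonneg_left (log_div_le hA).2 (by positivity : 0 ≤ 1 / 2 * A ^ 2)
  refine mul_le_mul_of_nonneg_left ?_ (by positivity)
  have e : A + 1 / 2 * A ^ 2 * (-(2 / A) - 2 / (3 * (A * (A ^ 2 - 1)))) +
      4 * A / (3 * (A ^ 2 - 1)) = A / (A ^ 2 - 1) := by
    field_simp
    ring
  linarith

theorem landauForce_le {A : ℝ} (hA : 1 < A) :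
    landauForce A ≤ 16 * Real.pi * (4 * A / (3 * (A ^ 2 - 1))) := by
  have hA0 : 0 < A := by linarith
  have h := mul_le_mul_of_nonneg_left (log_div_le hA).1 (by positivity : 0 ≤ 1 / 2 * A ^ 2)
  refine mul_le_mul_of_nonneg_left ?_ (by positivity)
  have e : 1 / 2 * A ^ 2 * -(2 / A) = -A := by field_simp
  linarith

theorem hasDerivAt_landauForce {A : ℝ} (hA : 1 < A) :
    HasDerivAt landauForce (16 * Real.pi * (1 + A * Real.log ((A - 1) / (A + 1)) +
      A ^ 2 / (A ^ 2 - 1) - 4 / 3 * ((A ^ 2 + 1) / (A ^ 2 - 1) ^ 2))) A := by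
  have h1 : A - 1 ≠ 0 := by linarith
  have h2 : A + 1 ≠ 0 := by linarith
  have h3 : A ^ 2 - 1 ≠ 0 := by nlinarith
  have hq : HasDerivAt (fun A : ℝ => (A - 1) / (A + 1)) (2 / (A + 1) ^ 2) A := by
    refine (((hasDerivAt_id A).sub_const 1).div ((hasDerivAt_id A).add_const 1) h2).congr_deriv ?_
    simp only [id]
    ring
  have hl := hq.log (div_ne_zero h1 h2)
  have hp : HasDerivAt (fun A : ℝ => 1 / 2 * A ^ 2) A A := by
    refine ((hasDerivAt_pow 2 A).const_mul (1 / 2)).congr_deriv ?_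
    norm_num
    ring
  have hn : HasDerivAt (fun A : ℝ => 4 * A) 4 A := by
    simpa using (hasDerivAt_id A).const_mul (4 : ℝ)
  have hd : HasDerivAt (fun A : ℝ => 3 * (A ^ 2 - 1)) (6 * A) A := by
    refine (((hasDerivAt_pow 2 A).sub_const 1).const_mul 3).congr_deriv ?_
    norm_num
    ring
  have h := (((hasDerivAt_id A).add (hp.mul hl)).add
    (hn.div hd (by positivity))).const_mul (16 * Real.pi)
  refine h.congr_deriv ?_
  have e1 : 2 / (A + 1) ^ 2 / ((A - 1) / (A + 1)) = 2 / (A ^ 2 - 1) := by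
    rw [show A ^ 2 - 1 = (A - 1) * (A + 1) by ring]
    field_simp
  rw [e1]
  congr 1
  field_simp
  ring

theorem strictAntiOn_landauForce : StrictAntiOn landauForce (Set.Ioi 1) := by
  refine strictAntiOn_of_deriv_neg (convex_Ioi 1)
    (fun A hA => (hasDerivAt_landauForce hA).continuousAt.continuousWithinAt) fun A hA => ?_
  rw [interior_Ioi] at hA
  have hA' : 1 < A := hA
  have hA2 : 0 < A ^ 2 - 1 := by nlinarith
  rw [(hasDerivAt_landauForce hA).deriv]
  refine mul_neg_of_pos_of_neg (by positivity) ?_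
  have h := mul_le_mul_of_nonneg_left (log_div_le hA').1 (by linarith : 0 ≤ A)
  have e : A * -(2 / A) = -2 := by field_simp
  have e2 : 1 + -2 + A ^ 2 / (A ^ 2 - 1) - 4 / 3 * ((A ^ 2 + 1) / (A ^ 2 - 1) ^ 2) =
      -(A ^ 2 + 7) / (3 * (A ^ 2 - 1) ^ 2) := by
    field_simp
    ring
  have h3 : -(A ^ 2 + 7) / (3 * (A ^ 2 - 1) ^ 2) < 0 :=
    div_neg_of_neg_of_pos (by nlinarith) (by positivity)
  linarith

theorem exists_landauForce_eq {β : ℝ} (hβ : 0 < β) : ∃ A : ℝ, 1 < A ∧ landauForce A = β := by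
  have hpi := Real.pi_pos
  set u := Real.pi / β with hu
  have hu0 : 0 < u := by positivity
  have huβ : u * β = Real.pi := by rw [hu]; field_simp
  have h1 : β ≤ landauForce (1 + 8 * u) := by
    refine le_trans ?_ (le_landauForce (by linarith))
    rw [← mul_div_assoc, le_div_iff₀ (by nlinarith), ← huβ]
    nlinarith [mul_pos hu0 hβ, mul_pos (mul_pos hu0 hu0) hβ]
  have h2 : landauForce (2 + 32 * u) ≤ β := by
    refine (landauForce_le (by linarith)).trans ?_
    rw [← mul_div_assoc, div_le_iff₀ (by nlinarith), ← huβ]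
    nlinarith [mul_pos hu0 hβ, mul_pos (mul_pos hu0 hu0) hβ]
  -- By the bounds for `β`, it is at least `β` at `1 + 8 π / β` and at most `β` at `2 + 32 π / β`.
  have hsub : Set.Icc (1 + 8 * u) (2 + 32 * u) ⊆ Set.Ioi 1 := fun A hA =>
    lt_of_lt_of_le (by linarith) hA.1
  obtain ⟨A, hA, hAβ⟩ := intermediate_value_Icc' (by linarith : 1 + 8 * u ≤ 2 + 32 * u)
    (fun A hA => (hasDerivAt_landauForce (hsub hA)).continuousAt.continuousWithinAt) ⟨h2, h1⟩
  exact ⟨A, hsub hA, hAβ⟩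

theorem landauParam_spec {β : ℝ} (hβ : 0 < β) :
    1 < landauParam β ∧ landauForce (landauParam β) = β :=
  Classical.epsilon_spec (exists_landauForce_eq hβ)

theorem landauForce_pos {A : ℝ} (hA : 1 < A) : 0 < landauForce A :=
  lt_of_lt_of_le (mul_pos (by positivity) (div_pos (by linarith) (by nlinarith)))
    (le_landauForce hA)

theorem landauParam_landauForce {A : ℝ} (hA : 1 < A) : landauParam (landauForce A) = A :=
  have h := landauParam_spec (landauForce_pos hA)
  strictAntiOn_landauForce.injOn h.1 hA h.2

end Force

/-! ### Bounds for the Landau solution -/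

section Profile

theorem le_mul_norm_sub_inner {A : ℝ} {e : R3} (he : ‖e‖ = 1) (x : R3) :
    (A - 1) * ‖x‖ ≤ A * ‖x‖ - inner ℝ e x := by
  have := real_inner_le_norm e x
  rw [he] at this
  linarith

theorem mul_norm_sub_inner_pos {A : ℝ} (hA : 1 < A) {e : R3} (he : ‖e‖ = 1) {x : R3}
    (hx : x ≠ 0) : 0 < A * ‖x‖ - inner ℝ e x :=
  (mul_pos (by linarith) (norm_pos_iff.2 hx)).trans_le (le_mul_norm_sub_inner he x)

/-- In terms of `q = (A |x| - e · x)⁻¹` the Landau solution is `2 (q e + (A cos φ - 1) q² x)`. -/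
theorem landauProfile_eq {A : ℝ} (hA : 1 < A) {e : R3} (he : ‖e‖ = 1) {x : R3} (hx : x ≠ 0) :
    landauProfile A e x = (2 : ℝ) • ((A * ‖x‖ - inner ℝ e x)⁻¹ • e +
      ((A * (inner ℝ e x * ‖x‖⁻¹) - 1) * ((A * ‖x‖ - inner ℝ e x)⁻¹ * (A * ‖x‖ - inner ℝ e x)⁻¹)) •
        x) := by
  have hr : ‖x‖ ≠ 0 := norm_ne_zero_iff.2 hx
  have hD := (mul_norm_sub_inner_pos hA he hx).ne'
  rw [landauProfile]
  set r := ‖x‖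
  obtain ⟨d, hd⟩ : ∃ d, d = A * r - inner ℝ e x := ⟨_, rfl⟩
  rw [← hd] at hD ⊢
  have hc : inner ℝ e x = A * r - d := by rw [hd]; ring
  have e1 : A - inner ℝ e x / r = d / r := by
    rw [hc]
    field_simp
    ring
  rw [e1, hc]
  match_scalars
  · field_simp
    ring
  · field_simp

theorem continuousAt_landauProfile {A : ℝ} (hA : 1 < A) {e : R3} (he : ‖e‖ = 1) {x : R3}
    (hx : x ≠ 0) : ContinuousAt (fun A => landauProfile A e x) A := by
  have hr : 0 < ‖x‖ := norm_pos_iff.2 hx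
  have hD : A - inner ℝ e x / ‖x‖ ≠ 0 := by
    have h1 := mul_norm_sub_inner_pos hA he hx
    have h2 : A - inner ℝ e x / ‖x‖ = (A * ‖x‖ - inner ℝ e x) / ‖x‖ := by field_simp
    rw [h2]
    exact (div_pos h1 hr).ne'
  have h1 : ContinuousAt (fun A : ℝ => A ^ 2 - 1) A := by fun_prop
  have h2 : ContinuousAt (fun A : ℝ => A - inner ℝ e x / ‖x‖) A := by fun_prop
  have h3 : ContinuousAt (fun A : ℝ => (A ^ 2 - 1) / (A - inner ℝ e x / ‖x‖) ^ 2 - 1) A :=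
    (h1.div (h2.pow 2) (pow_ne_zero 2 hD)).sub continuousAt_const
  have h4 : ContinuousAt (fun A : ℝ => 1 / (A - inner ℝ e x / ‖x‖)) A :=
    continuousAt_const.div h2 hD
  exact ((h3.smul continuousAt_const).add (h4.smul continuousAt_const)).const_smul (2 / ‖x‖)

theorem norm_smul_inv_norm_eq_one {b : R3} (hb : b ≠ 0) : ‖‖b‖⁻¹ • b‖ = 1 := by
  rw [norm_smul, norm_inv, norm_norm, inv_mul_cancel₀ (norm_ne_zero_iff.2 hb)]

/-- The first part of the estimate for `U^b` holds up to the end point `|b| = ε₀`: with the axis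
fixed, `U^b` is the limit of Landau solutions with larger parameter, that is, smaller force. -/
theorem norm_landau_le {ε₀ C₀ : ℝ} (h : LandauEstimate ε₀ C₀) {b : R3} (hb : b ≠ 0)
    (hb' : ‖b‖ ≤ ε₀) {x : R3} (hx : x ≠ 0) : ‖landau b x‖ ≤ C₀ * ‖b‖ / ‖x‖ := by
  have hβ : 0 < ‖b‖ := norm_pos_iff.2 hb
  obtain ⟨hA, hAb⟩ := landauParam_spec hβ
  set A := landauParam ‖b‖ with hAdef
  set e := ‖b‖⁻¹ • b with he
  have he1 : ‖e‖ = 1 := norm_smul_inv_norm_eq_one hb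
  have key : ∀ A' ∈ Set.Ioi A, ‖landauProfile A' e x‖ ≤ C₀ * landauForce A' / ‖x‖ := by
    intro A' hA'
    have h1 : 1 < A' := hA.trans hA'
    have hf := landauForce_pos h1
    have hn : ‖landauForce A' • e‖ = landauForce A' := by
      rw [norm_smul, he1, mul_one, Real.norm_of_nonneg hf.le]
    have hlt : ‖landauForce A' • e‖ < ε₀ := by
      rw [hn]
      exact (strictAntiOn_landauForce hA h1 hA').trans_le (hAb.trans_le hb')
    have h2 := (h (landauForce A' • e) (by rw [hn]; exact hf) hlt x hx).1
    rw [landau, hn, landauParam_landauForce h1, smul_smul, inv_mul_cancel₀ hf.ne', one_smul] at h2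
    exact h2
  have hl1 : Tendsto (fun A' => ‖landauProfile A' e x‖) (𝓝[>] A) (𝓝 ‖landauProfile A e x‖) :=
    (continuousAt_landauProfile hA he1 hx).norm.tendsto.mono_left nhdsWithin_le_nhds
  have hl2 : Tendsto (fun A' => C₀ * landauForce A' / ‖x‖) (𝓝[>] A)
      (𝓝 (C₀ * landauForce A / ‖x‖)) :=
    (((hasDerivAt_landauForce hA).continuousAt.tendsto.const_mul C₀).div_const _).mono_left
      nhdsWithin_le_nhds
  have := le_of_tendsto_of_tendsto hl1 hl2 (eventually_mem_nhdsWithin.mono key)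
  rwa [hAb] at this

/-- A bound for the size and the gradient of the Landau solution in terms of its parameter. -/
theorem norm_landauProfile_le {A : ℝ} (hA : 2 ≤ A) {e : R3} (he : ‖e‖ = 1) {x : R3} (hx : x ≠ 0) :
    ‖landauProfile A e x‖ ≤ 20 / (A * ‖x‖) ∧
      ‖fderiv ℝ (landauProfile A e) x‖ ≤ 176 / (A * ‖x‖ ^ 2) := by
  have hA1 : 1 < A := by linarith
  have hA0 : 0 < A := by linarith
  have hr : 0 < ‖x‖ := norm_pos_iff.2 hx
  have hDpos := mul_norm_sub_inner_pos hA1 he hx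
  set r := ‖x‖ with hrdef
  set q := (A * r - inner ℝ e x)⁻¹ with hq
  have hq0 : 0 < q := inv_pos.2 hDpos
  have hqle : q ≤ 2 / (A * r) := by
    rw [hq, inv_le_comm₀ hDpos (by positivity), inv_div]
    refine le_trans ?_ (le_mul_norm_sub_inner he x)
    rw [← hrdef]
    nlinarith
  have hq1 : A * r * q ≤ 2 := by
    rw [le_div_iff₀ (by positivity)] at hqle
    linarith
  set c := inner ℝ e x * r⁻¹ with hc
  have hinner : |inner ℝ e x| ≤ r := by
    have := abs_real_inner_le_norm e x
    rwa [he, one_mul] at this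
  have hc1 : |c| ≤ 1 := by
    rw [hc, abs_mul, abs_of_pos (inv_pos.2 hr), ← div_eq_mul_inv, div_le_one hr]
    exact hinner
  set N := A * c - 1 with hN
  have hN1 : |N| ≤ 2 * A := by
    rw [abs_le] at hc1 ⊢
    constructor <;> nlinarith
  constructor
  · rw [landauProfile_eq hA1 he hx, norm_smul, Real.norm_ofNat]
    have h1 : ‖q • e‖ = q := by rw [norm_smul, he, mul_one, Real.norm_of_nonneg hq0.le]
    have h2 : ‖(N * (q * q)) • x‖ ≤ 2 * A * (q * q) * r := by
      rw [norm_smul, norm_mul, Real.norm_of_nonneg (by positivity : 0 ≤ q * q), Real.norm_eq_abs]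
      gcongr
    have h3 := norm_add_le (q • e) ((N * (q * q)) • x)
    rw [le_div_iff₀ (by positivity)]
    have h4 : 2 * A * (q * q) * r * (A * r) ≤ 8 := by
      have : (A * r * q) * (A * r * q) ≤ 2 * 2 := mul_self_le_mul_self (by positivity) hq1
      nlinarith
    have h5 : ‖q • e + (N * (q * q)) • x‖ * (A * r) ≤ (q + 2 * A * (q * q) * r) * (A * r) :=
      mul_le_mul_of_nonneg_right (by linarith) (by positivity)
    nlinarith
  · have hev : landauProfile A e =ᶠ[𝓝 x] fun y => (2 : ℝ) • ((A * ‖y‖ - inner ℝ e y)⁻¹ • e +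
        ((A * (inner ℝ e y * ‖y‖⁻¹) - 1) *
          ((A * ‖y‖ - inner ℝ e y)⁻¹ * (A * ‖y‖ - inner ℝ e y)⁻¹)) • y) := by
      filter_upwards [isOpen_ne.mem_nhds hx] with y hy using landauProfile_eq hA1 he hy
    rw [hev.fderiv_eq]
    have hnorm : HasFDerivAt (fun y : R3 => ‖y‖) (fderiv ℝ (fun y : R3 => ‖y‖) x) x :=
      ((contDiffAt_norm ℝ hx).differentiableAt one_ne_zero).hasFDerivAt
    have hr' : ‖fderiv ℝ (fun y : R3 => ‖y‖) x‖ ≤ 1 :=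
      norm_fderiv_le_of_lipschitz (C := 1) ℝ lipschitzWith_one_norm
    set r' := fderiv ℝ (fun y : R3 => ‖y‖) x
    have hine : HasFDerivAt (fun y : R3 => inner ℝ e y) (innerSL ℝ e) x :=
      (innerSL ℝ e).hasFDerivAt
    have he' : ‖innerSL ℝ e‖ = 1 := by rw [innerSL_apply_norm, he]
    have hD : HasFDerivAt (fun y : R3 => A * ‖y‖ - inner ℝ e y) (A • r' - innerSL ℝ e) x :=
      (hnorm.const_mul A).sub hine
    set D' := A • r' - innerSL ℝ e with hD'
    have hD'le : ‖D'‖ ≤ 2 * A := by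
      refine (norm_sub_le _ _).trans ?_
      rw [norm_smul, Real.norm_of_nonneg hA0.le, he']
      nlinarith
    have hQ : HasFDerivAt (fun y : R3 => (A * ‖y‖ - inner ℝ e y)⁻¹) (-(q * q) • D') x :=
      ((hasDerivAt_inv hDpos.ne').comp_hasFDerivAt x hD).congr_fderiv (by rw [hq, sq, mul_inv])
    have hR : HasFDerivAt (fun y : R3 => ‖y‖⁻¹) (-(r⁻¹ * r⁻¹) • r') x :=
      ((hasDerivAt_inv hr.ne').comp_hasFDerivAt x hnorm).congr_fderiv (by rw [sq, mul_inv])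
    have hNd := ((hine.mul hR).const_mul A).sub_const 1
    set N' := A • (inner ℝ e x • -(r⁻¹ * r⁻¹) • r' + r⁻¹ • innerSL ℝ e) with hN'
    have hN'le : ‖N'‖ ≤ 2 * A * r⁻¹ := by
      rw [hN', norm_smul, Real.norm_of_nonneg hA0.le]
      have h1 : ‖inner ℝ e x • -(r⁻¹ * r⁻¹) • r'‖ ≤ r * ((r⁻¹ * r⁻¹) * 1) := by
        rw [norm_smul, norm_smul, norm_neg, Real.norm_of_nonneg (by positivity : 0 ≤ r⁻¹ * r⁻¹),
          Real.norm_eq_abs]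
        gcongr
      have h2 : ‖r⁻¹ • innerSL ℝ e‖ = r⁻¹ := by
        rw [norm_smul, he', mul_one, Real.norm_of_nonneg (by positivity)]
      have h3 : r * ((r⁻¹ * r⁻¹) * 1) = r⁻¹ := by field_simp
      have h4 := norm_add_le (inner ℝ e x • -(r⁻¹ * r⁻¹) • r') (r⁻¹ • innerSL ℝ e)
      nlinarith
    have hall : HasFDerivAt (fun y : R3 => (2 : ℝ) • ((A * ‖y‖ - inner ℝ e y)⁻¹ • e +
        ((A * (inner ℝ e y * ‖y‖⁻¹) - 1) *
          ((A * ‖y‖ - inner ℝ e y)⁻¹ * (A * ‖y‖ - inner ℝ e y)⁻¹)) • y))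
        ((2 : ℝ) • ((-(q * q) • D').smulRight e + ((N * (q * q)) • ContinuousLinearMap.id ℝ R3 +
          (N • (q • -(q * q) • D' + q • -(q * q) • D') + (q * q) • N').smulRight x))) x :=
      ((hQ.smul_const e).add
        ((hNd.mul (hQ.mul hQ)).smul (hasFDerivAt_id x))).const_smul (2 : ℝ)
    rw [hall.fderiv, norm_smul, Real.norm_ofNat]
    have n1 : ‖(-(q * q) • D').smulRight e‖ ≤ (q * q) * (2 * A) := by
      rw [ContinuousLinearMap.norm_smulRight_apply, he, mul_one, norm_smul, norm_neg,
        Real.norm_of_nonneg (by positivity)]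
      gcongr
    have n2 : ‖(N * (q * q)) • ContinuousLinearMap.id ℝ R3‖ ≤ 2 * A * (q * q) := by
      rw [norm_smul, norm_mul, Real.norm_of_nonneg (by positivity : 0 ≤ q * q), Real.norm_eq_abs]
      calc |N| * (q * q) * ‖ContinuousLinearMap.id ℝ R3‖ ≤ 2 * A * (q * q) * 1 := by
            gcongr
            exact ContinuousLinearMap.norm_id_le
        _ = _ := mul_one _
    have n3 : ‖q • -(q * q) • D'‖ ≤ q * (q * q * (2 * A)) := by
      rw [norm_smul, norm_smul, norm_neg, Real.norm_of_nonneg hq0.le,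
        Real.norm_of_nonneg (by positivity)]
      gcongr
    have n4 : ‖N • (q • -(q * q) • D' + q • -(q * q) • D')‖ ≤
        2 * A * (q * (q * q * (2 * A)) + q * (q * q * (2 * A))) := by
      rw [norm_smul, Real.norm_eq_abs]
      exact mul_le_mul hN1 (norm_add_le_of_le n3 n3) (norm_nonneg _) (by positivity)
    have n5 : ‖(q * q) • N'‖ ≤ q * q * (2 * A * r⁻¹) := by
      rw [norm_smul, Real.norm_of_nonneg (by positivity)]
      gcongr
    have n6 : ‖(N • (q • -(q * q) • D' + q • -(q * q) • D') + (q * q) • N').smulRight x‖ ≤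
        (2 * A * (q * (q * q * (2 * A)) + q * (q * q * (2 * A))) + q * q * (2 * A * r⁻¹)) * r := by
      rw [ContinuousLinearMap.norm_smulRight_apply]
      exact mul_le_mul_of_nonneg_right (norm_add_le_of_le n4 n5) hr.le
    have n7 := norm_add_le_of_le n1 (norm_add_le_of_le n2 n6)
    rw [le_div_iff₀ (by positivity)]
    have m1 : (A * r * q) * (A * r * q) ≤ 2 * 2 := mul_self_le_mul_self (by positivity) hq1
    have m2 : (A * r * q) * ((A * r * q) * (A * r * q)) ≤ 2 * (2 * 2) :=
      mul_le_mul hq1 m1 (by positivity) (by norm_num)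
    have e1 : ((q * q) * (2 * A) + (2 * A * (q * q) + (2 * A * (q * (q * q * (2 * A)) +
        q * (q * q * (2 * A))) + q * q * (2 * A * r⁻¹)) * r)) * (A * r ^ 2) =
        6 * ((A * r * q) * (A * r * q)) + 8 * ((A * r * q) * ((A * r * q) * (A * r * q))) := by
      field_simp
      ring
    have n8 := mul_le_mul_of_nonneg_right n7 (by positivity : 0 ≤ A * r ^ 2)
    rw [e1] at n8
    linarith

/-- Since `β(A) ≥ 16 π A / (A² - 1) ≥ 16 π / A`, one has `1 / A ≤ |b| / (16 π)`, and `|b| < 8 π`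
forces `A ≥ 2`. -/
theorem landauEstimate_of_lt : LandauEstimate (8 * Real.pi) 11 := by
  intro b hb hb' x hx
  obtain ⟨hA, hAb⟩ := landauParam_spec hb
  have hx0 : 0 < ‖x‖ := norm_pos_iff.2 hx
  have hpi := Real.pi_gt_three
  have h1 : 16 * Real.pi ≤ landauParam ‖b‖ * ‖b‖ := by
    have h2 := le_landauForce hA
    rw [hAb] at h2
    set A := landauParam ‖b‖
    have h3 : 1 ≤ A * (A / (A ^ 2 - 1)) := by
      rw [← mul_div_assoc, one_le_div (by nlinarith)]
      nlinarith
    nlinarith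
  have hA2 : 2 ≤ landauParam ‖b‖ := by
    by_contra h
    nlinarith
  have h := norm_landauProfile_le hA2 (norm_smul_inv_norm_eq_one (norm_pos_iff.1 hb)) hx
  have hA0 : 0 < landauParam ‖b‖ := by linarith
  constructor
  · refine h.1.trans ?_
    rw [div_le_div_iff₀ (by positivity) hx0]
    nlinarith
  · refine h.2.trans ?_
    rw [div_le_div_iff₀ (by positivity) (by positivity)]
    have : 0 < ‖x‖ ^ 2 := by positivity
    nlinarith

end Profile

/-! ### Square integrable functions -/

section SquareIntegrable

variable {α F : Type*} {m : MeasurableSpace α} {μ : Measure α} [NormedAddCommGroup F]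

theorem eLpNorm_two_le_ofReal {f : α → F} (hf : AEStronglyMeasurable f μ)
    (hi : Integrable (fun x => ‖f x‖ ^ 2) μ) {C : ℝ} (hC : 0 ≤ C)
    (h : ∫ x, ‖f x‖ ^ 2 ∂μ ≤ C ^ 2) : eLpNorm f 2 μ ≤ ENNReal.ofReal C := by
  have hm : MemLp f 2 μ := (memLp_two_iff_integrable_sq_norm hf).2 hi
  rw [hm.eLpNorm_eq_integral_rpow_norm two_ne_zero ENNReal.ofNat_ne_top]
  refine ENNReal.ofReal_le_ofReal ?_
  have h2 : ∫ x, ‖f x‖ ^ (ENNReal.toReal 2) ∂μ = ∫ x, ‖f x‖ ^ 2 ∂μ := by simp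
  rw [h2, ENNReal.toReal_ofNat, ← one_div, ← Real.sqrt_eq_rpow]
  exact Real.sqrt_le_iff.2 ⟨hC, h⟩

theorem norm_sq_eq_integral [InnerProductSpace ℂ F] (f : Lp F 2 μ) :
    ‖f‖ ^ 2 = ∫ x, ‖f x‖ ^ 2 ∂μ := by
  have h := inner_self_eq_norm_sq_to_K (𝕜 := ℂ) f
  rw [L2.inner_def] at h
  have h2 : ∫ x, inner ℂ (f x) (f x) ∂μ = ((∫ x, ‖f x‖ ^ 2 ∂μ : ℝ) : ℂ) := by
    rw [← integral_complex_ofReal]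
    refine integral_congr_ae (Eventually.of_forall fun x => ?_)
    simp [inner_self_eq_norm_sq_to_K]
  rw [h2] at h
  have h3 : ((‖f‖ ^ 2 : ℝ) : ℂ) = ((∫ x, ‖f x‖ ^ 2 ∂μ : ℝ) : ℂ) := by
    rw [h]
    simp
  exact Complex.ofReal_injective h3

theorem integrable_norm_sq (f : Lp F 2 μ) : Integrable (fun x => ‖f x‖ ^ 2) μ :=
  (memLp_two_iff_integrable_sq_norm (Lp.aestronglyMeasurable f)).1 (Lp.memLp f)

end SquareIntegrable

/-! ### Hardy's inequality -/

section Hardy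

/-- The squared norm of the gradient. -/
noncomputable def gradSq (φ : R3 → C3) (x : R3) : ℝ := ∑ j, ‖partialD j φ x‖ ^ 2

theorem continuous_partialD (j : Fin 3) {φ : R3 → C3} (hφ : ContDiff ℝ ∞ φ) :
    Continuous (partialD j φ) :=
  (hφ.continuous_fderiv (by simp)).clm_apply continuous_const

theorem hasCompactSupport_partialD (j : Fin 3) {φ : R3 → C3} (hφ : HasCompactSupport φ) :
    HasCompactSupport (partialD j φ) := hφ.fderiv_apply (𝕜 := ℝ) _

theorem hasFDerivAt_coord (j : Fin 3) (x : R3) :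
    HasFDerivAt (fun y : R3 => y j) (EuclideanSpace.proj j : R3 →L[ℝ] ℝ) x :=
  (EuclideanSpace.proj j : R3 →L[ℝ] ℝ).hasFDerivAt

theorem contDiff_norm_sq_add (δ : ℝ) : ContDiff ℝ ∞ fun x : R3 => ‖x‖ ^ 2 + δ ^ 2 :=
  (contDiff_norm_sq ℝ).add contDiff_const

theorem hasCompactSupport_norm_sq {f : R3 → C3} (hf : HasCompactSupport f) :
    HasCompactSupport fun x => ‖f x‖ ^ 2 :=
  hf.comp_left (g := fun y : C3 => ‖y‖ ^ 2) (by simp)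

theorem integrable_gradSq {φ : R3 → C3} (hφ : ContDiff ℝ ∞ φ) (hc : HasCompactSupport φ) :
    Integrable (gradSq φ) :=
  integrable_finsetSum _ fun j _ => Continuous.integrable_of_hasCompactSupport
    ((continuous_partialD j hφ).norm.pow 2)
    (hasCompactSupport_norm_sq (hasCompactSupport_partialD j hc))

/-- Hardy's inequality with the weight `|x|² + δ²`: integrate `|φ|²` against the divergence of
`x / (|x|² + δ²)`, which is at least `1 / (|x|² + δ²)`. -/
theorem integral_norm_sq_div_le {φ : R3 → C3} (hφ : ContDiff ℝ ∞ φ) (hc : HasCompactSupport φ)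
    {δ : ℝ} (hδ : 0 < δ) :
    ∫ x, ‖φ x‖ ^ 2 / (‖x‖ ^ 2 + δ ^ 2) ≤ 4 * ∫ x, gradSq φ x := by
  have hs : ∀ x : R3, 0 < ‖x‖ ^ 2 + δ ^ 2 := fun x => by positivity
  set w : Fin 3 → R3 → ℝ := fun j x => x j / (‖x‖ ^ 2 + δ ^ 2) with hw
  have hwc : ∀ j, ContDiff ℝ ∞ (w j) := fun j =>
    ((EuclideanSpace.proj j : R3 →L[ℝ] ℝ).contDiff).div (contDiff_norm_sq_add δ)
      fun x => (hs x).ne'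
  have hwd : ∀ j x, fderiv ℝ (w j) x (EuclideanSpace.single j 1) =
      1 / (‖x‖ ^ 2 + δ ^ 2) - 2 * x j ^ 2 / (‖x‖ ^ 2 + δ ^ 2) ^ 2 := by
    intro j x
    have h1 : HasFDerivAt (fun x : R3 => ‖x‖ ^ 2 + δ ^ 2) (2 • innerSL ℝ x) x :=
      ((hasStrictFDerivAt_norm_sq x).hasFDerivAt).add_const _
    have h2 := (hasFDerivAt_coord j x).mul
      ((hasDerivAt_inv (hs x).ne').comp_hasFDerivAt x h1)
    have h3 : HasFDerivAt (w j) _ x := h2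
    rw [h3.fderiv]
    have := (hs x).ne'
    simp [EuclideanSpace.inner_single_right]
    field_simp
    ring
  set F : R3 → ℝ := fun x => ‖φ x‖ ^ 2 with hF
  have hFc : ContDiff ℝ ∞ F := hφ.norm_sq ℂ
  have hFs : HasCompactSupport F := hasCompactSupport_norm_sq hc
  have hFd : ∀ j x,
      |fderiv ℝ F x (EuclideanSpace.single j 1)| ≤ 2 * (‖φ x‖ * ‖partialD j φ x‖) := by
    intro j x
    have hd := (hφ.differentiable (by simp) x).hasFDerivAt
    have h2 := Complex.reCLM.hasFDerivAt.comp x (hd.inner ℂ hd)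
    have h3 : F = Complex.reCLM ∘ fun x => inner ℂ (φ x) (φ x) := by
      ext y
      simp [hF, inner_self_eq_norm_sq_to_K, ← Complex.ofReal_pow]
    rw [h3, h2.fderiv]
    have h4 : |(inner ℂ (φ x) (partialD j φ x)).re| ≤ ‖φ x‖ * ‖partialD j φ x‖ :=
      (Complex.abs_re_le_norm _).trans (norm_inner_le_norm _ _)
    have h5 : (inner ℂ (partialD j φ x) (φ x)).re = (inner ℂ (φ x) (partialD j φ x)).re := by
      rw [← inner_conj_symm, Complex.conj_re]
    change |(inner ℂ (φ x) (partialD j φ x) + inner ℂ (partialD j φ x) (φ x)).re| ≤ _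
    rw [Complex.add_re, h5, ← two_mul, abs_mul, abs_two]
    linarith
  have hFds : ∀ j, HasCompactSupport fun x => fderiv ℝ F x (EuclideanSpace.single j 1) := fun j =>
    hFs.fderiv_apply (𝕜 := ℝ) _
  have hFdc : ∀ j, Continuous fun x => fderiv ℝ F x (EuclideanSpace.single j 1) := fun j =>
    (hFc.continuous_fderiv (by simp)).clm_apply continuous_const
  have hwdc : ∀ j, Continuous fun x => fderiv ℝ (w j) x (EuclideanSpace.single j 1) := fun j =>
    ((hwc j).continuous_fderiv (by simp)).clm_apply continuous_const
  have i1 : ∀ j, Integrable fun x => fderiv ℝ (w j) x (EuclideanSpace.single j 1) * F x := fun j =>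
    ((hwdc j).mul hFc.continuous).integrable_of_hasCompactSupport hFs.mul_left
  have i2 : ∀ j, Integrable fun x => w j x * fderiv ℝ F x (EuclideanSpace.single j 1) := fun j =>
    ((hwc j).continuous.mul (hFdc j)).integrable_of_hasCompactSupport (hFds j).mul_left
  have i3 : ∀ j, Integrable fun x => w j x * F x := fun j =>
    ((hwc j).continuous.mul hFc.continuous).integrable_of_hasCompactSupport hFs.mul_left
  have i4 : Integrable fun x => F x / (‖x‖ ^ 2 + δ ^ 2) := by
    refine (hFc.continuous.div (contDiff_norm_sq_add δ).continuous
      fun x => (hs x).ne').integrable_of_hasCompactSupport ?_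
    simp only [div_eq_mul_inv]
    exact hFs.mul_right
  have i5 := integrable_gradSq hφ hc
  have hpart : ∀ j, ∫ x, w j x * fderiv ℝ F x (EuclideanSpace.single j 1) =
      - ∫ x, fderiv ℝ (w j) x (EuclideanSpace.single j 1) * F x := fun j =>
    integral_mul_fderiv_eq_neg_fderiv_mul_of_integrable (i1 j) (i2 j) (i3 j)
      (fun x _ => (hwc j).differentiable (by simp) x) (fun x _ => hFc.differentiable (by simp) x)
  have hdiv : ∀ x : R3, F x / (‖x‖ ^ 2 + δ ^ 2) ≤
      ∑ j, fderiv ℝ (w j) x (EuclideanSpace.single j 1) * F x := by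
    intro x
    rw [← Finset.sum_mul, div_eq_mul_one_div, mul_comm]
    refine mul_le_mul_of_nonneg_right ?_ (sq_nonneg _)
    have h := hs x
    rw [← sub_nonneg]
    have e : ∑ j, fderiv ℝ (w j) x (EuclideanSpace.single j 1) - 1 / (‖x‖ ^ 2 + δ ^ 2) =
        2 * δ ^ 2 / (‖x‖ ^ 2 + δ ^ 2) ^ 2 := by
      have e1 : ∑ j, fderiv ℝ (w j) x (EuclideanSpace.single j 1) =
          3 * (1 / (‖x‖ ^ 2 + δ ^ 2)) - 2 * (∑ j, x j ^ 2) / (‖x‖ ^ 2 + δ ^ 2) ^ 2 := by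
        rw [Fin.sum_univ_three, Fin.sum_univ_three, hwd, hwd, hwd]
        ring
      rw [e1, ← EuclideanSpace.real_norm_sq_eq]
      field_simp
      ring
    rw [e]
    positivity
  have hpt : ∀ x : R3, -∑ j, w j x * fderiv ℝ F x (EuclideanSpace.single j 1) ≤
      1 / 2 * (F x / (‖x‖ ^ 2 + δ ^ 2)) + 2 * gradSq φ x := by
    intro x
    have h := hs x
    have h1 : ∀ j, -(w j x * fderiv ℝ F x (EuclideanSpace.single j 1)) ≤
        1 / 2 * (x j ^ 2 * (F x / (‖x‖ ^ 2 + δ ^ 2) ^ 2)) + 2 * ‖partialD j φ x‖ ^ 2 := by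
      intro j
      have h2 : |w j x * fderiv ℝ F x (EuclideanSpace.single j 1)| ≤
          |x j| / (‖x‖ ^ 2 + δ ^ 2) * (2 * (‖φ x‖ * ‖partialD j φ x‖)) := by
        rw [abs_mul, hw, abs_div, abs_of_pos h]
        exact mul_le_mul_of_nonneg_left (hFd j x) (by positivity)
      have h3 := (neg_le_abs _).trans h2
      have h4 : x j ^ 2 * (F x / (‖x‖ ^ 2 + δ ^ 2) ^ 2) =
          (|x j| / (‖x‖ ^ 2 + δ ^ 2) * ‖φ x‖) ^ 2 := by
        rw [mul_pow, div_pow, sq_abs]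
        ring
      rw [h4]
      nlinarith [sq_nonneg (|x j| / (‖x‖ ^ 2 + δ ^ 2) * ‖φ x‖ - 2 * ‖partialD j φ x‖)]
    rw [← Finset.sum_neg_distrib]
    refine (Finset.sum_le_sum fun j _ => h1 j).trans ?_
    rw [Finset.sum_add_distrib, ← Finset.mul_sum, ← Finset.mul_sum, ← Finset.sum_mul,
      ← EuclideanSpace.real_norm_sq_eq, gradSq]
    have h5 : ‖x‖ ^ 2 * (F x / (‖x‖ ^ 2 + δ ^ 2) ^ 2) ≤ F x / (‖x‖ ^ 2 + δ ^ 2) := by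
      rw [← mul_div_assoc, div_le_div_iff₀ (by positivity) h]
      have : 0 ≤ F x * (‖x‖ ^ 2 + δ ^ 2) * δ ^ 2 :=
        mul_nonneg (mul_nonneg (sq_nonneg _) h.le) (sq_nonneg _)
      nlinarith
    linarith
  have hI : ∫ x, F x / (‖x‖ ^ 2 + δ ^ 2) ≤
      1 / 2 * (∫ x, F x / (‖x‖ ^ 2 + δ ^ 2)) + 2 * ∫ x, gradSq φ x := by
    calc ∫ x, F x / (‖x‖ ^ 2 + δ ^ 2)
        ≤ ∫ x, ∑ j, fderiv ℝ (w j) x (EuclideanSpace.single j 1) * F x :=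
          integral_mono i4 (integrable_finsetSum _ fun j _ => i1 j) hdiv
      _ = ∫ x, -∑ j, w j x * fderiv ℝ F x (EuclideanSpace.single j 1) := by
          rw [integral_finsetSum _ fun j _ => i1 j, integral_neg,
            integral_finsetSum _ fun j _ => i2 j, ← Finset.sum_neg_distrib]
          exact Finset.sum_congr rfl fun j _ => by rw [hpart, neg_neg]
      _ ≤ ∫ x, (1 / 2 * (F x / (‖x‖ ^ 2 + δ ^ 2)) + 2 * gradSq φ x) :=
          integral_mono (integrable_finsetSum _ fun j _ => i2 j).neg
            ((i4.const_mul _).add (i5.const_mul _)) hpt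
      _ = _ := by
          rw [integral_add (i4.const_mul _) (i5.const_mul _), integral_const_mul,
            integral_const_mul]
  linarith

theorem integral_gradSq {u : Jet} {φ : R3 → C3} (hu : ∀ j, u.snd j =ᵐ[volume] partialD j φ) :
    ∫ x, gradSq φ x = ‖u.snd‖ ^ 2 := by
  have hi : ∀ j, Integrable fun x => ‖u.snd j x‖ ^ 2 := fun j => integrable_norm_sq _
  rw [PiLp.norm_sq_eq_of_L2]
  simp only [norm_sq_eq_integral]
  rw [← integral_finsetSum _ fun j _ => hi j]
  refine integral_congr_ae ?_
  filter_upwards [ae_all_iff.2 hu] with x hx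
  simp only [gradSq, hx]

theorem eLpNorm_regularized_le {u : Jet} (hu : u ∈ testJet) {δ : ℝ} (hδ : 0 < δ) :
    eLpNorm (fun x : R3 => (√(‖x‖ ^ 2 + δ ^ 2))⁻¹ • u.fst x) 2 volume ≤
      ENNReal.ofReal (2 * ‖u.snd‖) := by
  obtain ⟨φ, hφ, hu1, hu2⟩ := hu
  have hs : ∀ x : R3, 0 < ‖x‖ ^ 2 + δ ^ 2 := fun x => by positivity
  have hcs : Continuous fun x : R3 => (√(‖x‖ ^ 2 + δ ^ 2))⁻¹ :=
    (by fun_prop : Continuous fun x : R3 => √(‖x‖ ^ 2 + δ ^ 2)).inv₀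
      fun x => (Real.sqrt_pos.2 (hs x)).ne'
  have hcong : (fun x : R3 => (√(‖x‖ ^ 2 + δ ^ 2))⁻¹ • u.fst x) =ᵐ[volume]
      fun x => (√(‖x‖ ^ 2 + δ ^ 2))⁻¹ • φ x := by
    filter_upwards [hu1] with x hx
    rw [hx]
  have hnorm : ∀ x : R3, ‖(√(‖x‖ ^ 2 + δ ^ 2))⁻¹ • φ x‖ ^ 2 = ‖φ x‖ ^ 2 / (‖x‖ ^ 2 + δ ^ 2) := by
    intro x
    rw [norm_smul, norm_inv, Real.norm_of_nonneg (Real.sqrt_nonneg _), mul_pow, inv_pow,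
      Real.sq_sqrt (hs x).le]
    ring
  have hcont : Continuous fun x : R3 => (√(‖x‖ ^ 2 + δ ^ 2))⁻¹ • φ x :=
    hcs.smul hφ.1.continuous
  have hsupp : HasCompactSupport fun x : R3 => (√(‖x‖ ^ 2 + δ ^ 2))⁻¹ • φ x :=
    HasCompactSupport.smul_left (f := fun x : R3 => (√(‖x‖ ^ 2 + δ ^ 2))⁻¹) hφ.2.1
  rw [eLpNorm_congr_ae hcong]
  refine eLpNorm_two_le_ofReal hcont.aestronglyMeasurable ?_ (by positivity) ?_
  · exact Continuous.integrable_of_hasCompactSupport (hcont.norm.pow 2)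
      (hasCompactSupport_norm_sq hsupp)
  · simp only [hnorm]
    refine (integral_norm_sq_div_le hφ.1 hφ.2.1 hδ).trans_eq ?_
    rw [integral_gradSq hu2]
    ring

/-- Hardy's inequality in `H¹_σ`, by Fatou's lemma. -/
theorem eLpNorm_inv_norm_smul_le {u : Jet} (hu : u ∈ H1σ) :
    eLpNorm (fun x : R3 => ‖x‖⁻¹ • u.fst x) 2 volume ≤ ENNReal.ofReal (2 * ‖u.snd‖) := by
  obtain ⟨v, hv, hvu⟩ := mem_closure_iff_seq_limit.1
    (show u ∈ closure (testJet : Set Jet) from hu)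
  have hfst : Tendsto (fun n => (v n).fst) atTop (𝓝 u.fst) :=
    ((WithLp.continuous_fst 2 _ _).tendsto u).comp hvu
  have hsnd : Tendsto (fun n => (v n).snd) atTop (𝓝 u.snd) :=
    ((WithLp.continuous_snd 2 _ _).tendsto u).comp hvu
  obtain ⟨ns, hns, hae⟩ := (tendstoInMeasure_of_tendsto_Lp hfst).exists_seq_tendsto_ae
  set δ : ℕ → ℝ := fun n => 1 / ((n : ℝ) + 1) with hδ
  have hδ0 : Tendsto δ atTop (𝓝 0) := tendsto_one_div_add_atTop_nhds_zero_nat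
  have hδpos : ∀ n, 0 < δ n := fun n => by positivity
  set f : ℕ → R3 → C3 := fun n x => (√(‖x‖ ^ 2 + δ n ^ 2))⁻¹ • (v (ns n)).fst x with hf
  have hmeas : ∀ n, AEStronglyMeasurable (f n) volume := fun n => by
    have h : Measurable fun x : R3 => (√(‖x‖ ^ 2 + δ n ^ 2))⁻¹ := by fun_prop
    exact h.aestronglyMeasurable.smul (Lp.aestronglyMeasurable _)
  have hlim : ∀ᵐ x : R3, Tendsto (fun n => f n x) atTop (𝓝 (‖x‖⁻¹ • u.fst x)) := by
    filter_upwards [hae, Measure.ae_ne volume 0] with x hx hx0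
    refine Tendsto.smul ?_ hx
    have h1 : Tendsto (fun n => √(‖x‖ ^ 2 + δ n ^ 2)) atTop (𝓝 √(‖x‖ ^ 2 + 0 ^ 2)) :=
      (tendsto_const_nhds.add (hδ0.pow 2)).sqrt
    have h2 : √(‖x‖ ^ 2 + 0 ^ 2) = ‖x‖ := by simp
    rw [h2] at h1
    exact h1.inv₀ (norm_ne_zero_iff.2 hx0)
  refine (Lp.eLpNorm_lim_le_liminf_eLpNorm hmeas _ hlim).trans ?_
  have hb : Tendsto (fun n => ENNReal.ofReal (2 * ‖(v (ns n)).snd‖)) atTop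
      (𝓝 (ENNReal.ofReal (2 * ‖u.snd‖))) :=
    ENNReal.tendsto_ofReal (((hsnd.norm).const_mul 2).comp hns.tendsto_atTop)
  rw [← hb.liminf_eq]
  exact liminf_le_liminf (Eventually.of_forall fun n => eLpNorm_regularized_le (hv _) (hδpos n))

theorem memLp_inv_norm_smul {u : Jet} (hu : u ∈ H1σ) :
    MemLp (fun x : R3 => ‖x‖⁻¹ • u.fst x) 2 volume := by
  refine ⟨?_, (eLpNorm_inv_norm_smul_le hu).trans_lt ENNReal.ofReal_lt_top⟩
  have h : Measurable fun x : R3 => ‖x‖⁻¹ := by fun_prop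
  exact h.aestronglyMeasurable.smul (Lp.aestronglyMeasurable _)

theorem norm_toLp_inv_norm_smul_le {u : Jet} (hu : u ∈ H1σ) :
    ‖(memLp_inv_norm_smul hu).toLp _‖ ≤ 2 * ‖u.snd‖ := by
  rw [Lp.norm_toLp]
  exact ENNReal.toReal_le_of_le_ofReal (by positivity) (eLpNorm_inv_norm_smul_le hu)

/-- The operator `w ↦ w / |x|` from `H¹_σ` to `L²`. -/
noncomputable def hardyMap : H1σ →L[ℂ] L2 :=
  LinearMap.mkContinuous
    { toFun := fun u => (memLp_inv_norm_smul u.2).toLp _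
      map_add' := fun u v => by
        rw [← MemLp.toLp_add]
        refine MemLp.toLp_congr _ _ ?_
        filter_upwards [Lp.coeFn_add (u : Jet).fst (v : Jet).fst] with x hx
        change ‖x‖⁻¹ • ((u : Jet).fst + (v : Jet).fst) x = _
        rw [hx]
        exact smul_add _ _ _
      map_smul' := fun c u => by
        rw [RingHom.id_apply, ← MemLp.toLp_const_smul]
        refine MemLp.toLp_congr _ _ ?_
        filter_upwards [Lp.coeFn_smul c (u : Jet).fst] with x hx
        change ‖x‖⁻¹ • (c • (u : Jet).fst) x = _
        rw [hx]
        exact smul_comm ‖x‖⁻¹ c ((u : Jet).fst x) }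
    2 fun u => (norm_toLp_inv_norm_smul_le u.2).trans (mul_le_mul_of_nonneg_left
      (WithLp.norm_snd_le _ (u : Jet)) zero_le_two)

theorem hardyMap_ae (u : H1σ) :
    hardyMap u =ᵐ[volume] fun x => ‖x‖⁻¹ • (u : Jet).fst x :=
  MemLp.coeFn_toLp (memLp_inv_norm_smul u.2)

theorem norm_hardyMap_le (u : H1σ) : ‖hardyMap u‖ ≤ 2 * ‖(u : Jet).snd‖ :=
  norm_toLp_inv_norm_smul_le u.2

end Hardy

/-! ### The Landau solution is divergence free across the origin -/

section DivergenceFree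

theorem clm_apply_eq_sum {E : Type*} [NormedAddCommGroup E] [NormedSpace ℝ E] (L : R3 →L[ℝ] E)
    (x : R3) : L x = ∑ i, x i • L (EuclideanSpace.single i 1) := by
  have h : x = ∑ i, x i • (EuclideanSpace.single i 1 : R3) := by
    simpa using ((EuclideanSpace.basisFun (Fin 3) ℝ).sum_repr x).symm
  conv_lhs => rw [h]
  simp

variable {g : R3 → ℂ}

theorem contDiff_fderiv_apply (hg : ContDiff ℝ ∞ g) (v : R3) :
    ContDiff ℝ ∞ fun x => fderiv ℝ g x v :=
  (hg.fderiv_right (m := ∞) le_rfl).clm_apply contDiff_const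

theorem fderiv_fderiv_apply_comm (hg : ContDiff ℝ ∞ g) (x v w : R3) :
    fderiv ℝ (fun y => fderiv ℝ g y v) x w = fderiv ℝ (fun y => fderiv ℝ g y w) x v := by
  have hd : DifferentiableAt ℝ (fderiv ℝ g) x :=
    (hg.fderiv_right (m := ∞) le_rfl).differentiable (by simp) x
  have h : ∀ v w : R3, fderiv ℝ (fun y => fderiv ℝ g y v) x w = fderiv ℝ (fderiv ℝ g) x w v := by
    intro v w
    rw [fderiv_clm_apply hd (differentiableAt_const v)]
    simp
  rw [h, h]
  exact (hg.contDiffAt.isSymmSndFDerivAt (by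
    rw [minSmoothness_of_isRCLikeNormedField]
    exact WithTop.coe_le_coe.2 (le_top : (2 : ℕ∞) ≤ ⊤))) w v

theorem integral_fderiv_smul (hg : ContDiff ℝ ∞ g) (hgc : HasCompactSupport g) {h : R3 → ℝ}
    (hh : ContDiff ℝ ∞ h) (v : R3) :
    Integrable (fun x => fderiv ℝ h x v • g x) ∧ Integrable (fun x => h x • fderiv ℝ g x v) ∧
      ∫ x, fderiv ℝ h x v • g x = -∫ x, h x • fderiv ℝ g x v := by
  have hhd : Continuous fun x => fderiv ℝ h x v :=
    (hh.continuous_fderiv (by simp)).clm_apply continuous_const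
  have hgd : Continuous fun x => fderiv ℝ g x v :=
    (hg.continuous_fderiv (by simp)).clm_apply continuous_const
  have hgdc : HasCompactSupport fun x => fderiv ℝ g x v := hgc.fderiv_apply (𝕜 := ℝ) _
  have i1 : Integrable fun x => fderiv ℝ h x v • g x :=
    (hhd.smul hg.continuous).integrable_of_hasCompactSupport
      (HasCompactSupport.smul_left (f := fun x => fderiv ℝ h x v) hgc)
  have i2 : Integrable fun x => h x • fderiv ℝ g x v :=
    (hh.continuous.smul hgd).integrable_of_hasCompactSupport
      (HasCompactSupport.smul_left (f := h) hgdc)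
  have i3 : Integrable fun x => h x • g x :=
    (hh.continuous.smul hg.continuous).integrable_of_hasCompactSupport
      (HasCompactSupport.smul_left (f := h) hgc)
  refine ⟨i1, i2, ?_⟩
  rw [integral_smul_fderiv_eq_neg_fderiv_smul_of_integrable i1 i2 i3
    (fun x _ => hh.differentiable (by simp) x) (fun x _ => hg.differentiable (by simp) x), neg_neg]

/-- The field `2 h e + (x · ∇h) e - (e · ∇h) x` is the curl of `h e × x`, and hence orthogonal to
all gradients. -/
theorem integral_fderiv_curl_eq_zero (hg : ContDiff ℝ ∞ g) (hgc : HasCompactSupport g)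
    {h : R3 → ℝ} (hh : ContDiff ℝ ∞ h) (e : R3) :
    ∫ x, fderiv ℝ g x ((2 * h x + fderiv ℝ h x x) • e - fderiv ℝ h x e • x) = 0 := by
  set G : R3 → R3 → ℂ := fun v x => fderiv ℝ g x v with hG
  have hGc : ∀ v, ContDiff ℝ ∞ (G v) := contDiff_fderiv_apply hg
  have hGs : ∀ v, HasCompactSupport (G v) := fun v => hgc.fderiv_apply (𝕜 := ℝ) _
  have hk : ∀ (i : Fin 3) v, ContDiff ℝ ∞ fun x : R3 => x i • G v x := fun i v =>
    ((EuclideanSpace.proj i : R3 →L[ℝ] ℝ).contDiff).smul (hGc v)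
  have hks : ∀ (i : Fin 3) v, HasCompactSupport fun x : R3 => x i • G v x := fun i v =>
    HasCompactSupport.smul_left (f := fun x : R3 => x i) (hGs v)
  have hkd : ∀ (i : Fin 3) v w x, fderiv ℝ (fun x : R3 => x i • G v x) x w =
      x i • fderiv ℝ (G v) x w + w i • G v x := fun i v w x => by
    have := (hasFDerivAt_coord i x).smul ((hGc v).differentiable (by simp) x).hasFDerivAt
    have h2 : HasFDerivAt (fun x : R3 => x i • G v x) _ x := this
    rw [h2.fderiv]
    simp
  have a := fun i => integral_fderiv_smul (hk i e) (hks i e) hh (EuclideanSpace.single i 1)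
  have b := fun i => integral_fderiv_smul (hk i (EuclideanSpace.single i 1))
    (hks i (EuclideanSpace.single i 1)) hh e
  have i0 : Integrable fun x => (2 * h x) • G e x :=
    ((contDiff_const.mul hh).continuous.smul (hGc e).continuous).integrable_of_hasCompactSupport
      (HasCompactSupport.smul_left (f := fun x => 2 * h x) (hGs e))
  have hpt : ∀ x, fderiv ℝ g x ((2 * h x + fderiv ℝ h x x) • e - fderiv ℝ h x e • x) =
      (2 * h x) • G e x + ∑ i, fderiv ℝ h x (EuclideanSpace.single i 1) • (x i • G e x) -
        ∑ i, fderiv ℝ h x e • (x i • G (EuclideanSpace.single i 1) x) := by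
    intro x
    rw [map_sub, map_smul, map_smul, add_smul, clm_apply_eq_sum (fderiv ℝ h x) x,
      clm_apply_eq_sum (fderiv ℝ g x) x, Finset.sum_smul, Finset.smul_sum]
    simp only [smul_smul, smul_eq_mul, hG]
    congr 2
    exact Finset.sum_congr rfl fun i _ => by rw [mul_comm]
  have ia := integrable_finsetSum Finset.univ fun i _ => (a i).1
  have ib := integrable_finsetSum Finset.univ fun i _ => (b i).1
  have ia' := integrable_finsetSum Finset.univ fun i _ => (a i).2.1
  have ib' := integrable_finsetSum Finset.univ fun i _ => (b i).2.1
  have ea : ∫ x, ∑ i, fderiv ℝ h x (EuclideanSpace.single i 1) • (x i • G e x) =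
      -∫ x, ∑ i, h x • fderiv ℝ (fun x : R3 => x i • G e x) x (EuclideanSpace.single i 1) := by
    rw [integral_finsetSum _ fun i _ => (a i).1, integral_finsetSum _ fun i _ => (a i).2.1,
      ← Finset.sum_neg_distrib]
    exact Finset.sum_congr rfl fun i _ => (a i).2.2
  have eb : ∫ x, ∑ i, fderiv ℝ h x e • (x i • G (EuclideanSpace.single i 1) x) =
      -∫ x, ∑ i, h x • fderiv ℝ (fun x : R3 => x i • G (EuclideanSpace.single i 1) x) x e := by
    rw [integral_finsetSum _ fun i _ => (b i).1, integral_finsetSum _ fun i _ => (b i).2.1,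
      ← Finset.sum_neg_distrib]
    exact Finset.sum_congr rfl fun i _ => (b i).2.2
  simp only [hpt]
  refine (integral_sub (i0.add ia) ib).trans ?_
  rw [integral_add' i0 ia, ea, eb, ← sub_eq_add_neg, sub_neg_eq_add, ← integral_sub i0 ia']
  refine (integral_add (i0.sub ia') ib').symm.trans ?_
  -- After integration by parts the integrand vanishes by the symmetry of the Hessian of `g`.
  refine integral_eq_zero_of_ae (Eventually.of_forall fun x => ?_)
  have hsymm : ∀ i : Fin 3, fderiv ℝ (G e) x (EuclideanSpace.single i 1) =
      fderiv ℝ (G (EuclideanSpace.single i 1)) x e := fun i => fderiv_fderiv_apply_comm hg x _ _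
  have hGe : G e x = ∑ i, e i • G (EuclideanSpace.single i 1) x :=
    clm_apply_eq_sum (fderiv ℝ g x) e
  simp only [Pi.sub_apply, Pi.zero_apply, hkd, hsymm, hGe, Fin.sum_univ_three]
  simp
  ring

/-- The curl of `e × x / (A ρ - e · x)` with `ρ = (|x|² + δ²)^{1/2}`; for `δ = 0` it is half the
Landau solution. -/
noncomputable def regField (A : ℝ) (e : R3) (δ : ℝ) (x : R3) : R3 :=
  let ρ := √(‖x‖ ^ 2 + δ ^ 2)
  let h := (A * ρ - inner ℝ e x)⁻¹
  (2 * h - h * h * (A * ‖x‖ ^ 2 * ρ⁻¹ - inner ℝ e x)) • e +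
    (h * h * (A * inner ℝ e x * ρ⁻¹ - 1)) • x

theorem norm_le_sqrt (x : R3) (δ : ℝ) : ‖x‖ ≤ √(‖x‖ ^ 2 + δ ^ 2) :=
  Real.le_sqrt_of_sq_le (by nlinarith [sq_nonneg δ])

theorem le_mul_sqrt_sub_inner {A : ℝ} {e : R3} (he : ‖e‖ = 1) (x : R3) (δ : ℝ) :
    (A - 1) * √(‖x‖ ^ 2 + δ ^ 2) ≤ A * √(‖x‖ ^ 2 + δ ^ 2) - inner ℝ e x := by
  have h := real_inner_le_norm e x
  rw [he] at h
  linarith [norm_le_sqrt x δ]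

theorem integral_fderiv_regField (hg : ContDiff ℝ ∞ g) (hgc : HasCompactSupport g) {A : ℝ}
    (hA : 1 < A) {e : R3} (he : ‖e‖ = 1) {δ : ℝ} (hδ : 0 < δ) :
    ∫ x, fderiv ℝ g x (regField A e δ x) = 0 := by
  have hs : ∀ x : R3, 0 < ‖x‖ ^ 2 + δ ^ 2 := fun x => by positivity
  have hρ : ContDiff ℝ ∞ fun x : R3 => √(‖x‖ ^ 2 + δ ^ 2) :=
    (contDiff_norm_sq_add δ).sqrt fun x => (hs x).ne'
  have hD : ∀ x : R3, 0 < A * √(‖x‖ ^ 2 + δ ^ 2) - inner ℝ e x := fun x =>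
    (mul_pos (by linarith) (Real.sqrt_pos.2 (hs x))).trans_le (le_mul_sqrt_sub_inner he x δ)
  have hh : ContDiff ℝ ∞ fun x : R3 => (A * √(‖x‖ ^ 2 + δ ^ 2) - inner ℝ e x)⁻¹ :=
    ((contDiff_const.mul hρ).sub (innerSL ℝ e).contDiff).inv fun x => (hD x).ne'
  have hfd : ∀ x v : R3, fderiv ℝ (fun x : R3 => (A * √(‖x‖ ^ 2 + δ ^ 2) - inner ℝ e x)⁻¹) x v =
      -((A * √(‖x‖ ^ 2 + δ ^ 2) - inner ℝ e x)⁻¹ * (A * √(‖x‖ ^ 2 + δ ^ 2) - inner ℝ e x)⁻¹) *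
        (A * inner ℝ x v * (√(‖x‖ ^ 2 + δ ^ 2))⁻¹ - inner ℝ e v) := by
    intro x v
    have h1 : HasFDerivAt (fun x : R3 => ‖x‖ ^ 2 + δ ^ 2) (2 • innerSL ℝ x) x :=
      ((hasStrictFDerivAt_norm_sq x).hasFDerivAt).add_const _
    have h2 := ((h1.sqrt (hs x).ne').const_mul A).sub (innerSL ℝ e).hasFDerivAt
    have h3 : HasFDerivAt (fun x : R3 => (A * √(‖x‖ ^ 2 + δ ^ 2) - inner ℝ e x)⁻¹) _ x :=
      (hasDerivAt_inv (hD x).ne').comp_hasFDerivAt x h2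
    rw [h3.fderiv]
    have := (Real.sqrt_pos.2 (hs x)).ne'
    simp
    field_simp
  rw [← integral_fderiv_curl_eq_zero hg hgc hh e]
  refine integral_congr_ae (Eventually.of_forall fun x => ?_)
  simp only [hfd, regField]
  congr 1
  rw [real_inner_self_eq_norm_sq, real_inner_self_eq_norm_sq, he, real_inner_comm]
  module

/-- The regularised fields are dominated by a multiple of `1 / |x|`, uniformly in `δ`. -/
theorem norm_regField_le {A : ℝ} (hA : 1 < A) {e : R3} (he : ‖e‖ = 1) (δ : ℝ) {x : R3}
    (hx : x ≠ 0) :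
    ‖regField A e δ x‖ ≤ (2 * (A - 1)⁻¹ + 2 * (A + 1) * ((A - 1)⁻¹ * (A - 1)⁻¹)) * ‖x‖⁻¹ := by
  have hx0 : 0 < ‖x‖ := norm_pos_iff.2 hx
  have hxρ := norm_le_sqrt x δ
  have hDρ := le_mul_sqrt_sub_inner (A := A) he x δ
  have hi := abs_real_inner_le_norm e x
  rw [he, one_mul] at hi
  unfold regField
  set ρ := √(‖x‖ ^ 2 + δ ^ 2) with hρdef
  have hρ : 0 < ρ := hx0.trans_le hxρ
  have ha : 0 < A - 1 := by linarith
  have hA0 : 0 < A := by linarith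
  have hD : 0 < A * ρ - inner ℝ e x := (mul_pos ha hρ).trans_le hDρ
  simp only
  set h := (A * ρ - inner ℝ e x)⁻¹ with hh
  have h0 : 0 < h := inv_pos.2 hD
  have hle : h ≤ (A - 1)⁻¹ * ρ⁻¹ := by
    rw [← mul_inv]
    exact inv_anti₀ (mul_pos ha hρ) hDρ
  have hhle : h * h * ρ ≤ (A - 1)⁻¹ * (A - 1)⁻¹ * ρ⁻¹ := by
    have := mul_le_mul hle hle h0.le (by positivity)
    calc h * h * ρ ≤ (A - 1)⁻¹ * ρ⁻¹ * ((A - 1)⁻¹ * ρ⁻¹) * ρ :=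
          mul_le_mul_of_nonneg_right this hρ.le
      _ = _ := by field_simp
  have hρinv : ρ⁻¹ ≤ ‖x‖⁻¹ := inv_anti₀ hx0 hxρ
  have hiρ : |inner ℝ e x| ≤ ρ := hi.trans hxρ
  have b1 : |A * ‖x‖ ^ 2 * ρ⁻¹ - inner ℝ e x| ≤ (A + 1) * ρ := by
    have h1 : A * ‖x‖ ^ 2 * ρ⁻¹ ≤ A * ρ := by
      rw [mul_assoc]
      refine mul_le_mul_of_nonneg_left ?_ hA0.le
      rw [← div_eq_mul_inv, div_le_iff₀ hρ]
      nlinarith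
    have h2 : 0 ≤ A * ‖x‖ ^ 2 * ρ⁻¹ := by positivity
    rw [abs_le] at hiρ ⊢
    constructor <;> nlinarith
  have b2 : |A * inner ℝ e x * ρ⁻¹ - 1| ≤ A + 1 := by
    have h1 : |inner ℝ e x * ρ⁻¹| ≤ 1 := by
      rw [abs_mul, abs_of_pos (inv_pos.2 hρ), ← div_eq_mul_inv, div_le_one hρ]
      exact hiρ
    rw [abs_le] at h1 ⊢
    rw [mul_assoc]
    constructor <;> nlinarith
  have n1 : ‖(2 * h - h * h * (A * ‖x‖ ^ 2 * ρ⁻¹ - inner ℝ e x)) • e‖ ≤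
      2 * h + h * h * ((A + 1) * ρ) := by
    rw [norm_smul, he, mul_one]
    refine (norm_sub_le _ _).trans ?_
    rw [norm_mul, norm_mul, Real.norm_of_nonneg (by positivity : 0 ≤ h * h), Real.norm_ofNat,
      Real.norm_of_nonneg h0.le, Real.norm_eq_abs]
    gcongr
  have n2 : ‖(h * h * (A * inner ℝ e x * ρ⁻¹ - 1)) • x‖ ≤ h * h * (A + 1) * ρ := by
    rw [norm_smul, norm_mul, Real.norm_of_nonneg (by positivity : 0 ≤ h * h), Real.norm_eq_abs]
    gcongr
  calc _ ≤ (2 * h + h * h * ((A + 1) * ρ)) + h * h * (A + 1) * ρ := norm_add_le_of_le n1 n2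
    _ = 2 * h + 2 * (A + 1) * (h * h * ρ) := by ring
    _ ≤ 2 * ((A - 1)⁻¹ * ρ⁻¹) + 2 * (A + 1) * ((A - 1)⁻¹ * (A - 1)⁻¹ * ρ⁻¹) := by gcongr
    _ = (2 * (A - 1)⁻¹ + 2 * (A + 1) * ((A - 1)⁻¹ * (A - 1)⁻¹)) * ρ⁻¹ := by ring
    _ ≤ _ := by gcongr

theorem landauProfile_eq_regField {A : ℝ} (hA : 1 < A) {e : R3} (he : ‖e‖ = 1) {x : R3}
    (hx : x ≠ 0) : landauProfile A e x = (2 : ℝ) • regField A e 0 x := by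
  have hr : ‖x‖ ≠ 0 := norm_ne_zero_iff.2 hx
  have hD := (mul_norm_sub_inner_pos hA he hx).ne'
  have hs : √(‖x‖ ^ 2 + 0 ^ 2) = ‖x‖ := by simp
  rw [landauProfile_eq hA he hx, regField]
  simp only [hs]
  have h1 : A * ‖x‖ ^ 2 * ‖x‖⁻¹ = A * ‖x‖ := by field_simp
  have h2 : 2 * (A * ‖x‖ - inner ℝ e x)⁻¹ - (A * ‖x‖ - inner ℝ e x)⁻¹ *
      (A * ‖x‖ - inner ℝ e x)⁻¹ * (A * ‖x‖ - inner ℝ e x) = (A * ‖x‖ - inner ℝ e x)⁻¹ := by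
    rw [mul_assoc _ _ (A * ‖x‖ - inner ℝ e x), inv_mul_cancel₀ hD]
    ring
  rw [h1, h2]
  congr 3
  ring

theorem tendsto_regField {A : ℝ} (hA : 1 < A) {e : R3} (he : ‖e‖ = 1) {x : R3} (hx : x ≠ 0) :
    Tendsto (fun δ => regField A e δ x) (𝓝 0) (𝓝 (regField A e 0 x)) := by
  have hr : ‖x‖ ≠ 0 := norm_ne_zero_iff.2 hx
  have hD := (mul_norm_sub_inner_pos hA he hx).ne'
  have hs : √(‖x‖ ^ 2 + 0 ^ 2) = ‖x‖ := by simp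
  have h1 : ContinuousAt (fun δ : ℝ => √(‖x‖ ^ 2 + δ ^ 2)) 0 := by fun_prop
  have h2 : ContinuousAt (fun δ : ℝ => (√(‖x‖ ^ 2 + δ ^ 2))⁻¹) 0 := h1.inv₀ (by rwa [hs])
  have h3 : ContinuousAt (fun δ : ℝ => (A * √(‖x‖ ^ 2 + δ ^ 2) - inner ℝ e x)⁻¹) 0 :=
    ((continuousAt_const.mul h1).sub continuousAt_const).inv₀ (by
      change A * √(‖x‖ ^ 2 + 0 ^ 2) - inner ℝ e x ≠ 0
      rwa [hs])
  have h4 : ContinuousAt (fun δ => regField A e δ x) 0 := by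
    unfold regField
    simp only
    fun_prop
  exact h4

/-- The function `1 / |x|` is integrable near the origin of `ℝ³`. -/
theorem integrable_inv_norm_mul {f : R3 → ℝ} (hf : Continuous f) (hfc : HasCompactSupport f) :
    Integrable fun x : R3 => ‖x‖⁻¹ * f x := by
  obtain ⟨R, hR⟩ := hfc.isCompact.isBounded.subset_ball 0
  obtain ⟨M, hM⟩ := hf.bounded_above_of_compact_support hfc
  have h1 : IntegrableOn (fun x : R3 => ‖x‖⁻¹) (Metric.ball 0 R) := by
    rw [integrableOn_fun_norm_addHaar volume (f := fun r : ℝ => r⁻¹)]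
    have h2 : IntegrableOn (fun r : ℝ => r) (Set.Ioo 0 R) :=
      (continuous_id.integrableOn_Icc).mono_set Set.Ioo_subset_Icc_self
    refine h2.congr_fun (fun r hr => ?_) measurableSet_Ioo
    have hr0 : r ≠ 0 := hr.1.ne'
    simp only [finrank_euclideanSpace, Fintype.card_fin, smul_eq_mul]
    field_simp
  have h3 : Integrable ((Metric.ball (0 : R3) R).indicator fun x => ‖x‖⁻¹) :=
    h1.integrable_indicator measurableSet_ball
  have h4 : Measurable fun x : R3 => ‖x‖⁻¹ := by fun_prop
  refine (h3.mul_const M).mono (h4.aestronglyMeasurable.mul hf.aestronglyMeasurable)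
    (Eventually.of_forall fun x => ?_)
  by_cases hx : x ∈ Metric.ball (0 : R3) R
  · rw [Set.indicator_of_mem hx, norm_mul, norm_mul]
    exact mul_le_mul_of_nonneg_left ((hM x).trans (le_abs_self M)) (norm_nonneg _)
  · rw [image_eq_zero_of_notMem_tsupport fun h => hx (hR h), mul_zero, norm_zero]
    exact norm_nonneg _

/-- The Landau solution is divergence free in the sense of distributions, across the origin. -/
theorem integral_fderiv_landau_eq_zero (hg : ContDiff ℝ ∞ g) (hgc : HasCompactSupport g) {b : R3}
    (hb : b ≠ 0) : ∫ x, fderiv ℝ g x (landau b x) = 0 := by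
  obtain ⟨hA, -⟩ := landauParam_spec (norm_pos_iff.2 hb)
  set A := landauParam ‖b‖
  have he := norm_smul_inv_norm_eq_one hb
  set e := ‖b‖⁻¹ • b
  set C := 2 * (A - 1)⁻¹ + 2 * (A + 1) * ((A - 1)⁻¹ * (A - 1)⁻¹)
  set δ : ℕ → ℝ := fun n => 1 / ((n : ℝ) + 1) with hδ
  have hδ0 : Tendsto δ atTop (𝓝 0) := tendsto_one_div_add_atTop_nhds_zero_nat
  have hδpos : ∀ n, 0 < δ n := fun n => by positivity
  have hcont : Continuous fun x => fderiv ℝ g x := hg.continuous_fderiv (by simp)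
  have hmeas : ∀ d, Measurable fun x => regField A e d x := fun d => by
    unfold regField
    fun_prop
  have hlim : Tendsto (fun n => ∫ x, fderiv ℝ g x (regField A e (δ n) x)) atTop
      (𝓝 (∫ x, fderiv ℝ g x (regField A e 0 x))) := by
    refine tendsto_integral_of_dominated_convergence (fun x => C * (‖x‖⁻¹ * ‖fderiv ℝ g x‖)) ?_
      ((integrable_inv_norm_mul hcont.norm ((hgc.fderiv (𝕜 := ℝ)).norm)).const_mul C) ?_ ?_
    · exact fun n => (isBoundedBilinearMap_apply.continuous.comp_aestronglyMeasurable
        (hcont.aestronglyMeasurable.prodMk (hmeas _).aestronglyMeasurable))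
    · intro n
      filter_upwards [Measure.ae_ne volume 0] with x hx
      refine ((fderiv ℝ g x).le_opNorm _).trans ?_
      have := mul_le_mul_of_nonneg_left (norm_regField_le hA he (δ n) hx)
        (norm_nonneg (fderiv ℝ g x))
      linarith
    · filter_upwards [Measure.ae_ne volume 0] with x hx
      exact ((fderiv ℝ g x).continuous.tendsto _).comp ((tendsto_regField hA he hx).comp hδ0)
  have h0 : ∫ x, fderiv ℝ g x (regField A e 0 x) = 0 := by
    refine tendsto_nhds_unique hlim ?_
    simp only [integral_fderiv_regField hg hgc hA he (hδpos _)]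
    exact tendsto_const_nhds
  have h1 : (fun x => fderiv ℝ g x (landau b x)) =ᵐ[volume]
      fun x => (2 : ℝ) • fderiv ℝ g x (regField A e 0 x) := by
    filter_upwards [Measure.ae_ne volume 0] with x hx
    rw [landau, landauProfile_eq_regField hA he hx, map_smul]
  rw [integral_congr_ae h1, integral_smul, h0, smul_zero]

end DivergenceFree

/-! ### Multiplication of gradients by a bounded field -/

section Multipliers

/-- A measurable family of linear maps from gradients to vectors, bounded by `C`, acts on square
integrable gradients with norm at most `C`. -/
theorem exists_multiplier (q : R3 → (Fin 3 → C3) →ₗ[ℂ] C3) {C : ℝ} (hC : 0 ≤ C)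
    (hmeas : ∀ G : Fin 3 → R3 → C3, (∀ j, AEStronglyMeasurable (G j) volume) →
      AEStronglyMeasurable (fun x => q x fun j => G j x) volume)
    (hle : ∀ x G, ‖q x G‖ ^ 2 ≤ C ^ 2 * ∑ j, ‖G j‖ ^ 2) :
    ∃ M : (PiLp 2 fun _ : Fin 3 => L2) →L[ℂ] L2,
      (∀ G, M G =ᵐ[volume] fun x => q x fun j => G j x) ∧ ∀ G, ‖M G‖ ≤ C * ‖G‖ := by
  have hm : ∀ G : PiLp 2 fun _ : Fin 3 => L2,
      AEStronglyMeasurable (fun x => q x fun j => G j x) volume := fun G =>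
    hmeas (fun j => G j) fun j => Lp.aestronglyMeasurable _
  have hdom : ∀ G : PiLp 2 fun _ : Fin 3 => L2,
      Integrable fun x => C ^ 2 * ∑ j, ‖G j x‖ ^ 2 := fun G =>
    (integrable_finsetSum _ fun j _ => integrable_norm_sq (G j)).const_mul _
  have hi : ∀ G : PiLp 2 fun _ : Fin 3 => L2,
      Integrable fun x => ‖q x fun j => G j x‖ ^ 2 := fun G => by
    refine (hdom G).mono ((hm G).norm.pow 2) (Eventually.of_forall fun x => ?_)
    rw [Real.norm_of_nonneg (sq_nonneg _)]
    exact (hle x _).trans (le_abs_self _)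
  have hLp : ∀ G : PiLp 2 fun _ : Fin 3 => L2, MemLp (fun x => q x fun j => G j x) 2 volume :=
    fun G => (memLp_two_iff_integrable_sq_norm (hm G)).2 (hi G)
  have hnorm : ∀ G : PiLp 2 fun _ : Fin 3 => L2, ‖(hLp G).toLp _‖ ≤ C * ‖G‖ := by
    intro G
    rw [Lp.norm_toLp]
    refine ENNReal.toReal_le_of_le_ofReal (by positivity)
      (eLpNorm_two_le_ofReal (hm G) (hi G) (by positivity) ?_)
    refine (integral_mono (hi G) (hdom G) fun x => hle x _).trans_eq ?_
    rw [integral_const_mul, integral_finsetSum _ fun j _ => integrable_norm_sq (G j), mul_pow,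
      PiLp.norm_sq_eq_of_L2]
    simp only [norm_sq_eq_integral]
  let M : (PiLp 2 fun _ : Fin 3 => L2) →ₗ[ℂ] L2 :=
    { toFun := fun G => (hLp G).toLp _
      map_add' := fun G G' => by
        rw [← MemLp.toLp_add]
        refine MemLp.toLp_congr _ _ ?_
        filter_upwards [ae_all_iff.2 fun j => Lp.coeFn_add (G j) (G' j)] with x hx
        rw [Pi.add_apply, ← map_add]
        congr 1
        exact funext hx
      map_smul' := fun c G => by
        rw [RingHom.id_apply, ← MemLp.toLp_const_smul]
        refine MemLp.toLp_congr _ _ ?_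
        filter_upwards [ae_all_iff.2 fun j => Lp.coeFn_smul c (G j)] with x hx
        rw [Pi.smul_apply, ← map_smul]
        congr 1
        exact funext hx }
  exact ⟨M.mkContinuous C hnorm, fun G => MemLp.coeFn_toLp (hLp G), hnorm⟩

variable {m : R3 → R3} {C : ℝ}

theorem exists_transport_multiplier (hm : Measurable m) (hC : 0 ≤ C) (hle : ∀ x, ‖m x‖ ≤ C) :
    ∃ M : (PiLp 2 fun _ : Fin 3 => L2) →L[ℂ] L2,
    (∀ G, M G =ᵐ[volume] fun x => ∑ j, (m x j : ℂ) • G j x) ∧ ∀ G, ‖M G‖ ≤ C * ‖G‖ := by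
  refine exists_multiplier
    (fun x => ∑ j, (m x j : ℂ) • (LinearMap.proj j : (Fin 3 → C3) →ₗ[ℂ] C3)) hC ?_ ?_ |>.imp
      fun M hM => ⟨fun G => (hM.1 G).trans (Eventually.of_forall fun x => by simp), hM.2⟩
  · intro G hG
    simp only [LinearMap.sum_apply, LinearMap.smul_apply, LinearMap.proj_apply]
    refine Finset.aestronglyMeasurable_fun_sum _ fun j _ => ?_
    have h : Measurable fun x => (m x j : ℂ) := by fun_prop
    exact h.aestronglyMeasurable.smul (hG j)
  · intro x G
    simp only [LinearMap.sum_apply, LinearMap.smul_apply, LinearMap.proj_apply]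
    have h1 : ‖∑ j, (m x j : ℂ) • G j‖ ≤ ∑ j, |m x j| * ‖G j‖ :=
      (norm_sum_le _ _).trans_eq (Finset.sum_congr rfl fun j _ => by
        rw [norm_smul, Complex.norm_real, Real.norm_eq_abs])
    calc ‖∑ j, (m x j : ℂ) • G j‖ ^ 2 ≤ (∑ j, |m x j| * ‖G j‖) ^ 2 :=
          pow_le_pow_left₀ (norm_nonneg _) h1 2
      _ ≤ (∑ j, |m x j| ^ 2) * ∑ j, ‖G j‖ ^ 2 := Finset.sum_mul_sq_le_sq_mul_sq _ _ _
      _ = ‖m x‖ ^ 2 * ∑ j, ‖G j‖ ^ 2 := by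
          simp only [sq_abs]
          rw [EuclideanSpace.real_norm_sq_eq]
      _ ≤ _ := mul_le_mul_of_nonneg_right (pow_le_pow_left₀ (norm_nonneg _) (hle x) 2)
          (Finset.sum_nonneg fun _ _ => sq_nonneg _)

theorem exists_contract_multiplier (hm : Measurable m) (hC : 0 ≤ C) (hle : ∀ x, ‖m x‖ ≤ C) :
    ∃ M : (PiLp 2 fun _ : Fin 3 => L2) →L[ℂ] L2,
    (∀ G, M G =ᵐ[volume] fun x => WithLp.toLp 2 fun k => ∑ j, (m x j : ℂ) * G k x j) ∧
      ∀ G, ‖M G‖ ≤ C * ‖G‖ := by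
  let q : R3 → (Fin 3 → C3) →ₗ[ℂ] C3 := fun x =>
    { toFun := fun G => WithLp.toLp 2 fun k => ∑ j, (m x j : ℂ) * G k j
      map_add' := fun G G' => by
        ext k
        simp [mul_add, Finset.sum_add_distrib]
      map_smul' := fun c G => by
        ext k
        simp [Finset.mul_sum, mul_left_comm] }
  refine exists_multiplier q hC ?_ ?_
  · intro G hG
    change AEStronglyMeasurable (fun x => (WithLp.toLp 2 fun k => ∑ j, (m x j : ℂ) * G k x j : C3))
      volume
    have hGm : ∀ k, AEMeasurable (G k) volume := fun k => (hG k).aemeasurable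
    refine AEMeasurable.aestronglyMeasurable ?_
    refine (WithLp.measurable_toLp 2 _).comp_aemeasurable (aemeasurable_pi_lambda _ fun k => ?_)
    refine Finset.aemeasurable_fun_sum _ fun j _ => AEMeasurable.mul ?_ ?_
    · exact Measurable.aemeasurable (by fun_prop)
    · exact (EuclideanSpace.proj j : C3 →L[ℂ] ℂ).continuous.measurable.comp_aemeasurable (hGm k)
  · intro x G
    change ‖(WithLp.toLp 2 fun k => ∑ j, (m x j : ℂ) * G k j : C3)‖ ^ 2 ≤ _
    rw [EuclideanSpace.norm_sq_eq, Finset.mul_sum]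
    refine Finset.sum_le_sum fun k _ => ?_
    have h1 : ‖∑ j, (m x j : ℂ) * G k j‖ ≤ ∑ j, |m x j| * ‖G k j‖ :=
      (norm_sum_le _ _).trans_eq (Finset.sum_congr rfl fun j _ => by
        rw [norm_mul, Complex.norm_real, Real.norm_eq_abs])
    calc ‖∑ j, (m x j : ℂ) * G k j‖ ^ 2 ≤ (∑ j, |m x j| * ‖G k j‖) ^ 2 :=
          pow_le_pow_left₀ (norm_nonneg _) h1 2
      _ ≤ (∑ j, |m x j| ^ 2) * ∑ j, ‖G k j‖ ^ 2 := Finset.sum_mul_sq_le_sq_mul_sq _ _ _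
      _ = ‖m x‖ ^ 2 * ‖G k‖ ^ 2 := by
          simp only [sq_abs]
          rw [EuclideanSpace.real_norm_sq_eq, EuclideanSpace.norm_sq_eq]
      _ ≤ _ := mul_le_mul_of_nonneg_right (pow_le_pow_left₀ (norm_nonneg _) (hle x) 2)
          (sq_nonneg _)

end Multipliers

/-! ### The spaces of the theorem -/

section Spaces

instance : CompleteSpace H1σ :=
  (Submodule.isClosed_topologicalClosure testJet).completeSpace_coe

instance : CompleteSpace L2σ :=
  (Submodule.isClosed_topologicalClosure testL2).completeSpace_coe

-- The inner product of the Hilbert space `H¹_σ`, and not the one of a Hilbert `C⋆`-module over `ℂ`,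
-- is the one to be found by instance search.
noncomputable instance : Inner ℂ H1σ := (Submodule.innerProductSpace H1σ).toInner

noncomputable instance : Inner ℂ L2σ := (Submodule.innerProductSpace L2σ).toInner

theorem fst_mem_L2σ {u : Jet} (hu : u ∈ H1σ) : u.fst ∈ L2σ := by
  have h : Set.MapsTo (fun u : Jet => u.fst) (testJet : Set Jet) (testL2 : Set L2) := by
    rintro u ⟨φ, hφ, hu, -⟩
    exact ⟨φ, hφ, hu⟩
  exact map_mem_closure (WithLp.continuous_fst 2 _ _) hu h

/-- The embedding of `H¹_σ` into `L²_σ`. -/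
noncomputable def embedding : H1σ →L[ℂ] L2σ :=
  ((WithLp.fstL 2 ℂ L2 (PiLp 2 fun _ : Fin 3 => L2)).comp H1σ.subtypeL).codRestrict L2σ
    fun u => fst_mem_L2σ u.2

/-- The gradient on `H¹_σ`. -/
noncomputable def gradMap : H1σ →L[ℂ] PiLp 2 fun _ : Fin 3 => L2 :=
  (WithLp.sndL 2 ℂ L2 (PiLp 2 fun _ : Fin 3 => L2)).comp H1σ.subtypeL

theorem coe_embedding (u : H1σ) : (embedding u : L2) = (u : Jet).fst := rfl

theorem gradMap_apply (u : H1σ) : gradMap u = (u : Jet).snd := rfl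

theorem norm_sq_H1σ (u : H1σ) : ‖u‖ ^ 2 = ‖embedding u‖ ^ 2 + ‖gradMap u‖ ^ 2 :=
  WithLp.prod_norm_sq_eq_of_L2 (u : Jet)

/-- `u` is the jet of the smooth field `φ`. -/
def IsJetOf (u : H1σ) (φ : R3 → C3) : Prop :=
  (u : Jet).fst =ᵐ[volume] φ ∧ ∀ j, (u : Jet).snd j =ᵐ[volume] partialD j φ

theorem exists_isJetOf {φ : R3 → C3} (hφ : φ ∈ testFields) : ∃ u : H1σ, IsJetOf u φ := by
  have h1 : MemLp φ 2 volume := hφ.1.continuous.memLp_of_hasCompactSupport hφ.2.1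
  have h2 : ∀ j, MemLp (partialD j φ) 2 volume := fun j =>
    (continuous_partialD j hφ.1).memLp_of_hasCompactSupport (hasCompactSupport_partialD j hφ.2.1)
  let u : Jet := WithLp.toLp 2 (h1.toLp φ, WithLp.toLp 2 fun j => (h2 j).toLp _)
  have hu : u ∈ testJet := ⟨φ, hφ, h1.coeFn_toLp, fun j => (h2 j).coeFn_toLp⟩
  exact ⟨⟨u, Submodule.le_topologicalClosure _ hu⟩, h1.coeFn_toLp, fun j => (h2 j).coeFn_toLp⟩

/-- A closed condition on `H¹_σ` need only be checked for jets of test fields. -/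
theorem H1σ_induction {p : H1σ → Prop} (hp : IsClosed {u | p u})
    (h : ∀ φ ∈ testFields, ∀ u, IsJetOf u φ → p u) (u : H1σ) : p u := by
  have hu : u ∈ closure ((↑) ⁻¹' (testJet : Set Jet) : Set H1σ) := by
    rw [closure_subtype]
    exact closure_mono
      (show (testJet : Set Jet) ⊆ ((↑) : H1σ → Jet) '' ((↑) ⁻¹' (testJet : Set Jet)) from
        fun v hv => ⟨⟨v, Submodule.le_topologicalClosure testJet hv⟩, hv, rfl⟩) u.2
  refine closure_minimal ?_ hp hu
  rintro v ⟨φ, hφ, hv⟩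
  exact h φ hφ v hv

theorem denseRange_embedding : DenseRange embedding := by
  intro f
  rw [closure_subtype]
  refine closure_mono ?_ f.2
  rintro g ⟨φ, hφ, hg⟩
  obtain ⟨u, hu⟩ := exists_isJetOf hφ
  have h : (u : Jet).fst = g := Lp.ext (hu.1.trans hg.symm)
  exact ⟨embedding u, ⟨u, rfl⟩, h⟩

theorem inner_C3 (a b : C3) : inner ℂ a b = ∑ k, b k * conj (a k) := by
  simp [PiLp.inner_apply]

/-- In the definition of `lerayGraph` all of `H¹_σ` may serve as test fields if the
pairing with test fields extends continuously to `H¹_σ`. -/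
theorem mem_lerayGraph_iff {F : Jet → (R3 → C3) → ℂ} {a : H1σ → H1σ → ℂ}
    (ha : ∀ u, Continuous (a u)) (h : ∀ u v : H1σ, ∀ φ, IsJetOf v φ → F u φ = a u v)
    (p : L2σ × L2σ) : p ∈ lerayGraph F ↔
      ∃ u, embedding u = p.1 ∧ ∀ v, inner ℂ (embedding v) p.2 = a u v := by
  have hpair : ∀ (f : L2σ) (v : H1σ) φ, IsJetOf v φ →
      ∫ x, ∑ k, (f : L2) x k * conj (φ x k) = inner ℂ (embedding v) f := by
    intro f v φ hv
    rw [Submodule.coe_inner, L2.inner_def, coe_embedding]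
    refine integral_congr_ae ?_
    filter_upwards [hv.1] with x hx
    rw [inner_C3, hx]
  constructor
  · rintro ⟨u, hu, hup, huF⟩
    refine ⟨⟨u, hu⟩, Subtype.ext hup, fun v => ?_⟩
    refine H1σ_induction (p := fun v => inner ℂ (embedding v) p.2 = a ⟨u, hu⟩ v)
      (isClosed_eq (embedding.continuous.inner continuous_const)
        (ha _)) (fun φ hφ v hv => ?_) v
    rw [← hpair _ v φ hv, ← huF φ hφ]
    exact h ⟨u, hu⟩ v φ hv
  · rintro ⟨u, hup, hu⟩
    refine ⟨u, u.2, congrArg Subtype.val hup, fun φ hφ => ?_⟩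
    obtain ⟨v, hv⟩ := exists_isJetOf hφ
    rw [hpair _ v φ hv, hu v]
    exact h u v φ hv

end Spaces

/-! ### The terms of the operators as inner products -/

section Pairings

theorem measurable_landau (b : R3) : Measurable (landau b) := by
  unfold landau landauProfile
  fun_prop

theorem negLaplacian_eq {u v : H1σ} {φ : R3 → C3} (hv : IsJetOf v φ) :
    negLaplacian u φ = inner ℂ (gradMap v) (gradMap u) := by
  rw [PiLp.inner_apply]
  simp only [L2.inner_def]
  rw [← integral_finsetSum _ fun j _ => L2.integrable_inner _ _]
  refine integral_congr_ae ?_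
  filter_upwards [ae_all_iff.2 hv.2] with x hx
  refine Finset.sum_congr rfl fun j _ => ?_
  rw [inner_C3, gradMap_apply, gradMap_apply, hx]

variable {b : R3} {T S : (PiLp 2 fun _ : Fin 3 => L2) →L[ℂ] L2}

theorem transport_eq
    (hT : ∀ G, T G =ᵐ[volume] fun x => ∑ j, ((‖x‖ • landau b x) j : ℂ) • G j x) {u v : H1σ}
    {φ : R3 → C3} (hv : IsJetOf v φ) :
    transport b u φ = inner ℂ (hardyMap v) (T (gradMap u)) := by
  rw [L2.inner_def]
  refine integral_congr_ae ?_
  filter_upwards [hv.1, hT (gradMap u), hardyMap_ae v, Measure.ae_ne volume 0] with x h1 h2 h3 hx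
  have hr : (‖x‖ : ℂ) ≠ 0 := by exact_mod_cast norm_ne_zero_iff.2 hx
  rw [h2, h3, h1, inner_C3, Finset.sum_comm]
  refine Finset.sum_congr rfl fun k _ => ?_
  simp only [gradMap_apply, Fin.sum_univ_three, PiLp.add_apply, PiLp.smul_apply, smul_eq_mul,
    Complex.real_smul, map_mul, map_inv₀, Complex.conj_ofReal, Complex.ofReal_mul,
    Complex.ofReal_inv]
  field_simp

theorem gradContract_eq
    (hS : ∀ G, S G =ᵐ[volume] fun x => WithLp.toLp 2 fun k =>
      ∑ j, ((‖x‖ • landau b x) j : ℂ) * G k x j) {u v : H1σ}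
    {φ : R3 → C3} (hv : IsJetOf v φ) :
    gradContract b u φ = inner ℂ (hardyMap v) (S (gradMap u)) := by
  rw [L2.inner_def]
  refine integral_congr_ae ?_
  filter_upwards [hv.1, hS (gradMap u), hardyMap_ae v, Measure.ae_ne volume 0] with x h1 h2 h3 hx
  have hr : (‖x‖ : ℂ) ≠ 0 := by exact_mod_cast norm_ne_zero_iff.2 hx
  rw [h2, h3, h1, inner_C3, Finset.sum_comm]
  refine Finset.sum_congr rfl fun k _ => ?_
  simp only [gradMap_apply, Fin.sum_univ_three, PiLp.smul_apply, smul_eq_mul,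
    Complex.real_smul, map_mul, map_inv₀, Complex.conj_ofReal, Complex.ofReal_mul,
    Complex.ofReal_inv]
  field_simp

/-- Here the gradient of the test field enters: `∇ · (u ⊗ U)` is tested as `-⟨∑ₖ Uₖ ∇vₖ, u⟩`. -/
theorem divTensor_eq
    (hS : ∀ G, S G =ᵐ[volume] fun x => WithLp.toLp 2 fun k =>
      ∑ j, ((‖x‖ • landau b x) j : ℂ) * G k x j) {u v : H1σ}
    {φ : R3 → C3} (hv : IsJetOf v φ) :
    divTensor b u φ = -inner ℂ (S (gradMap v)) (hardyMap u) := by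
  rw [L2.inner_def, divTensor, neg_inj]
  refine integral_congr_ae ?_
  filter_upwards [ae_all_iff.2 hv.2, hS (gradMap v), hardyMap_ae u, Measure.ae_ne volume 0]
    with x h1 h2 h3 hx
  have hr : (‖x‖ : ℂ) ≠ 0 := by exact_mod_cast norm_ne_zero_iff.2 hx
  rw [h2, h3, inner_C3]
  refine Finset.sum_congr rfl fun k _ => ?_
  simp only [gradMap_apply, h1, Fin.sum_univ_three, PiLp.smul_apply, smul_eq_mul, map_add,
    Complex.real_smul, map_mul, Complex.conj_ofReal, Complex.ofReal_mul, Complex.ofReal_inv]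
  field_simp

/-- The transport term is skew-Hermitian, since `U^b` is divergence free. -/
theorem inner_transport_skew (hb : b ≠ 0)
    (hT : ∀ G, T G =ᵐ[volume] fun x => ∑ j, ((‖x‖ • landau b x) j : ℂ) • G j x) (u v : H1σ) :
    inner ℂ (T (gradMap v)) (hardyMap u) = -inner ℂ (hardyMap v) (T (gradMap u)) := by
  have c1 : ∀ w, Continuous fun u : H1σ => inner ℂ (T (gradMap w)) (hardyMap u) := fun w =>
    continuous_const.inner hardyMap.continuous
  have c2 : ∀ w, Continuous fun u : H1σ => inner ℂ (hardyMap w) (T (gradMap u)) := fun w =>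
    continuous_const.inner (T.continuous.comp gradMap.continuous)
  have c3 : ∀ w, Continuous fun v : H1σ => inner ℂ (T (gradMap v)) (hardyMap w) := fun w =>
    (T.continuous.comp gradMap.continuous).inner continuous_const
  have c4 : ∀ w, Continuous fun v : H1σ => inner ℂ (hardyMap v) (T (gradMap w)) := fun w =>
    hardyMap.continuous.inner continuous_const
  refine H1σ_induction (p := fun u => inner ℂ (T (gradMap v)) (hardyMap u) =
    -inner ℂ (hardyMap v) (T (gradMap u))) (isClosed_eq (c1 v) (c2 v).neg) (fun φ hφ u hu => ?_) u
  refine H1σ_induction (p := fun v => inner ℂ (T (gradMap v)) (hardyMap u) =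
    -inner ℂ (hardyMap v) (T (gradMap u))) (isClosed_eq (c3 u) (c4 u).neg) (fun ψ hψ v hv => ?_) v
  set g : R3 → ℂ := fun x => inner ℂ (ψ x) (φ x) with hg
  have hgc : ContDiff ℝ ∞ g := hψ.1.inner ℂ hφ.1
  have hgs : HasCompactSupport g := by
    refine hφ.2.1.mono fun x hx h0 => hx ?_
    simp only [hg]
    rw [h0, inner_zero_right]
  have h0 := integral_fderiv_landau_eq_zero hgc hgs hb
  rw [← add_eq_zero_iff_eq_neg, L2.inner_def, L2.inner_def,
    ← integral_add (L2.integrable_inner _ _) (L2.integrable_inner _ _), ← h0]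
  refine integral_congr_ae ?_
  filter_upwards [hu.1, hv.1, ae_all_iff.2 hu.2, ae_all_iff.2 hv.2, hT (gradMap u),
    hT (gradMap v), hardyMap_ae u, hardyMap_ae v, Measure.ae_ne volume 0]
    with x hu1 hv1 hu2 hv2 hTu hTv hRu hRv hx
  have hr : (‖x‖ : ℂ) ≠ 0 := by exact_mod_cast norm_ne_zero_iff.2 hx
  have hd : fderiv ℝ g x (landau b x) =
      inner ℂ (ψ x) (∑ j, landau b x j • partialD j φ x) +
        inner ℂ (∑ j, landau b x j • partialD j ψ x) (φ x) := by
    have h1 := ((hψ.1.differentiable (by simp) x).hasFDerivAt).inner ℂ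
      (hφ.1.differentiable (by simp) x).hasFDerivAt
    rw [h1.fderiv]
    change inner ℂ (ψ x) (fderiv ℝ φ x (landau b x)) +
      inner ℂ (fderiv ℝ ψ x (landau b x)) (φ x) = _
    rw [clm_apply_eq_sum (fderiv ℝ φ x), clm_apply_eq_sum (fderiv ℝ ψ x)]
    rfl
  rw [hd, hTu, hTv, hRu, hRv, hu1, hv1, add_comm]
  simp only [gradMap_apply, hu2, hv2, inner_C3, Fin.sum_univ_three, PiLp.add_apply,
    PiLp.smul_apply, smul_eq_mul, map_add,
    Complex.real_smul, map_mul, map_inv₀, Complex.conj_ofReal, Complex.ofReal_mul,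
    Complex.ofReal_inv]
  field_simp

end Pairings

/-! ### Form-bounded perturbations -/

section AbstractForm

variable {V G E : Type*} [NormedAddCommGroup V] [InnerProductSpace ℂ V] [CompleteSpace V]
  [NormedAddCommGroup G] [InnerProductSpace ℂ G] [CompleteSpace G]
  [NormedAddCommGroup E] [InnerProductSpace ℂ E] [CompleteSpace E]
  (D : V →L[ℂ] G) (R : V →L[ℂ] E) (T S : G →L[ℂ] E) (c : ℂ)

/-- The operator of the form `⟨D v, D u⟩ + ⟨R v, T D u⟩ + c ⟨S D v, R u⟩`. -/
noncomputable def perturbedForm : V →L[ℂ] V :=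
  D.adjoint.comp D + R.adjoint.comp (T.comp D) + c • D.adjoint.comp (S.adjoint.comp R)

theorem inner_perturbedForm (u v : V) : inner ℂ v (perturbedForm D R T S c u) =
    inner ℂ (D v) (D u) + inner ℂ (R v) (T (D u)) + c * inner ℂ (S (D v)) (R u) := by
  simp only [perturbedForm, add_apply, smul_apply, ContinuousLinearMap.comp_apply, inner_add_right,
    inner_smul_right, ContinuousLinearMap.adjoint_inner_right]

theorem inner_adjoint_perturbedForm (u v : V) :
    inner ℂ v ((perturbedForm D R T S c).adjoint u) =
      inner ℂ (D v) (D u) + inner ℂ (T (D v)) (R u) + conj c * inner ℂ (R v) (S (D u)) := by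
  rw [ContinuousLinearMap.adjoint_inner_right, ← inner_conj_symm, inner_perturbedForm]
  simp only [map_add, map_mul, inner_conj_symm]

variable {H : Type*} [NormedAddCommGroup H] [InnerProductSpace ℂ H] {i : V →L[ℂ] H}

/-- If `‖R u‖ ≤ 2 ‖D u‖`, as in Hardy's inequality, and `T`, `S` have norm at most `1 / 6`, the
perturbation is at most `2 / 3` of the leading part. -/
theorem isSectorialForm_perturbedForm (hi : DenseRange i)
    (hV : ∀ u, ‖u‖ ^ 2 = ‖i u‖ ^ 2 + ‖D u‖ ^ 2) (hR : ∀ u, ‖R u‖ ≤ 2 * ‖D u‖)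
    (hT : ∀ g, ‖T g‖ ≤ 1 / 6 * ‖g‖) (hS : ∀ g, ‖S g‖ ≤ 1 / 6 * ‖g‖) (hc : ‖c‖ = 1) :
    IsSectorialForm 2 i (perturbedForm D R T S c) := by
  have key : ∀ u : V, ∃ p : ℂ, inner ℂ u (perturbedForm D R T S c u) = (‖D u‖ ^ 2 : ℝ) + p ∧
      ‖p‖ ≤ 2 / 3 * ‖D u‖ ^ 2 := by
    intro u
    refine ⟨inner ℂ (R u) (T (D u)) + c * inner ℂ (S (D u)) (R u), ?_, ?_⟩
    · rw [inner_perturbedForm, inner_self_eq_norm_sq_to_K, add_assoc]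
      simp
    · have h1 : ‖inner ℂ (R u) (T (D u))‖ ≤ 2 * ‖D u‖ * (1 / 6 * ‖D u‖) :=
        (norm_inner_le_norm _ _).trans
          (mul_le_mul (hR u) (hT _) (norm_nonneg _) (by positivity))
      have h2 : ‖c * inner ℂ (S (D u)) (R u)‖ ≤ 1 / 6 * ‖D u‖ * (2 * ‖D u‖) := by
        rw [norm_mul, hc, one_mul]
        exact (norm_inner_le_norm _ _).trans
          (mul_le_mul (hS _) (hR u) (norm_nonneg _) (by positivity))
      refine (norm_add_le_of_le h1 h2).trans_eq ?_
      ring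
  have hre : ∀ u : V, 1 / 3 * ‖D u‖ ^ 2 ≤ (inner ℂ u (perturbedForm D R T S c u)).re := by
    intro u
    obtain ⟨p, h1, h2⟩ := key u
    rw [h1, Complex.add_re, Complex.ofReal_re]
    have h3 := (abs_le.1 ((Complex.abs_re_le_norm p).trans h2)).1
    linarith
  refine ⟨two_pos, fun u => ?_, ⟨1 / 3, by norm_num, fun u => ?_⟩, hi⟩
  · obtain ⟨p, h1, h2⟩ := key u
    refine le_trans ?_ (mul_le_mul_of_nonneg_left (hre u) zero_le_two)
    rw [h1, Complex.add_im, Complex.ofReal_im, zero_add]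
    have := (Complex.abs_im_le_norm p).trans h2
    linarith
  · rw [hV]
    have := hre u
    nlinarith [sq_nonneg ‖i u‖]

/-- An operator given weakly by the form of `perturbedForm`, and the one given by the adjoint form,
are adjoint to each other and generate analytic semigroups. -/
theorem isAdjointOf_and_generates [CompleteSpace H] (hi : DenseRange i)
    (hV : ∀ u, ‖u‖ ^ 2 = ‖i u‖ ^ 2 + ‖D u‖ ^ 2) (hR : ∀ u, ‖R u‖ ≤ 2 * ‖D u‖)
    (hT : ∀ g, ‖T g‖ ≤ 1 / 6 * ‖g‖) (hS : ∀ g, ‖S g‖ ≤ 1 / 6 * ‖g‖) (hc : ‖c‖ = 1)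
    {L M : Set (H × H)}
    (hL : ∀ p, p ∈ L ↔ ∃ u, i u = p.1 ∧ ∀ v, inner ℂ (i v) p.2 =
      inner ℂ (D v) (D u) + inner ℂ (R v) (T (D u)) + c * inner ℂ (S (D v)) (R u))
    (hM : ∀ p, p ∈ M ↔ ∃ u, i u = p.1 ∧ ∀ v, inner ℂ (i v) p.2 =
      inner ℂ (D v) (D u) + inner ℂ (T (D v)) (R u) + conj c * inner ℂ (R v) (S (D u))) :
    IsAdjointOf M L ∧ GeneratesAnalyticSemigroup (negGraph L) (Real.arctan (1 / 2)) ∧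
      GeneratesAnalyticSemigroup (negGraph M) (Real.arctan (1 / 2)) := by
  have h := isSectorialForm_perturbedForm D R T S c hi hV hR hT hS hc
  have hL' : L = (formGraph i (perturbedForm D R T S c) : Set (H × H)) := by
    ext p
    rw [hL, SetLike.mem_coe, mem_formGraph]
    simp only [inner_perturbedForm]
  have hM' : M = (formGraph i (perturbedForm D R T S c).adjoint : Set (H × H)) := by
    ext p
    rw [hM, SetLike.mem_coe, mem_formGraph]
    simp only [inner_adjoint_perturbedForm]
  rw [hL', hM']
  exact ⟨h.isAdjointOf, h.generatesAnalyticSemigroup, h.adjoint.generatesAnalyticSemigroup⟩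

end AbstractForm

/-! ### The operators of the theorem -/

section Operators

theorem norm_norm_smul_landau_le {b : R3} (h : ∀ x : R3, x ≠ 0 → ‖landau b x‖ ≤ 1 / 6 / ‖x‖)
    (x : R3) : ‖‖x‖ • landau b x‖ ≤ 1 / 6 := by
  rcases eq_or_ne x 0 with rfl | hx
  · simp
  · rw [norm_smul, norm_norm, mul_comm, ← le_div_iff₀ (norm_pos_iff.2 hx)]
    exact h x hx

/-- `T` is the multiplication `G ↦ |x| U · G` of gradients of the transport term. -/
theorem exists_landau_transport {b : R3} (h : ∀ x : R3, x ≠ 0 → ‖landau b x‖ ≤ 1 / 6 / ‖x‖) :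
    ∃ T : (PiLp 2 fun _ : Fin 3 => L2) →L[ℂ] L2,
      (∀ G, T G =ᵐ[volume] fun x => ∑ j, ((‖x‖ • landau b x) j : ℂ) • G j x) ∧
      ∀ G, ‖T G‖ ≤ 1 / 6 * ‖G‖ :=
  exists_transport_multiplier (measurable_norm.smul (measurable_landau b)) (by norm_num)
    (norm_norm_smul_landau_le h)

/-- `S` is the multiplication `G ↦ |x| ∑ⱼ Uⱼ ∇wⱼ` of gradients `G = ∇w`. -/
theorem exists_landau_contract {b : R3} (h : ∀ x : R3, x ≠ 0 → ‖landau b x‖ ≤ 1 / 6 / ‖x‖) :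
    ∃ S : (PiLp 2 fun _ : Fin 3 => L2) →L[ℂ] L2,
      (∀ G, S G =ᵐ[volume] fun x => WithLp.toLp 2 fun k =>
        ∑ j, ((‖x‖ • landau b x) j : ℂ) * G k x j) ∧
      ∀ G, ‖S G‖ ≤ 1 / 6 * ‖G‖ :=
  exists_contract_multiplier (measurable_norm.smul (measurable_landau b)) (by norm_num)
    (norm_norm_smul_landau_le h)

variable {b : R3} {T S : (PiLp 2 fun _ : Fin 3 => L2) →L[ℂ] L2}

theorem continuous_pairing (T S : (PiLp 2 fun _ : Fin 3 => L2) →L[ℂ] L2) (c : ℂ) (u : H1σ) :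
    Continuous fun v : H1σ =>
      inner ℂ (gradMap v) (gradMap u) + inner ℂ (hardyMap v) (T (gradMap u)) +
        c * inner ℂ (S (gradMap v)) (hardyMap u) :=
  ((gradMap.continuous.inner continuous_const).add
    (hardyMap.continuous.inner continuous_const)).add
    (continuous_const.mul ((S.continuous.comp gradMap.continuous).inner continuous_const))

theorem continuous_adjoint_pairing (T S : (PiLp 2 fun _ : Fin 3 => L2) →L[ℂ] L2) (c : ℂ) (u : H1σ) :
    Continuous fun v : H1σ =>
      inner ℂ (gradMap v) (gradMap u) + inner ℂ (T (gradMap v)) (hardyMap u) +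
        c * inner ℂ (hardyMap v) (S (gradMap u)) :=
  ((gradMap.continuous.inner continuous_const).add
    ((T.continuous.comp gradMap.continuous).inner continuous_const)).add
    (continuous_const.mul (hardyMap.continuous.inner continuous_const))

theorem mem_opL₁ {p : L2σ × L2σ}
    (hT : ∀ G, T G =ᵐ[volume] fun x => ∑ j, ((‖x‖ • landau b x) j : ℂ) • G j x)
    (hS : ∀ G, S G =ᵐ[volume] fun x => WithLp.toLp 2 fun k =>
      ∑ j, ((‖x‖ • landau b x) j : ℂ) * G k x j) :
    p ∈ opL₁ b ↔ ∃ u, embedding u = p.1 ∧ ∀ v, inner ℂ (embedding v) p.2 =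
      inner ℂ (gradMap v) (gradMap u) + inner ℂ (hardyMap v) (T (gradMap u)) +
        (-1) * inner ℂ (S (gradMap v)) (hardyMap u) := by
  refine mem_lerayGraph_iff (fun u => continuous_pairing T S _ u) (fun u v φ hv => ?_) p
  rw [negLaplacian_eq hv, transport_eq hT hv, divTensor_eq hS hv, neg_one_mul]

theorem mem_opL₂ {p : L2σ × L2σ}
    (hT : ∀ G, T G =ᵐ[volume] fun x => ∑ j, ((‖x‖ • landau b x) j : ℂ) • G j x)
    (hS : ∀ G, S G =ᵐ[volume] fun x => WithLp.toLp 2 fun k =>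
      ∑ j, ((‖x‖ • landau b x) j : ℂ) * G k x j) :
    p ∈ opL₂ b ↔ ∃ u, embedding u = p.1 ∧ ∀ v, inner ℂ (embedding v) p.2 =
      inner ℂ (gradMap v) (gradMap u) + inner ℂ (hardyMap v) (T (gradMap u)) +
        1 * inner ℂ (S (gradMap v)) (hardyMap u) := by
  refine mem_lerayGraph_iff (fun u => continuous_pairing T S _ u) (fun u v φ hv => ?_) p
  rw [negLaplacian_eq hv, transport_eq hT hv, divTensor_eq hS hv, one_mul, sub_neg_eq_add]

theorem mem_opL₁star (hb : b ≠ 0) {p : L2σ × L2σ}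
    (hT : ∀ G, T G =ᵐ[volume] fun x => ∑ j, ((‖x‖ • landau b x) j : ℂ) • G j x)
    (hS : ∀ G, S G =ᵐ[volume] fun x => WithLp.toLp 2 fun k =>
      ∑ j, ((‖x‖ • landau b x) j : ℂ) * G k x j) :
    p ∈ opL₁star b ↔ ∃ u, embedding u = p.1 ∧ ∀ v, inner ℂ (embedding v) p.2 =
      inner ℂ (gradMap v) (gradMap u) + inner ℂ (T (gradMap v)) (hardyMap u) +
        conj (-1) * inner ℂ (hardyMap v) (S (gradMap u)) := by
  refine mem_lerayGraph_iff (fun u => continuous_adjoint_pairing T S _ u) (fun u v φ hv => ?_) p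
  rw [negLaplacian_eq hv, transport_eq hT hv, gradContract_eq hS hv, inner_transport_skew hb hT,
    map_neg, map_one, neg_one_mul, sub_eq_add_neg, sub_eq_add_neg]

theorem mem_opL₂star (hb : b ≠ 0) {p : L2σ × L2σ}
    (hT : ∀ G, T G =ᵐ[volume] fun x => ∑ j, ((‖x‖ • landau b x) j : ℂ) • G j x)
    (hS : ∀ G, S G =ᵐ[volume] fun x => WithLp.toLp 2 fun k =>
      ∑ j, ((‖x‖ • landau b x) j : ℂ) * G k x j) :
    p ∈ opL₂star b ↔ ∃ u, embedding u = p.1 ∧ ∀ v, inner ℂ (embedding v) p.2 =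
      inner ℂ (gradMap v) (gradMap u) + inner ℂ (T (gradMap v)) (hardyMap u) +
        conj 1 * inner ℂ (hardyMap v) (S (gradMap u)) := by
  refine mem_lerayGraph_iff (fun u => continuous_adjoint_pairing T S _ u) (fun u v φ hv => ?_) p
  rw [negLaplacian_eq hv, transport_eq hT hv, gradContract_eq hS hv, inner_transport_skew hb hT,
    map_one, one_mul, sub_eq_add_neg]

theorem isAdjointOf_and_generates_opL₁ (hb : b ≠ 0)
    (h : ∀ x : R3, x ≠ 0 → ‖landau b x‖ ≤ 1 / 6 / ‖x‖) :
    IsAdjointOf (opL₁star b) (opL₁ b) ∧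
      GeneratesAnalyticSemigroup (negGraph (opL₁ b)) (Real.arctan (1 / 2)) ∧
      GeneratesAnalyticSemigroup (negGraph (opL₁star b)) (Real.arctan (1 / 2)) := by
  obtain ⟨T, hT, hTn⟩ := exists_landau_transport h
  obtain ⟨S, hS, hSn⟩ := exists_landau_contract h
  refine isAdjointOf_and_generates (V := H1σ) (G := PiLp 2 fun _ : Fin 3 => L2) (E := L2)
    (H := L2σ) gradMap hardyMap T S (-1) (i := embedding) ?_ ?_ ?_ ?_ ?_ ?_ ?_ ?_
  · exact denseRange_embedding
  · exact norm_sq_H1σ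
  · exact norm_hardyMap_le
  · exact hTn
  · exact hSn
  · simp
  · exact fun p => mem_opL₁ hT hS
  · exact fun p => mem_opL₁star hb hT hS

theorem isAdjointOf_and_generates_opL₂ (hb : b ≠ 0)
    (h : ∀ x : R3, x ≠ 0 → ‖landau b x‖ ≤ 1 / 6 / ‖x‖) :
    IsAdjointOf (opL₂star b) (opL₂ b) ∧
      GeneratesAnalyticSemigroup (negGraph (opL₂ b)) (Real.arctan (1 / 2)) ∧
      GeneratesAnalyticSemigroup (negGraph (opL₂star b)) (Real.arctan (1 / 2)) := by
  obtain ⟨T, hT, hTn⟩ := exists_landau_transport h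
  obtain ⟨S, hS, hSn⟩ := exists_landau_contract h
  refine isAdjointOf_and_generates (V := H1σ) (G := PiLp 2 fun _ : Fin 3 => L2) (E := L2)
    (H := L2σ) gradMap hardyMap T S 1 (i := embedding) ?_ ?_ ?_ ?_ ?_ ?_ ?_ ?_
  · exact denseRange_embedding
  · exact norm_sq_H1σ
  · exact norm_hardyMap_le
  · exact hTn
  · exact hSn
  · simp
  · exact fun p => mem_opL₂ hT hS
  · exact fun p => mem_opL₂star hb hT hS

end Operators

end LandauMHD

theorem theorem3p2 :
    (∃ ε₀ C₀ : ℝ, 0 < ε₀ ∧ 0 < C₀ ∧ LandauMHD.LandauEstimate ε₀ C₀) ∧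
    ∀ ε₀ C₀ : ℝ, 0 < ε₀ → 0 < C₀ → LandauMHD.LandauEstimate ε₀ C₀ →
      ∃ ε : ℝ → ℝ, ∀ b : LandauMHD.R3, b ≠ 0 → ‖b‖ ≤ min ε₀ (1 / (6 * C₀)) →
        (0 < ε ‖b‖ ∧ ε ‖b‖ ≤ Real.pi / 2) ∧
        (LandauMHD.IsAdjointOf (LandauMHD.opL₁star b) (LandauMHD.opL₁ b) ∧
          LandauMHD.IsAdjointOf (LandauMHD.opL₂star b) (LandauMHD.opL₂ b)) ∧
        LandauMHD.GeneratesAnalyticSemigroup (LandauMHD.negGraph (LandauMHD.opL₁ b)) (ε ‖b‖) ∧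
        LandauMHD.GeneratesAnalyticSemigroup (LandauMHD.negGraph (LandauMHD.opL₂ b)) (ε ‖b‖) ∧
        LandauMHD.GeneratesAnalyticSemigroup (LandauMHD.negGraph (LandauMHD.opL₁star b)) (ε ‖b‖) ∧
        LandauMHD.GeneratesAnalyticSemigroup (LandauMHD.negGraph (LandauMHD.opL₂star b)) (ε ‖b‖)
    := by
  refine ⟨⟨8 * Real.pi, 11, by positivity, by norm_num, LandauMHD.landauEstimate_of_lt⟩,
    fun ε₀ C₀ _ hC hE => ⟨fun _ => Real.arctan (1 / 2), fun b hb hle => ?_⟩⟩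
  have h : ∀ x : LandauMHD.R3, x ≠ 0 → ‖LandauMHD.landau b x‖ ≤ 1 / 6 / ‖x‖ := fun x hx => by
    refine (LandauMHD.norm_landau_le hE hb (hle.trans (min_le_left _ _)) hx).trans ?_
    refine div_le_div_of_nonneg_right ?_ (norm_nonneg x)
    refine (mul_le_mul_of_nonneg_left (hle.trans (min_le_right _ _)) hC.le).trans_eq ?_
    field_simp
  obtain ⟨a1, g1, g1'⟩ := LandauMHD.isAdjointOf_and_generates_opL₁ hb h
  obtain ⟨a2, g2, g2'⟩ := LandauMHD.isAdjointOf_and_generates_opL₂ hb h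
  exact ⟨⟨Real.arctan_pos.2 (by norm_num), (Real.arctan_lt_pi_div_two _).le⟩, ⟨a1, a2⟩,
    g1, g2, g1', g2'⟩
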